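/- **Theorem 3.4.** Let $N\ge 1$, $n\ge 1$, and consider the scalar PDE $\partial_t^N u+g=0$ for $u(t,x)$, $x=(x^1,\dots,x^n)$, where $g$ is a smooth function of $t,x$ and finitely many of the derivatives $\partial_t^j\partial_x^\alpha u$ with $j<N$. Below, a *differential function* is a smooth function of $t$, $x$ and finitely many such derivatives; all of them are considered on an open set $U$ of the space of the variables $(t,x,(\partial_t^j\partial_x^\alpha u)_{j<N,\,\alpha})$. Let $D_i$ be the total derivative in $x^i$ and $\mathcal D_t$ the total derivative in $t$ on the solution space, i.e. with $\partial_t^N u$ and its differential consequences eliminated through $\partial_t^N\partial_x^\alpha u=-D^\alpha g$. Repeated indices are summed, over all strings $i_1\cdots i_k$, and $\partial/\partial(\partial_t^j u_{i_1\cdots i_k})$ is normalised so that each derivative counts once (it is $\alpha!/|\alpha|!$ times $\partial/\partial(\partial_t^j\partial_x^\alpha u)$, $\alpha$ being the multi-index of the string). A *conservation law* (in normal form) consists of differential functions $\Phi^t,\Phi^1,\dots,\Phi^n$ with $D_t\Phi^t+D_i\Phi^i=0$ on the solution space, that is, $\mathcal D_t\Phi^t+D_i\Phi^i=0$ identically on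 $U$. Densities are *trivial* if $\Phi^t=D_i\theta^i$, $\Phi^i=-\mathcal D_t\theta^i+D_j\psi^{ij}$ for some differential functions $\theta^i$, $\psi^{ij}=-\psi^{ji}$. Two conservation laws are identified if their densities differ by trivial ones. The *multiplier* of a conservation law is $$\Lambda=\sum_{k\ge0}(-1)^kD_{i_1}\cdots D_{i_k}\frac{\partial\Phi^t}{\partial(\partial_t^{N-1}u_{i_1\cdots i_k})}.$$ Put $\Omega_0=\Lambda$ and, for $q=1,\dots,N$, $$\Omega_q=(-1)^q\mathcal D_t^q\Lambda+\sum_{k=1}^q(-1)^{q-k}\mathcal D_t^{q-k}\Big(\sum_{r\ge0}(-1)^rD_{i_1}\cdots D_{i_r}\Big(\frac{\partial g}{\partial(\partial_t^{N-k}u_{i_1\cdots i_r})}\Lambda\Big)\Big).$$ Fix a smooth function $\tilde u(t,x)$ on the projection $B$ of $U$ to $(t,x)$-space, and let $u_{(\lambda)}=\lambda u+(1-\lambda)\tilde u$. Assume that all expressions below are nonsingular, in the sense that $U$ is mapped into itself by $u\mapsto u_{(\lambda)}$ for all $\lambda\in[0,1]$, and that $(\lambda t,\lambda x)\in B$ whenever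 $(t,x)\in B$ and $\lambda\in[0,1]$. Put $K(t,x)=(\partial_t^N\tilde u+g[\tilde u])\,\Lambda[\tilde u]$ and $$S^i[V,W;F]=\sum_{j=0}^{N-1}\sum_{\ell,k\ge0}(-1)^k\big(\mathcal D_t^jD_{i_1}\cdots D_{i_\ell}V\big)\,D_{j_1}\cdots D_{j_k}\Big(\frac{\partial F}{\partial(\partial_t^ju_{i\,i_1\cdots i_\ell j_1\cdots j_k})}W\Big),$$ where for $F=f[u_{(\lambda)}]$ the coefficient is $\partial f/\partial(\partial_t^ju_{\cdots})$ evaluated at $u_{(\lambda)}$. Then, for every conservation law (in particular every nontrivial one), its conserved densities are given in terms of its multiplier $\Lambda$, up to trivial densities, by $$\Phi^t=\int_0^1\sum_{j=0}^{N-1}(\partial_t^ju-\partial_t^j\tilde u)\,\Omega_{N-1-j}[u_{(\lambda)}]\,d\lambda+t\int_0^1\lambda^nK(\lambda t,\lambda x)\,d\lambda,$$ $$\Phi^i=x^i\int_0^1\lambda^nK(\lambda t,\lambda x)\,d\lambda+\int_0^1\Big(S^i\big[u-\tilde u,\Omega_0[u_{(\lambda)}];g[u_{(\lambda)}]\big]+S^i\big[u-\tilde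 u,\;g[u_{(\lambda)}]-\lambda g[u]+(1-\lambda)\partial_t^N\tilde u;\;\Omega_0[u_{(\lambda)}]\big]\Big)d\lambda .$$ That is, these expressions are differential functions on $U$ forming a conservation law, and they differ from the given densities by trivial ones. -/

import Mathlib

open scoped ContDiff

namespace CKScalar

noncomputable section

/-- The space of independent variables `(t, x) = (t, x¹, …, xⁿ)`. -/
abbrev Base (n : ℕ) : Type := ℝ × (Fin n → ℝ)

/-- Labels of the jet variables `∂ₜʲ ∂ₓ^α u` with `j < N` and `α` a multi-index in `x`. -/
abbrev Coord (N n : ℕ) : Type := Fin N × (Fin n → ℕ)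

/-- The space of all values of `t`, `x` and of the derivatives of `u` that remain after
`∂ₜᴺ u = -g` and its differential consequences have been used to eliminate all `t`-derivatives of
order `≥ N`.  Its points are exactly the infinite jets of formal solutions of `∂ₜᴺ u + g = 0`. -/
abbrev Jet (N n : ℕ) : Type := Base n × (Coord N n → ℝ)

variable {N n : ℕ}

/-! ### Differential functions `F(t, x, u, ∂u, …, ∂ᵏu)` -/

/-- Keep only the finitely many jet variables labelled by `s`. -/
def trunc (s : Finset (Coord N n)) (z : Jet N n) : Base n × (s → ℝ) :=
  (z.1, fun c => z.2 c)

/-- `F` is on `U` a smooth function of `t`, `x` and finitely many of the jet variables. -/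
def IsDiffFun (U : Set (Jet N n)) (F : Jet N n → ℝ) : Prop :=
  ∃ (s : Finset (Coord N n)) (f : Base n × (s → ℝ) → ℝ),
    ContDiffOn ℝ ∞ f (trunc s '' U) ∧ ∀ z ∈ U, F z = f (trunc s z)

/-- `D^α = D₁^{α₁} ⋯ Dₙ^{αₙ}` for a family of operators `D₁, …, Dₙ`. -/
def multiIter {A : Type*} (D : Fin n → A → A) (α : Fin n → ℕ) (F : A) : A :=
  (List.finRange n).foldr (fun i f => (D i)^[α i] f) F

/-- `D_I = D_{i₁} ⋯ D_{i_k}` for a family of operators and an index string `I = i₁ ⋯ i_k`. -/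
def listIter {A : Type*} (D : Fin n → A → A) (I : List (Fin n)) (F : A) : A :=
  I.foldr D F

/-- `∂F/∂(∂ₜʲ ∂ₓ^α u)`, where `c = (j, α)`. -/
def pCoord (c : Coord N n) (F : Jet N n → ℝ) (z : Jet N n) : ℝ :=
  deriv (fun r => F (z.1, Function.update z.2 c r)) (z.2 c)

/-- The explicit partial derivative `∂F/∂t`. -/
def pT (F : Jet N n → ℝ) (z : Jet N n) : ℝ :=
  deriv (fun r => F ((r, z.1.2), z.2)) z.1.1

/-- The explicit partial derivative `∂F/∂xⁱ`. -/
def pX (i : Fin n) (F : Jet N n → ℝ) (z : Jet N n) : ℝ :=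
  deriv (fun r => F ((z.1.1, Function.update z.1.2 i r), z.2)) (z.1.2 i)

/-- The total derivative `D_i` with respect to `xⁱ`. -/
def totD (i : Fin n) (F : Jet N n → ℝ) (z : Jet N n) : ℝ :=
  pX i F z + ∑ᶠ c : Coord N n, z.2 (c.1, c.2 + Pi.single i 1) * pCoord c F z

/-- The total derivative with respect to `t` on the solution space of `∂ₜᴺ u + g = 0`:
`∂ₜᴺ ∂ₓ^α u` is replaced by `-D^α g`. -/
def solDt (g F : Jet N n → ℝ) (z : Jet N n) : ℝ :=
  pT F z + ∑ᶠ c : Coord N n,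
    (if h : c.1.1 + 1 < N then z.2 (⟨c.1.1 + 1, h⟩, c.2) else -(multiIter totD c.2 g z))
      * pCoord c F z

/-- `∂F/∂(∂ₜʲ u_{i₁⋯i_k})` for an index string `I = i₁ ⋯ i_k`, normalised (`α! / |α|!` times the
partial derivative with respect to `∂ₜʲ ∂ₓ^α u`, with `α` the multi-index of `I`) so that sums
over all index strings, as in the summation convention, count each derivative once. -/
def pString (j : Fin N) (I : List (Fin n)) (F : Jet N n → ℝ) (z : Jet N n) : ℝ :=
  ((∏ i, ((I.count i).factorial : ℝ)) / (I.length.factorial : ℝ))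
    * pCoord (j, fun i => I.count i) F z

/-! ### Conservation laws in normal form -/

/-- `D_t Φᵗ + D_i Φⁱ = 0` on the solution space of `∂ₜᴺ u + g = 0`. -/
structure IsConservationLaw (U : Set (Jet N n)) (g Φt : Jet N n → ℝ)
    (Φx : Fin n → Jet N n → ℝ) : Prop where
  smooth_t : IsDiffFun U Φt
  smooth_x : ∀ i, IsDiffFun U (Φx i)
  conserved : ∀ z ∈ U, solDt g Φt z + ∑ i, totD i (Φx i) z = 0

/-- `Φᵗ = D_i θⁱ`, `Φⁱ = -D_t θⁱ + D_j ψⁱʲ` with `ψⁱʲ = -ψʲⁱ`, on the solution space. -/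
def IsTrivialLaw (U : Set (Jet N n)) (g Φt : Jet N n → ℝ)
    (Φx : Fin n → Jet N n → ℝ) : Prop :=
  ∃ (θ : Fin n → Jet N n → ℝ) (ψ : Fin n → Fin n → Jet N n → ℝ),
    (∀ i, IsDiffFun U (θ i)) ∧ (∀ i j, IsDiffFun U (ψ i j)) ∧
    (∀ i j, ∀ z ∈ U, ψ i j z = -ψ j i z) ∧
    (∀ z ∈ U, Φt z = ∑ i, totD i (θ i) z) ∧
    (∀ i, ∀ z ∈ U, Φx i z = -solDt g (θ i) z + ∑ j, totD j (ψ i j) z)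

/-- `∑_k (-1)^k D_{i₁} ⋯ D_{i_k} ( ∂F/∂(∂ₜʲ u_{i₁⋯i_k}) · W )`. -/
def adjLin (j : Fin N) (F W : Jet N n → ℝ) (z : Jet N n) : ℝ :=
  ∑ᶠ I : List (Fin n), (-1) ^ I.length * listIter totD I (fun y => pString j I F y * W y) z

/-- The multiplier `Λ = Ê(Φᵗ)` of a conservation law, where `Ê` is the restricted Euler operator
`∂/∂(∂ₜᴺ⁻¹u) - D_i ∂/∂(∂ₜᴺ⁻¹u_i) + D_i D_j ∂/∂(∂ₜᴺ⁻¹u_{ij}) - ⋯`. -/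
def multiplier (hN : 0 < N) (Φt : Jet N n → ℝ) : Jet N n → ℝ :=
  adjLin ⟨N - 1, Nat.sub_lt hN Nat.one_pos⟩ Φt (fun _ => 1)

/-- `Ω_q = (-1)^q D_t^q Λ + ∑_{k=1}^q (-1)^{q-k} D_t^{q-k} ( ∂g/∂(∂ₜᴺ⁻ᵏu) Λ - D_i(…) + ⋯ )`, with
`D_t` taken on the solution space.  The summation variable `l` is `k - 1`, and `l.rev = N - k`. -/
def Om (g Λ : Jet N n → ℝ) (q : ℕ) (z : Jet N n) : ℝ :=
  (-1) ^ q * (solDt g)^[q] Λ z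
    + ∑ l : Fin N, if l.1 < q then
        (-1) ^ (q - (l.1 + 1)) * (solDt g)^[q - (l.1 + 1)] (adjLin l.rev g Λ) z
      else 0

/-! ### The construction formula -/

/-- `∂f/∂t` for a function of `(t, x)`. -/
def baseDt (f : Base n → ℝ) (p : Base n) : ℝ :=
  deriv (fun r => f (r, p.2)) p.1

/-- `∂f/∂xⁱ` for a function of `(t, x)`. -/
def baseDx (i : Fin n) (f : Base n → ℝ) (p : Base n) : ℝ :=
  deriv (fun r => f (p.1, Function.update p.2 i r)) (p.2 i)

/-- The point of the jet space given by the derivatives of the function `v` at `p = (t, x)`. -/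
def jetOf (v : Base n → ℝ) (p : Base n) : Jet N n :=
  (p, fun c => (baseDt)^[c.1.1] (multiIter baseDx c.2 v) p)

/-- Passage from `u` to `u_(s) = s u + (1 - s) v`, so that `F[u_(s)]` is `F ∘ interp v s`. -/
def interp (v : Base n → ℝ) (s : ℝ) (z : Jet N n) : Jet N n :=
  (z.1, s • z.2 + (1 - s) • (jetOf v z.1 : Jet N n).2)

/-- `K(t, x) = (∂ₜᴺ v + g[v]) Λ[v]`. -/
def Kfun (g Λ : Jet N n → ℝ) (v : Base n → ℝ) (p : Base n) : ℝ :=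
  ((baseDt)^[N] v p + g (jetOf v p)) * Λ (jetOf v p)

/-- The trilinear expression `Sⁱ[V, W; F[u_(s)]]`,
`∑_j ∑_{I,J} (-1)^{|J|} (D_t^j D_I V) D_J ( ∂F/∂(∂ₜʲ u_{iIJ})[u_(s)] W )`,
the inner sum being over all pairs of index strings. -/
def trilin (g : Jet N n → ℝ) (v : Base n → ℝ) (s : ℝ) (i : Fin n)
    (V W F : Jet N n → ℝ) (z : Jet N n) : ℝ :=
  ∑ j : Fin N, ∑ᶠ P : List (Fin n) × List (Fin n),
    (-1) ^ P.2.length * listIter totD P.1 ((solDt g)^[j.1] V) z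
      * listIter totD P.2
          (fun y => pString j (i :: (P.1 ++ P.2)) F (interp v s y) * W y) z

/-- The density `Φᵗ` of the construction formula; `j.rev = N - 1 - j`. -/
def formulaT (g Λ : Jet N n → ℝ) (v : Base n → ℝ) (z : Jet N n) : ℝ :=
  (∫ s in (0 : ℝ)..1, ∑ j : Fin N,
      (z.2 (j, 0) - (baseDt)^[j.1] v z.1) * Om g Λ j.rev.1 (interp v s z))
    + z.1.1 * ∫ s in (0 : ℝ)..1, s ^ n * Kfun g Λ v (s • z.1)

/-- The densities `Φⁱ` of the construction formula. -/
def formulaX (hN : 0 < N) (g Λ : Jet N n → ℝ) (v : Base n → ℝ) (i : Fin n) (z : Jet N n) : ℝ :=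
  z.1.2 i * (∫ s in (0 : ℝ)..1, s ^ n * Kfun g Λ v (s • z.1))
    + ∫ s in (0 : ℝ)..1,
        (trilin g v s i (fun y => y.2 (⟨0, hN⟩, 0) - v y.1)
            (fun y => Om g Λ 0 (interp v s y)) g z
          + trilin g v s i (fun y => y.2 (⟨0, hN⟩, 0) - v y.1)
            (fun y => g (interp v s y) - s * g y + (1 - s) * (baseDt)^[N] v y.1)
            (Om g Λ 0) z)

end

end CKScalar

/-! Substitute u_(s) = s u + (1-s) ũ into the conservation law and integrate the s-derivative over
[0,1]. Even when u is a solution, u_(s) is not one. The substitution φ therefore commutes with every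
D_i but not with D_t on the solution space. By `hom_Dt` the error is the evolutionary derivation
along φ in the top position with characteristic ρ = g[u_(s)] - s g[u] + (1-s) ∂_t^N ũ (`defect`).
This ρ vanishes at s = 1 and equals ∂_t^N ũ + g[ũ] at s = 0; it is the source of K and of the second
S^i term. By `hom_Ds` the s-derivative of φ is the sum of the evolutionary derivations with
characteristics w_j = ∂_t^j (u - ũ).

Apply the evolutionary derivation with arbitrary characteristic w in position j to D_t Φ^t + D_i Φ^i
= 0, commute it past the total derivatives (`evo_Dt`, `evo_D`) and integrate by parts
(`integration_by_parts`). The outcome has the form w m + ∑ D_i (P_i w) = 0 for all w, with P_i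
linear differential operators in the D_i. Because the algebra contains the coordinates x^i, an
operator determines its symbol (`opOf_injective`), so m + ∑ p_i X_i = 0 as polynomials. Hence m = 0,
and `koszul_exact` writes the p_i through a skew matrix, so that P_i w is a skew divergence. This is
`linearized_law`. For φ = id the equation m = 0 is a descending recursion for the variational
derivatives of Φ^t in the positions j (`EPred_eq`); its solution starting from Λ is Ω_{N-1-j}
(`om_eq_E`).

Put w = w_j and sum over j. Since D_t w_j = w_{j+1}, the boundary terms telescope, and
`homotopy_law` identifies the s-derivative of the densities with the integrands of the formula, up
to trivial terms and the s-derivative of a boundary term B_i that is linear in ρ. After integration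
B_i contributes nothing at s = 1. What remains at s = 0 depends on (t,x) only and has divergence K.
The radial field built from ∫ λ^n K has the same divergence (`divergence_radial`). The difference is
a divergence-free field on a star-shaped base, which is trivial by `poincare`. This gives
`construction_formula`; the formula is then itself conserved because trivial laws are
(`conserved_of_trivial`).

The computation takes place in an abstract `JetAlg`, with the homotopy parameter as one more
coordinate. It is realized by the smooth functions of finitely many coordinates on an open set
containing [0,1] × U, and `Region.Rep` translates back to functions on the jet space. -/

namespace CKScalar

/-! ### Smooth dependence of an integral over [0,1] on parameters. -/

section ParametricIntegral

set_option linter.unusedSectionVars false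

open Filter Topology MeasureTheory

variable {E F : Type} [NormedAddCommGroup E] [NormedSpace ℝ E]
  [NormedAddCommGroup F] [NormedSpace ℝ F]

/-- Compactness of [0,1] turns continuity along the slice into a uniform bound near it. This is the
constant dominating function used below. -/
theorem eventually_bounded_slice {g : E × ℝ → F} {y : E}
    (hg : ∀ r ∈ Set.Icc (0 : ℝ) 1, ContinuousAt g (y, r)) :
    ∃ C : ℝ, ∀ᶠ x in 𝓝 y, ∀ r ∈ Set.Icc (0 : ℝ) 1, ‖g (x, r)‖ ≤ C := by
  have hc : ContinuousOn (fun r : ℝ => g (y, r)) (Set.Icc 0 1) := fun r hr =>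
    (ContinuousAt.comp (g := g) (f := fun r : ℝ => (y, r)) (hg r hr)
      (by fun_prop)).continuousWithinAt
  obtain ⟨C, hC⟩ := isCompact_Icc.exists_bound_of_continuousOn hc
  refine ⟨C + 1, isCompact_Icc.eventually_forall_of_forall_eventually
    (P := fun x r => ‖g (x, r)‖ ≤ C + 1) fun r hr => ?_⟩
  have h1 : ‖g (y, r)‖ < C + 1 := lt_of_le_of_lt (hC r hr) (by linarith)
  exact ((hg r hr).norm.eventually_lt_const h1).mono fun p hp => hp.le

theorem continuousOn_slice {g : E × ℝ → F} {y : E}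
    (hg : ∀ r ∈ Set.Icc (0 : ℝ) 1, ContinuousAt g (y, r)) :
    ContinuousOn (fun r : ℝ => g (y, r)) (Set.uIcc 0 1) := by
  rw [Set.uIcc_of_le zero_le_one]
  exact fun r hr => (ContinuousAt.comp (g := g) (f := fun r : ℝ => (y, r)) (hg r hr)
      (by fun_prop)).continuousWithinAt

/-- Order `∞` is excluded because smoothness at a point only gives neighbourhoods that may shrink as
the order grows. The smooth case is therefore assembled from the finite orders. -/
theorem eventually_contDiffAt_slice {n : WithTop ℕ∞} (hn : n ≠ ∞) {f : E × ℝ → F} {y : E}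
    (hf : ∀ r ∈ Set.Icc (0 : ℝ) 1, ContDiffAt ℝ n f (y, r)) :
    ∀ᶠ x in 𝓝 y, ∀ r ∈ Set.Icc (0 : ℝ) 1, ContDiffAt ℝ n f (x, r) :=
  isCompact_Icc.eventually_forall_of_forall_eventually
    (P := fun x r => ContDiffAt ℝ n f (x, r)) fun r hr => (hf r hr).eventually hn

theorem continuousAt_parametric_integral {f : E × ℝ → F} {y : E}
    (hf : ∀ r ∈ Set.Icc (0 : ℝ) 1, ContDiffAt ℝ 0 f (y, r)) :
    ContinuousAt (fun x => ∫ r in (0 : ℝ)..1, f (x, r)) y := by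
  obtain ⟨C, hC⟩ := eventually_bounded_slice fun r hr => (hf r hr).continuousAt
  have hev := eventually_contDiffAt_slice (n := 0) (by simp) hf
  refine intervalIntegral.continuousAt_of_dominated_interval (bound := fun _ => C) ?_ ?_
    intervalIntegrable_const ?_
  · filter_upwards [hev] with x hx
    exact (continuousOn_slice fun r hr => (hx r hr).continuousAt).intervalIntegrable.def'.1
  · filter_upwards [hC] with x hx
    refine Eventually.of_forall fun r hr => hx r ?_
    rw [Set.uIoc_of_le zero_le_one] at hr
    exact Set.Ioc_subset_Icc_self hr
  · refine Eventually.of_forall fun r hr => ?_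
    rw [Set.uIoc_of_le zero_le_one] at hr
    exact ContinuousAt.comp (g := f) (f := fun x : E => (x, r))
      (hf r (Set.Ioc_subset_Icc_self hr)).continuousAt (by fun_prop)

theorem hasFDerivAt_parametric_integral {f : E × ℝ → F} {y : E}
    (hf : ∀ r ∈ Set.Icc (0 : ℝ) 1, ContDiffAt ℝ 1 f (y, r)) :
    HasFDerivAt (fun x => ∫ r in (0 : ℝ)..1, f (x, r))
      (∫ r in (0 : ℝ)..1, (fderiv ℝ f (y, r)).comp (ContinuousLinearMap.inl ℝ E ℝ)) y := by
  set f' : E × ℝ → E →L[ℝ] F :=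
    fun p => (fderiv ℝ f p).comp (ContinuousLinearMap.inl ℝ E ℝ) with hf'
  have hf'c : ∀ p, ContDiffAt ℝ 1 f p → ContinuousAt f' p := fun p hp =>
    (((hp.fderiv_right (m := 0) (by simp)).continuousAt).clm_comp continuousAt_const)
  obtain ⟨C, hC⟩ := eventually_bounded_slice fun r hr => hf'c _ (hf r hr)
  have hev := eventually_contDiffAt_slice (n := 1) (by simp) hf
  refine intervalIntegral.hasFDerivAt_integral_of_dominated_of_fderiv_le (𝕜 := ℝ)
    (F := fun x r => f (x, r)) (F' := fun x r => f' (x, r)) (hC.and hev) ?_ ?_ ?_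
    (bound := fun _ => C) ?_ intervalIntegrable_const ?_
  · filter_upwards [hev] with x hx
    exact (continuousOn_slice fun r hr => (hx r hr).continuousAt).intervalIntegrable.def'.1
  · exact (continuousOn_slice fun r hr => (hf r hr).continuousAt).intervalIntegrable
  · exact (continuousOn_slice (g := f') fun r hr => hf'c _
      (hf r hr)).intervalIntegrable.def'.1
  · refine Eventually.of_forall fun r hr x hx => hx.1 r ?_
    rw [Set.uIoc_of_le zero_le_one] at hr
    exact Set.Ioc_subset_Icc_self hr
  · refine Eventually.of_forall fun r hr x hx => ?_
    rw [Set.uIoc_of_le zero_le_one] at hr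
    have h1 := ((hx.2 r (Set.Ioc_subset_Icc_self hr)).differentiableAt (by simp)).hasFDerivAt
    exact h1.comp x (hasFDerivAt_prodMk_left x r)

/-- The derivative is an integral of the same kind, one order less smooth and with values in `E
→L[ℝ] F`; hence the induction generalizes the codomain. -/
theorem contDiffAt_parametric_integral_nat (n : ℕ) {F : Type} [NormedAddCommGroup F]
    [NormedSpace ℝ F] {f : E × ℝ → F} {y : E}
    (hf : ∀ r ∈ Set.Icc (0 : ℝ) 1, ContDiffAt ℝ n f (y, r)) :
    ContDiffAt ℝ n (fun x => ∫ r in (0 : ℝ)..1, f (x, r)) y := by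
  induction n generalizing F y with
  | zero =>
    have hev := eventually_contDiffAt_slice (n := (0 : ℕ)) (by simp) hf
    have : ContDiffAt ℝ 0 (fun x => ∫ r in (0 : ℝ)..1, f (x, r)) y := by
      refine contDiffAt_zero.2 ⟨_, hev, fun x hx => ?_⟩
      exact (continuousAt_parametric_integral (by exact_mod_cast hx)).continuousWithinAt
    exact_mod_cast this
  | succ n ih =>
    rw [Nat.cast_succ] at *
    refine contDiffAt_succ_iff_hasFDerivAt.2 ⟨fun x => ∫ r in (0 : ℝ)..1,
      (fderiv ℝ f (x, r)).comp (ContinuousLinearMap.inl ℝ E ℝ), ⟨_,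
        eventually_contDiffAt_slice (n := n + 1) (by exact_mod_cast ENat.natCast_ne_top (n + 1)) hf, fun x hx => ?_⟩,
        ih (f := fun p => (fderiv ℝ f p).comp (ContinuousLinearMap.inl ℝ E ℝ))
          fun r hr => ?_⟩
    · exact hasFDerivAt_parametric_integral fun r hr => (hx r hr).of_le (by simp)
    · exact ((hf r hr).fderiv_right (m := n) le_rfl).clm_comp contDiffAt_const

theorem contDiffAt_parametric_integral {f : E × ℝ → F} {y : E}
    (hf : ∀ r ∈ Set.Icc (0 : ℝ) 1, ContDiffAt ℝ ∞ f (y, r)) :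
    ContDiffAt ℝ ∞ (fun x => ∫ r in (0 : ℝ)..1, f (x, r)) y :=
  contDiffAt_infty.2 fun n => contDiffAt_parametric_integral_nat n fun r hr =>
    contDiffAt_infty.1 (hf r hr) n

end ParametricIntegral

end CKScalar

namespace CKScalar

noncomputable section

open TopologicalSpace

/-! ### The algebra of smooth functions of finitely many coordinates. -/

section Cylinder

set_option linter.unusedSectionVars false

variable {ι : Type} [DecidableEq ι] {W : Opens (ι → ℝ)}

/-- Restriction of a point of `ℝ^ι` to finitely many coordinates. -/
def res (S : Finset ι) (q : ι → ℝ) : S → ℝ := fun b => q b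

/-- Smooth functions of finitely many coordinates on an open subset of `ℝ^ι`. -/
def IsCyl (W : Opens (ι → ℝ)) (F : W → ℝ) : Prop :=
  ∃ (S : Finset ι) (f : (S → ℝ) → ℝ),
    ∀ q : W, ContDiffAt ℝ ∞ f (res S q.1) ∧ F q = f (res S q.1)

/-- Smoothness of `g` is needed only at the values attained, so functions smooth on just a part of
the base, such as the reference function, may be substituted. -/
theorem isCyl_comp {K : Type} [Fintype K] {F : W → ℝ} (G : K → W → ℝ) (hG : ∀ k, IsCyl W (G k))
    (g : (K → ℝ) → ℝ) (hg : ∀ q, ContDiffAt ℝ ∞ g (fun k => G k q))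
    (hF : ∀ q, F q = g (fun k => G k q)) : IsCyl W F := by
  choose S f hf using hG
  have hS : ∀ k, S k ⊆ Finset.univ.biUnion S := fun k =>
    Finset.subset_biUnion_of_mem S (Finset.mem_univ k)
  refine ⟨Finset.univ.biUnion S, fun y => g (fun k => f k (Finset.restrict₂ (π := fun _ => ℝ) (hS k) y)),
    fun q => ?_⟩
  have h1 : ∀ k, Finset.restrict₂ (π := fun _ => ℝ) (hS k)
      (res (Finset.univ.biUnion S) q.1) = res (S k) q.1 := fun k => rfl
  constructor
  · have h2 : ContDiffAt ℝ ∞ (fun y k => f k (Finset.restrict₂ (π := fun _ => ℝ) (hS k) y))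
        (res (Finset.univ.biUnion S) q.1) := by
      refine contDiffAt_pi.2 fun k => ?_
      have h3 : ContDiffAt ℝ ∞ (Finset.restrict₂ (π := fun _ => ℝ) (hS k))
          (res (Finset.univ.biUnion S) q.1) :=
        contDiffAt_pi.2 fun i => contDiffAt_apply ℝ ℝ _ _
      exact ContDiffAt.comp (g := f k) _ (by rw [h1]; exact (hf k q).1) h3
    refine ContDiffAt.comp (g := g) _ ?_ h2
    simp only [h1, ← (hf _ q).2]
    exact hg q
  · simp only [h1, ← (hf _ q).2]
    exact hF q

theorem isCyl_coord (b : ι) : IsCyl W (fun q => q.1 b) :=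
  ⟨{b}, fun y => y ⟨b, by simp⟩, fun _ => ⟨contDiffAt_apply ℝ ℝ _ _, rfl⟩⟩

theorem isCyl_const (c : ℝ) : IsCyl W (fun _ => c) :=
  ⟨∅, fun _ => c, fun _ => ⟨contDiffAt_const, rfl⟩⟩

theorem IsCyl.comp₂ {F G : W → ℝ} (hF : IsCyl W F) (hG : IsCyl W G) (g : ℝ → ℝ → ℝ)
    (hg : ContDiff ℝ ∞ (fun p : ℝ × ℝ => g p.1 p.2)) : IsCyl W (fun q => g (F q) (G q)) := by
  refine isCyl_comp (K := Bool) (fun k => cond k F G) (by rintro (_ | _) <;> assumption)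
    (fun y => g (y true) (y false)) (fun q => ?_) (fun q => rfl)
  exact (hg.comp ((contDiff_apply ℝ ℝ true).prodMk (contDiff_apply ℝ ℝ false))).contDiffAt

variable (W) in
/-- The algebra of smooth functions of finitely many coordinates. -/
def CylAlg : Subalgebra ℝ (W → ℝ) where
  carrier := {F | IsCyl W F}
  mul_mem' hF hG := IsCyl.comp₂ hF hG (· * ·) (by fun_prop)
  add_mem' hF hG := IsCyl.comp₂ hF hG (· + ·) (by fun_prop)
  algebraMap_mem' c := isCyl_const c

variable (W) in
/-- The elements of `CylAlg W`. -/
def Cyl : Type := CylAlg W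

instance : CommRing (Cyl W) := inferInstanceAs (CommRing (CylAlg W))

instance : Algebra ℝ (Cyl W) := inferInstanceAs (Algebra ℝ (CylAlg W))

namespace Cyl

/-- A cylindrical function as an element of the algebra. -/
def mk (F : W → ℝ) (hF : IsCyl W F) : Cyl W := ⟨F, hF⟩

instance : CoeFun (Cyl W) fun _ => W → ℝ := ⟨fun F => F.1⟩

theorem isCyl (F : Cyl W) : IsCyl W F := F.2

@[ext] theorem ext {F G : Cyl W} (h : ∀ q, F q = G q) : F = G := Subtype.ext (funext h)

@[simp] theorem mk_apply (F : W → ℝ) (hF : IsCyl W F) (q : W) : mk F hF q = F q := rfl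
@[simp] theorem add_apply (F G : Cyl W) (q : W) : (F + G) q = F q + G q := rfl
@[simp] theorem mul_apply (F G : Cyl W) (q : W) : (F * G) q = F q * G q := rfl
@[simp] theorem neg_apply (F : Cyl W) (q : W) : (-F) q = -F q := rfl
@[simp] theorem sub_apply (F G : Cyl W) (q : W) : (F - G) q = F q - G q := rfl
@[simp] theorem smul_apply (c : ℝ) (F : Cyl W) (q : W) : (c • F) q = c * F q := rfl
@[simp] theorem zero_apply (q : W) : (0 : Cyl W) q = 0 := rfl
@[simp] theorem one_apply (q : W) : (1 : Cyl W) q = 1 := rfl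

/-- Evaluation at a point. -/
def eval (q : W) : Cyl W →ₐ[ℝ] ℝ where
  toFun F := F q
  map_one' := rfl
  map_mul' _ _ := rfl
  map_zero' := rfl
  map_add' _ _ := rfl
  commutes' _ := rfl

theorem sum_apply {κ : Type*} (s : Finset κ) (f : κ → Cyl W) (q : W) :
    (∑ i ∈ s, f i) q = ∑ i ∈ s, f i q := map_sum (eval q) f s

@[simp] theorem pow_apply (F : Cyl W) (k : ℕ) (q : W) : (F ^ k) q = F q ^ k :=
  map_pow (eval q) F k

end Cyl

/-- Extension of a function by zero. -/
def extZero (F : W → ℝ) (q : ι → ℝ) : ℝ :=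
  open Classical in if h : q ∈ W then F ⟨q, h⟩ else 0

theorem extZero_of_mem (F : W → ℝ) {q : ι → ℝ} (h : q ∈ W) : extZero F q = F ⟨q, h⟩ := dif_pos h

/-- `F` factors through the coordinates in `S`, so the chain rule needs differentiability of these
finitely many components of the curve only. -/
theorem hasDerivAt_curve {F : W → ℝ} {S : Finset ι} {f : (S → ℝ) → ℝ}
    (hf : ∀ q : W, ContDiffAt ℝ ∞ f (res S q.1) ∧ F q = f (res S q.1))
    {γ : ℝ → ι → ℝ} {γ' : ι → ℝ} {r : ℝ} (hr : γ r ∈ W) (hγ : ∀ᶠ x in nhds r, γ x ∈ W)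
    (hd : ∀ b ∈ S, HasDerivAt (fun x => γ x b) (γ' b) r) :
    HasDerivAt (fun x => extZero F (γ x)) (fderiv ℝ f (res S (γ r)) (res S γ')) r := by
  have h1 : HasDerivAt (fun x => res S (γ x)) (res S γ') r :=
    hasDerivAt_pi.2 fun b => hd b b.2
  have h2 := (((hf ⟨_, hr⟩).1.differentiableAt (by simp)).hasFDerivAt).comp_hasDerivAt r h1
  refine h2.congr_of_eventuallyEq ?_
  filter_upwards [hγ] with x hx
  rw [extZero_of_mem F hx, (hf ⟨_, hx⟩).2]
  rfl

theorem eventually_update_mem (q : W) (b : ι) : ∀ᶠ x in nhds (q.1 b), Function.update q.1 b x ∈ W := by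
  have : ContinuousAt (fun x => Function.update q.1 b x) (q.1 b) := by
    fun_prop
  refine this.eventually_mem (W.2.mem_nhds ?_)
  rw [Function.update_eq_self]
  exact q.2

theorem hasDerivAt_update {F : W → ℝ} {S : Finset ι} {f : (S → ℝ) → ℝ}
    (hf : ∀ q : W, ContDiffAt ℝ ∞ f (res S q.1) ∧ F q = f (res S q.1)) (q : W) (b : ι) :
    HasDerivAt (fun x => extZero F (Function.update q.1 b x))
      (fderiv ℝ f (res S q.1) (res S (Pi.single b 1))) (q.1 b) := by
  have := hasDerivAt_curve hf (γ := fun x => Function.update q.1 b x) (γ' := Pi.single b 1)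
    (r := q.1 b) (by simp [q.2]) (eventually_update_mem q b) (fun c _ => by
      have := _root_.hasDerivAt_update q.1 b (q.1 b)
      exact (hasDerivAt_pi.1 this) c)
  simpa using this

/-- The partial derivative with respect to the coordinate `b`. -/
def pdFun (b : ι) (F : W → ℝ) (q : W) : ℝ :=
  deriv (fun x => extZero F (Function.update q.1 b x)) (q.1 b)

theorem pdFun_eq {F : W → ℝ} {S : Finset ι} {f : (S → ℝ) → ℝ}
    (hf : ∀ q : W, ContDiffAt ℝ ∞ f (res S q.1) ∧ F q = f (res S q.1)) (q : W) (b : ι) :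
    pdFun b F q = fderiv ℝ f (res S q.1) (res S (Pi.single b 1)) :=
  (hasDerivAt_update hf q b).deriv

theorem IsCyl.hasDerivAt {F : W → ℝ} (hF : IsCyl W F) (b : ι) (q : W) :
    HasDerivAt (fun x => extZero F (Function.update q.1 b x)) (pdFun b F q) (q.1 b) := by
  obtain ⟨S, f, hf⟩ := hF
  rw [pdFun_eq hf]
  exact hasDerivAt_update hf q b

theorem pdFun_rep {F : W → ℝ} {S : Finset ι} {f : (S → ℝ) → ℝ}
    (hf : ∀ q : W, ContDiffAt ℝ ∞ f (res S q.1) ∧ F q = f (res S q.1)) (b : ι) (q : W) :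
    ContDiffAt ℝ ∞ (fun y => fderiv ℝ f y (res S (Pi.single b 1))) (res S q.1) ∧
      pdFun b F q = (fun y => fderiv ℝ f y (res S (Pi.single b 1))) (res S q.1) :=
  ⟨((hf q).1.fderiv_right (m := ∞) (by simp)).clm_apply contDiffAt_const, pdFun_eq hf q b⟩

theorem IsCyl.pdFun {F : W → ℝ} (hF : IsCyl W F) (b : ι) : IsCyl W (pdFun b F) := by
  obtain ⟨S, f, hf⟩ := hF
  exact ⟨S, _, pdFun_rep hf b⟩

theorem extZero_add (F G : W → ℝ) : extZero (F + G) = extZero F + extZero G := by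
  ext q; by_cases h : q ∈ W <;> simp [extZero, h]

theorem extZero_mul (F G : W → ℝ) : extZero (F * G) = extZero F * extZero G := by
  ext q; by_cases h : q ∈ W <;> simp [extZero, h]

theorem extZero_smul (c : ℝ) (F : W → ℝ) : extZero (c • F) = c • extZero F := by
  ext q; by_cases h : q ∈ W <;> simp [extZero, h]

theorem pdFun_add {F G : W → ℝ} (hF : IsCyl W F) (hG : IsCyl W G) (b : ι) :
    pdFun b (F + G) = pdFun b F + pdFun b G := by
  ext q
  have h := (hF.hasDerivAt b q).add (hG.hasDerivAt b q)
  rw [pdFun, extZero_add]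
  exact h.deriv

theorem pdFun_smul {F : W → ℝ} (hF : IsCyl W F) (c : ℝ) (b : ι) :
    pdFun b (c • F) = c • pdFun b F := by
  ext q
  have h := (hF.hasDerivAt b q).const_smul c
  rw [pdFun, extZero_smul]
  exact h.deriv

theorem pdFun_mul {F G : W → ℝ} (hF : IsCyl W F) (hG : IsCyl W G) (b : ι) :
    pdFun b (F * G) = F * pdFun b G + G * pdFun b F := by
  ext q
  have h := (hF.hasDerivAt b q).mul (hG.hasDerivAt b q)
  simp only [Function.update_eq_self, extZero_of_mem _ q.2] at h
  rw [pdFun, extZero_mul]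
  refine h.deriv.trans ?_
  simp only [Pi.add_apply, Pi.mul_apply]
  ring

/-- The partial derivative as a derivation. -/
def pd (b : ι) : Derivation ℝ (Cyl W) (Cyl W) :=
  Derivation.mk'
    { toFun := fun F => Cyl.mk (pdFun b F) (F.isCyl.pdFun b)
      map_add' := fun F G => Subtype.ext (pdFun_add F.2 G.2 b)
      map_smul' := fun c F => Subtype.ext (pdFun_smul F.2 c b) }
    fun F G => Subtype.ext (pdFun_mul F.2 G.2 b)

theorem pd_apply (b : ι) (F : Cyl W) (q : W) : pd b F q = pdFun b F q := rfl

theorem pd_eq_zero {F : Cyl W} {S : Finset ι} {f : (S → ℝ) → ℝ}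
    (hf : ∀ q : W, ContDiffAt ℝ ∞ f (res S q.1) ∧ F q = f (res S q.1))
    {b : ι} (hb : b ∉ S) : pd b F = 0 := by
  refine Cyl.ext fun q => ?_
  rw [pd_apply, pdFun_eq hf]
  have : res S (Pi.single b (1 : ℝ)) = 0 := by
    ext c
    have : (c : ι) ≠ b := fun h => hb (h ▸ c.2)
    simp [res, this]
  rw [this, map_zero]
  rfl

theorem finite_support_pd (F : Cyl W) : (Function.support fun b => pd b F).Finite := by
  obtain ⟨S, f, hf⟩ := F.2
  refine S.finite_toSet.subset fun b hb => ?_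
  by_contra h
  exact hb (pd_eq_zero hf h)

/-- Both iterated derivatives are values of the second Fréchet derivative of one finite-dimensional
representative, which is symmetric. -/
theorem pd_comm (b c : ι) (F : Cyl W) : pd b (pd c F) = pd c (pd b F) := by
  obtain ⟨S, f, hf⟩ := F.2
  refine Cyl.ext fun q => ?_
  have key : ∀ b c : ι, pd b (pd c F) q = fderiv ℝ (fderiv ℝ f) (res S q.1)
      (res S (Pi.single b 1)) (res S (Pi.single c 1)) := fun b c => by
    rw [pd_apply, pdFun_eq (F := pd c F) (pdFun_rep hf c)]
    have h1 : DifferentiableAt ℝ (fderiv ℝ f) (res S q.1) :=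
      ((hf q).1.fderiv_right (m := ∞) (by simp)).differentiableAt (by simp)
    have h2 := ((ContinuousLinearMap.apply ℝ ℝ (res S (Pi.single c 1))).hasFDerivAt.comp _
      h1.hasFDerivAt).fderiv
    exact DFunLike.congr_fun h2 _
  rw [key, key]
  exact (hf q).1.isSymmSndFDerivAt (by simp only [minSmoothness_of_isRCLikeNormedField]; exact WithTop.coe_le_coe.2 le_top) _ _

/-- The family of all partial derivatives. -/
def difFun (F : Cyl W) : ι →₀ Cyl W :=
  Finsupp.ofSupportFinite (fun b => pd b F) (finite_support_pd F)

theorem difFun_apply (F : Cyl W) (b : ι) : difFun F b = pd b F := rfl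

/-- The differential, with values in finitely supported families indexed by the coordinates. -/
def dif : Derivation ℝ (Cyl W) (ι →₀ Cyl W) :=
  Derivation.mk'
    { toFun := difFun
      map_add' := fun F G => Finsupp.ext fun b => by
        rw [Finsupp.add_apply, difFun_apply, difFun_apply, difFun_apply, map_add]
      map_smul' := fun c F => Finsupp.ext fun b => by
        rw [RingHom.id_apply, Finsupp.smul_apply, difFun_apply, difFun_apply,
          (pd b).map_smul] }
    fun F G => Finsupp.ext fun b => by
      rw [Finsupp.add_apply, Finsupp.smul_apply, Finsupp.smul_apply]
      exact (pd b).leibniz F G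

theorem dif_apply (F : Cyl W) (b : ι) : dif F b = pd b F := rfl

/-- The coordinate functions. -/
def coord (W : Opens (ι → ℝ)) (b : ι) : Cyl W := Cyl.mk (fun q => q.1 b) (isCyl_coord b)

theorem dif_coord (b : ι) : dif (coord W b) = Finsupp.single b 1 := by
  ext1 c
  refine Cyl.ext fun q => ?_
  rw [dif_apply, pd_apply]
  have h1 := pdFun_eq (F := (coord W b).1) (S := {b}) (f := fun y => y ⟨b, by simp⟩)
    (fun _ => ⟨contDiffAt_apply ℝ ℝ _ _, rfl⟩) q c
  have h2 := (ContinuousLinearMap.proj (R := ℝ) (φ := fun _ : ({b} : Finset ι) => ℝ)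
    ⟨b, by simp⟩).hasFDerivAt (x := res {b} q.1)
  refine h1.trans ((DFunLike.congr_fun h2.fderiv _).trans ?_)
  by_cases h : b = c
  · subst h; simp [res]
  · simp [res, h]

theorem isCyl_pull {W' : Opens (ι → ℝ)} (Ψ : W → W') (hΨ : ∀ b, IsCyl W (fun q => (Ψ q).1 b))
    {F : W' → ℝ} (hF : IsCyl W' F) : IsCyl W (fun q => F (Ψ q)) := by
  obtain ⟨S, f, hf⟩ := hF
  exact isCyl_comp (K := S) (fun k q => (Ψ q).1 k) (fun k => hΨ k) f (fun q => (hf (Ψ q)).1)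
    fun q => (hf (Ψ q)).2

/-- Pull-back along a map with cylindrical coordinates. -/
def pull (Ψ : W → W) (hΨ : ∀ b, IsCyl W (fun q => (Ψ q).1 b)) : Cyl W →ₐ[ℝ] Cyl W where
  toFun F := Cyl.mk (fun q => F (Ψ q)) (isCyl_pull Ψ hΨ F.isCyl)
  map_one' := rfl
  map_mul' _ _ := rfl
  map_zero' := rfl
  map_add' _ _ := rfl
  commutes' _ := rfl

theorem fderiv_restrict_eq_sum {F : Cyl W} {S : Finset ι} {f : (S → ℝ) → ℝ}
    (hf : ∀ q : W, ContDiffAt ℝ ∞ f (res S q.1) ∧ F q = f (res S q.1)) (q : W)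
    (e : ι → ℝ) :
    fderiv ℝ f (res S q.1) (res S e) = (dif F).sum fun b a => e b * a q := by
  rw [Finsupp.sum_of_support_subset (s := S) _ (fun b hb => by
    by_contra h
    exact Finsupp.mem_support_iff.1 hb (pd_eq_zero hf h)) _ (fun b _ => mul_zero _)]
  have : res S e = ∑ b ∈ S, e b • res S (Pi.single b (1 : ℝ)) := by
    ext c
    simp [Finset.sum_apply, Pi.single_apply, res]
  rw [this, map_sum]
  refine Finset.sum_congr rfl fun b _ => ?_
  rw [map_smul, smul_eq_mul, dif_apply, pd_apply, pdFun_eq hf]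

theorem dif_pull (Ψ : W → W) (hΨ : ∀ b, IsCyl W (fun q => (Ψ q).1 b)) (F : Cyl W) :
    dif (pull Ψ hΨ F) = (dif F).sum fun b a => pull Ψ hΨ a • dif (pull Ψ hΨ (coord W b)) := by
  ext1 c
  refine Cyl.ext fun q => ?_
  rw [Finsupp.sum, Finsupp.finsetSum_apply, Cyl.sum_apply, dif_apply, pd_apply]
  obtain ⟨S, f, hf⟩ := F.2
  -- `Ψ` is defined on `W` only, so the curve is formed from its coordinates extended by zero; near
  -- `q.1 c` the extension plays no role.
  have h1 := fun h h' => hasDerivAt_curve hf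
    (γ := fun x b => extZero (fun q => (Ψ q).1 b) (Function.update q.1 c x))
    (γ' := fun b => pdFun c (pull Ψ hΨ (coord W b)) q) (r := q.1 c) h h'
    fun b _ => (pull Ψ hΨ (coord W b)).isCyl.hasDerivAt c q
  · have h2 : (fun b => extZero (fun q => (Ψ q).1 b) (Function.update q.1 c (q.1 c)))
        = (Ψ q).1 := by
      ext b
      simp [extZero]
    specialize h1 ?_ ?_
    · rw [h2]; exact (Ψ q).2
    · filter_upwards [eventually_update_mem q c] with x hx
      convert (Ψ ⟨_, hx⟩).2 using 1
      ext b
      simp [extZero, hx]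
    rw [h2, fderiv_restrict_eq_sum hf] at h1
    rw [pdFun, HasDerivAt.deriv (HasDerivAt.congr_of_eventuallyEq h1 _)]
    · refine Finset.sum_congr rfl fun b _ => ?_
      change _ = (pull Ψ hΨ (dif F b)) q * _
      rw [mul_comm]
      rfl
    · filter_upwards [eventually_update_mem q c] with x hx
      rw [extZero_of_mem _ hx]
      have : (fun b => extZero (fun q => (Ψ q).1 b) (Function.update q.1 c x))
        = (Ψ ⟨_, hx⟩).1 := by
        ext b
        simp [extZero, hx]
      rw [this, extZero_of_mem _ (Ψ ⟨_, hx⟩).2]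
      rfl

/-- `F` does not depend on the coordinate `s`. -/
def Cyl.IndepOf (s : ι) (F : Cyl W) : Prop :=
  ∀ (q : W) (r : ℝ) (h : Function.update q.1 s r ∈ W), F ⟨_, h⟩ = F q

theorem Cyl.IndepOf.pd_eq_zero {s : ι} {F : Cyl W} (hF : F.IndepOf s) : pd s F = 0 := by
  ext q
  rw [pd_apply, pdFun]
  refine HasDerivAt.deriv ?_
  refine (hasDerivAt_const _ (F q)).congr_of_eventuallyEq ?_
  filter_upwards [eventually_update_mem q s] with x hx
  rw [extZero_of_mem _ hx]
  exact hF q x hx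

/-! ### Integration over one coordinate. -/

section Average

variable (s : ι)

/-- Replace the coordinate `s` by `r`. -/
def resetFun (S : Finset ι) (p : (S → ℝ) × ℝ) : S → ℝ :=
  fun b => if b.1 = s then p.2 else p.1 b

theorem resetFun_res (S : Finset ι) (q : ι → ℝ) (r : ℝ) :
    resetFun s S (res S q, r) = res S (Function.update q s r) := by
  ext b
  simp [resetFun, res, Function.update_apply]

theorem contDiff_resetFun (S : Finset ι) : ContDiff ℝ ∞ (resetFun s S) := by
  refine contDiff_pi.2 fun b => ?_
  by_cases h : b.1 = s
  · simpa [resetFun, h] using contDiff_snd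
  · simp only [resetFun, h, if_false]
    fun_prop

theorem avg_rep (hs : ∀ q ∈ W, ∀ r ∈ Set.Icc (0 : ℝ) 1, Function.update q s r ∈ W)
    {F : W → ℝ} {S : Finset ι} {f : (S → ℝ) → ℝ}
    (hf : ∀ q : W, ContDiffAt ℝ ∞ f (res S q.1) ∧ F q = f (res S q.1)) (q : W) :
    ContDiffAt ℝ ∞ (fun y => ∫ r in (0 : ℝ)..1, f (resetFun s S (y, r))) (res S q.1) ∧
      ∫ r in (0 : ℝ)..1, extZero F (Function.update q.1 s r) =
        ∫ r in (0 : ℝ)..1, f (resetFun s S (res S q.1, r)) := by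
  constructor
  · refine contDiffAt_parametric_integral (f := fun p => f (resetFun s S p)) fun r hr => ?_
    refine ContDiffAt.comp (g := f) _ ?_ (contDiff_resetFun s S).contDiffAt
    rw [resetFun_res]
    exact (hf ⟨_, hs q q.2 r hr⟩).1
  · refine intervalIntegral.integral_congr fun r hr => ?_
    rw [Set.uIcc_of_le zero_le_one] at hr
    simp only [extZero_of_mem _ (hs q q.2 r hr), resetFun_res, (hf ⟨_, hs q q.2 r hr⟩).2]

theorem continuousOn_extZero_update (hs : ∀ q ∈ W, ∀ r ∈ Set.Icc (0 : ℝ) 1, Function.update q s r ∈ W)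
    {F : W → ℝ} (hF : IsCyl W F) (q : W) :
    ContinuousOn (fun r => extZero F (Function.update q.1 s r)) (Set.uIcc 0 1) := by
  intro r hr
  rw [Set.uIcc_of_le zero_le_one] at hr
  have := (hF.hasDerivAt s ⟨_, hs q q.2 r hr⟩).continuousAt
  simp only [Function.update_idem, Function.update_self] at this
  exact this.continuousWithinAt

theorem intervalIntegrable_extZero_update (hs : ∀ q ∈ W, ∀ r ∈ Set.Icc (0 : ℝ) 1, Function.update q s r ∈ W)
    {F : W → ℝ} (hF : IsCyl W F) (q : W) :
    IntervalIntegrable (fun r => extZero F (Function.update q.1 s r)) MeasureTheory.volume 0 1 :=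
  (continuousOn_extZero_update s hs hF q).intervalIntegrable

/-- Integration over the unit interval in the coordinate `s`. -/
def avg (hs : ∀ q ∈ W, ∀ r ∈ Set.Icc (0 : ℝ) 1, Function.update q s r ∈ W)
    : Cyl W →ₗ[ℝ] Cyl W where
  toFun F := Cyl.mk (fun q => ∫ r in (0 : ℝ)..1, extZero F (Function.update q.1 s r)) (by
    obtain ⟨S, f, hf⟩ := F.isCyl
    exact ⟨S, _, avg_rep s hs hf⟩)
  map_add' F G := by
    ext q
    rw [Cyl.add_apply, Cyl.mk_apply, Cyl.mk_apply, Cyl.mk_apply, ← intervalIntegral.integral_add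
      (intervalIntegrable_extZero_update s hs F.isCyl q)
      (intervalIntegrable_extZero_update s hs G.isCyl q)]
    exact intervalIntegral.integral_congr fun r _ => congrFun (extZero_add F.1 G.1) _
  map_smul' c F := by
    ext q
    rw [RingHom.id_apply, Cyl.smul_apply, Cyl.mk_apply, Cyl.mk_apply,
      ← intervalIntegral.integral_const_mul]
    exact intervalIntegral.integral_congr fun r _ => congrFun (extZero_smul c F.1) _

theorem avg_apply (hs : ∀ q ∈ W, ∀ r ∈ Set.Icc (0 : ℝ) 1, Function.update q s r ∈ W)
    (F : Cyl W) (q : W) :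
    avg s hs F q = ∫ r in (0 : ℝ)..1, extZero F (Function.update q.1 s r) := rfl

theorem avg_mul (hs : ∀ q ∈ W, ∀ r ∈ Set.Icc (0 : ℝ) 1, Function.update q s r ∈ W)
    {A : Cyl W} (hA : A.IndepOf s) (F : Cyl W) :
    avg s hs (A * F) = A * avg s hs F := by
  ext q
  rw [Cyl.mul_apply, avg_apply, avg_apply, ← intervalIntegral.integral_const_mul]
  refine intervalIntegral.integral_congr fun r hr => ?_
  rw [Set.uIcc_of_le zero_le_one] at hr
  simp only [extZero_of_mem _ (hs q q.2 r hr), Cyl.mul_apply, hA q r (hs q q.2 r hr)]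

theorem avg_pd_self (hs : ∀ q ∈ W, ∀ r ∈ Set.Icc (0 : ℝ) 1, Function.update q s r ∈ W)
    (F : Cyl W) (q : W) :
    avg s hs (pd s F) q = F ⟨_, hs q q.2 1 (by simp)⟩ - F ⟨_, hs q q.2 0 (by simp)⟩ := by
  rw [avg_apply, ← extZero_of_mem (F := F.1), ← extZero_of_mem (F := F.1)]
  refine intervalIntegral.integral_eq_sub_of_hasDerivAt
    (f := fun r => extZero F (Function.update q.1 s r)) (fun r hr => ?_)
    (intervalIntegrable_extZero_update s hs (pd s F).isCyl q)
  rw [Set.uIcc_of_le zero_le_one] at hr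
  have := F.isCyl.hasDerivAt s ⟨_, hs q q.2 r hr⟩
  simp only [Function.update_idem, Function.update_self] at this
  rwa [extZero_of_mem _ (hs q q.2 r hr)]

/-- Differentiation under the integral sign, after passing to the finite-dimensional representative.
-/
theorem pd_avg (hs : ∀ q ∈ W, ∀ r ∈ Set.Icc (0 : ℝ) 1, Function.update q s r ∈ W)
    {b : ι} (hb : b ≠ s) (F : Cyl W) : pd b (avg s hs F) = avg s hs (pd b F) := by
  obtain ⟨S, f, hf⟩ := F.isCyl
  ext q
  rw [pd_apply, pdFun_eq (F := avg s hs F) (avg_rep s hs hf), avg_apply]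
  have hc : ∀ r ∈ Set.Icc (0 : ℝ) 1,
      ContDiffAt ℝ ∞ (fun p => f (resetFun s S p)) (res S q.1, r) := fun r hr => by
    refine ContDiffAt.comp (g := f) _ ?_ (contDiff_resetFun s S).contDiffAt
    rw [resetFun_res]
    exact (hf ⟨_, hs q q.2 r hr⟩).1
  have h1 := hasFDerivAt_parametric_integral (f := fun p => f (resetFun s S p))
    (y := res S q.1) fun r hr => (hc r hr).of_le (by simp)
  rw [h1.fderiv, ContinuousLinearMap.intervalIntegral_apply]
  · refine intervalIntegral.integral_congr fun r hr => ?_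
    rw [Set.uIcc_of_le zero_le_one] at hr
    simp only [extZero_of_mem _ (hs q q.2 r hr), pd_apply]
    rw [pdFun_eq hf]
    have h2 : HasDerivAt (fun x : ℝ => f (resetFun s S (res S (Function.update q.1 b x), r)))
        (fderiv ℝ f (res S (Function.update q.1 s r)) (res S (Pi.single b 1))) (q.1 b) := by
      have h3 := hasDerivAt_update hf ⟨_, hs q q.2 r hr⟩ b
      simp only [Function.update_of_ne hb] at h3
      refine h3.congr_of_eventuallyEq ?_
      have h4 := eventually_update_mem ⟨_, hs q q.2 r hr⟩ b
      simp only [Function.update_of_ne hb] at h4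
      filter_upwards [h4] with x hx
      rw [extZero_of_mem _ hx, (hf ⟨_, hx⟩).2, resetFun_res, Function.update_comm hb]
    have h5 : HasDerivAt (fun x : ℝ => (res S (Function.update q.1 b x), r))
        (res S (Pi.single b 1), 0) (q.1 b) := by
      refine HasDerivAt.prodMk ?_ (hasDerivAt_const _ _)
      have := _root_.hasDerivAt_update q.1 b (q.1 b)
      exact hasDerivAt_pi.2 fun c => (hasDerivAt_pi.1 this) c
    have h6 := ((hc r hr).differentiableAt (by simp)).hasFDerivAt
    rw [← Function.update_eq_self b q.1] at h6
    have h7 := HasFDerivAt.comp_hasDerivAt (q.1 b) h6 h5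
    simp only [Function.update_eq_self] at h7
    exact h7.unique h2
  · refine ContinuousOn.intervalIntegrable ?_
    refine continuousOn_slice (g := fun p => (fderiv ℝ (fun p => f (resetFun s S p)) p).comp
      (ContinuousLinearMap.inl ℝ (S → ℝ) ℝ)) fun r hr => ?_
    exact (((hc r hr).fderiv_right (m := 0) (by simp)).continuousAt).clm_comp continuousAt_const

end Average

end Cylinder

end

end CKScalar

namespace CKScalar

noncomputable section

/-! ### Derivations with prescribed components and their compositions. -/

section VectorFields

variable {ι R : Type} [CommRing R] [Algebra ℝ R] (d : Derivation ℝ R (ι →₀ R))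

/-- The derivation with prescribed components. -/
def vf (Y : ι → R) : Derivation ℝ R R := (Finsupp.linearCombination R Y).compDer d

/-- The derivation along the homomorphism `φ` with prescribed components. -/
def vfa (φ : R →ₐ[ℝ] R) (Y : ι → R) (F : R) : R := (d F).sum fun b a => Y b * φ a

/-- The second order part of a composition of two derivations. -/
def hess (φ : R →ₐ[ℝ] R) (Y Z : ι → R) (F : R) : R :=
  (d F).sum fun b a => Y b * vfa d φ Z a

variable {d} {φ : R →ₐ[ℝ] R} {Y Z : ι → R}

theorem vf_eq_sum (F : R) : vf d Y F = (d F).sum fun b a => a * Y b := rfl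

theorem vf_eq_vfa (F : R) : vf d Y F = vfa d (AlgHom.id ℝ R) Y F := by
  rw [vf_eq_sum, vfa]
  simp only [AlgHom.id_apply, mul_comm]

theorem vfa_eq_of_subset {s : Finset ι} {F : R} (hs : (d F).support ⊆ s) :
    vfa d φ Y F = ∑ b ∈ s, Y b * φ (d F b) :=
  Finsupp.sum_of_support_subset _ hs _ fun b _ => by simp

theorem hess_eq_of_subset {s : Finset ι} {F : R} (hs : (d F).support ⊆ s) :
    hess d φ Y Z F = ∑ b ∈ s, Y b * vfa d φ Z (d F b) :=
  Finsupp.sum_of_support_subset _ hs _ fun b _ => by simp [vfa]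

theorem vfa_add (F G : R) : vfa d φ Y (F + G) = vfa d φ Y F + vfa d φ Y G := by
  rw [vfa, map_add, Finsupp.sum_add_index' (by simp) (by intros; simp [mul_add])]; rfl

theorem vfa_zero : vfa d φ Y 0 = 0 := by simp [vfa]

theorem vfa_sum {κ : Type*} (s : Finset κ) (f : κ → R) :
    vfa d φ Y (∑ i ∈ s, f i) = ∑ i ∈ s, vfa d φ Y (f i) :=
  map_sum (AddMonoidHom.mk' (vfa d φ Y) vfa_add) f s

theorem vfa_mul (F G : R) : vfa d φ Y (F * G) = φ F * vfa d φ Y G + φ G * vfa d φ Y F := by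
  classical
  have h1 : (d (F * G)).support ⊆ (d F).support ∪ (d G).support := by
    rw [d.leibniz]
    refine Finsupp.support_add.trans (Finset.union_subset ?_ ?_)
    · exact Finsupp.support_smul.trans Finset.subset_union_right
    · exact Finsupp.support_smul.trans Finset.subset_union_left
  rw [vfa_eq_of_subset h1, vfa_eq_of_subset (F := F) Finset.subset_union_left,
    vfa_eq_of_subset (F := G) (Finset.subset_union_right (s₁ := (d F).support)),
    Finset.mul_sum, Finset.mul_sum,
    ← Finset.sum_add_distrib]
  refine Finset.sum_congr rfl fun b _ => ?_
  rw [d.leibniz]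
  simp only [Finsupp.add_apply, Finsupp.smul_apply, smul_eq_mul, map_add, map_mul]
  ring

theorem vfa_add_field (F : R) :
    vfa d φ (fun b => Y b + Z b) F = vfa d φ Y F + vfa d φ Z F := by
  simp [vfa, add_mul, Finsupp.sum_add]

theorem vfa_sub_field (F : R) :
    vfa d φ (fun b => Y b - Z b) F = vfa d φ Y F - vfa d φ Z F := by
  simp [vfa, sub_mul, Finsupp.sum_sub]

theorem vfa_sum_field {κ : Type*} (s : Finset κ) (Y : κ → ι → R) (F : R) :
    vfa d φ (fun b => ∑ i ∈ s, Y i b) F = ∑ i ∈ s, vfa d φ (Y i) F := by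
  simp only [vfa, Finsupp.sum, Finset.sum_mul]
  exact Finset.sum_comm

theorem hess_add_right (Z' : ι → R) (F : R) :
    hess d φ Y (fun b => Z b + Z' b) F = hess d φ Y Z F + hess d φ Y Z' F := by
  simp [hess, vfa_add_field, mul_add, Finsupp.sum_add]

/-- Symmetry of mixed partial derivatives. The set `s` contains every coordinate occurring in `d F`
or in the differential of one of its components, so both double sums run over the same square. -/
theorem hess_comm (hd : ∀ (F : R) (b c : ι), d (d F b) c = d (d F c) b) (F : R) :
    hess d φ Y Z F = hess d φ Z Y F := by
  classical
  set s := (d F).support ∪ (d F).support.biUnion fun b => (d (d F b)).support with hs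
  have h1 : (d F).support ⊆ s := Finset.subset_union_left
  have h2 : ∀ b, (d (d F b)).support ⊆ s := by
    intro b
    by_cases hb : b ∈ (d F).support
    · exact (Finset.subset_biUnion_of_mem (fun b => (d (d F b)).support) hb).trans
        Finset.subset_union_right
    · rw [Finsupp.notMem_support_iff] at hb
      simp [hb]
  rw [hess_eq_of_subset h1, hess_eq_of_subset h1]
  simp only [vfa_eq_of_subset (h2 _), Finset.mul_sum]
  rw [Finset.sum_comm]
  refine Finset.sum_congr rfl fun b _ => Finset.sum_congr rfl fun c _ => ?_
  rw [hd F c b]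
  ring

/-- The Leibniz rule separates the derivative of the components of the inner field from a
second-order part. With `vf_vfa` and `hess_comm`, the commutators below reduce to a comparison of
components. -/
theorem vfa_vf (X : ι → R) (F : R) :
    vfa d φ Y (vf d X F) = vfa d φ (fun b => vfa d φ Y (X b)) F
      + hess d φ (fun b => φ (X b)) Y F := by
  rw [vf_eq_sum, Finsupp.sum, vfa_sum, vfa, hess, Finsupp.sum, Finsupp.sum,
    ← Finset.sum_add_distrib]
  refine Finset.sum_congr rfl fun b _ => ?_
  rw [vfa_mul]
  ring

theorem vf_vfa {X Z : ι → R} (hX : ∀ G, vf d X (φ G) = vfa d φ Z G) (F : R) :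
    vf d X (vfa d φ Y F) = vfa d φ (fun b => vf d X (Y b)) F + hess d φ Y Z F := by
  rw [vfa, Finsupp.sum, map_sum, vfa, hess, Finsupp.sum, Finsupp.sum,
    ← Finset.sum_add_distrib]
  refine Finset.sum_congr rfl fun b _ => ?_
  rw [Derivation.leibniz, smul_eq_mul, smul_eq_mul, hX]
  ring

theorem vf_comm (hd : ∀ (F : R) (b c : ι), d (d F b) c = d (d F c) b) {X Y : ι → R}
    (h : ∀ b, vf d X (Y b) = vf d Y (X b)) (F : R) :
    vf d X (vf d Y F) = vf d Y (vf d X F) := by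
  rw [vf_eq_vfa, vf_eq_vfa (Y := Y) (vf d X F), vfa_vf, vfa_vf, hess_comm hd]
  congr 1
  congr 1
  ext b
  rw [← vf_eq_vfa, ← vf_eq_vfa, h]

end VectorFields

end

end CKScalar

/-! ### Iterated derivatives indexed by multi-indices. -/

namespace CKScalar

noncomputable section

/-- The operators are applied in the order of the list, so the additional factor `D i` has to be
moved out past those standing before it; without repetitions it is met at most once. -/
theorem foldr_iterate_add_single {A κ : Type*} [DecidableEq κ] (D : κ → A → A)
    (hD : ∀ i j F, D i (D j F) = D j (D i F)) (l : List κ) (hl : l.Nodup) (α : κ → ℕ) (i : κ)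
    (F : A) :
    l.foldr (fun j f => (D j)^[(α + Pi.single i 1 : κ → ℕ) j] f) F =
      if i ∈ l then D i (l.foldr (fun j f => (D j)^[α j] f) F)
      else l.foldr (fun j f => (D j)^[α j] f) F := by
  induction l with
  | nil => simp
  | cons j l ih =>
    rw [List.nodup_cons] at hl
    rw [List.foldr_cons, ih hl.2, List.foldr_cons]
    by_cases hij : i = j
    · subst hij
      simp only [hl.1, if_false, List.mem_cons, true_or, if_true, Pi.add_apply,
        Pi.single_eq_same, Function.iterate_succ_apply']
    · simp only [List.mem_cons, hij, false_or, Pi.add_apply, Pi.single_eq_of_ne (Ne.symm hij),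
        add_zero]
      split_ifs
      · exact (Function.Commute.iterate_left (f := D j) (g := D i) (fun F => hD j i F) _ _)
      · rfl

section MultiIter

variable {n : ℕ} {A : Type*} (D : Fin n → A → A)

theorem multiIter_zero (F : A) : multiIter D 0 F = F := by
  rw [multiIter]
  induction List.finRange n with
  | nil => rfl
  | cons j l ih => rw [List.foldr_cons, ih]; rfl

theorem multiIter_add_single (hD : ∀ i j F, D i (D j F) = D j (D i F)) (α : Fin n → ℕ)
    (i : Fin n) (F : A) : multiIter D (α + Pi.single i 1) F = D i (multiIter D α F) := by
  have := foldr_iterate_add_single D hD (List.finRange n) (List.nodup_finRange n) α i F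
  rwa [if_pos (List.mem_finRange i)] at this

theorem multiIter_induction {P : (Fin n → ℕ) → Prop} (h0 : P 0)
    (hs : ∀ α i, P α → P (α + Pi.single i 1)) (α : Fin n → ℕ) : P α := by
  induction h : ∑ i, α i generalizing α with
  | zero =>
    have : α = 0 := by
      ext i
      exact Finset.sum_eq_zero_iff.1 h i (Finset.mem_univ i)
    rw [this]; exact h0
  | succ m ih =>
    obtain ⟨i, -, hi⟩ : ∃ i ∈ Finset.univ, α i ≠ 0 := by
      by_contra! hc
      rw [Finset.sum_eq_zero hc] at h
      omega
    have hα : α = (α - Pi.single i 1 : Fin n → ℕ) + Pi.single i 1 := by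
      ext j
      by_cases hj : j = i
      · subst hj; simp; omega
      · simp [hj]
    rw [hα]
    refine hs _ i (ih _ ?_)
    have h2 : ∑ j, α j = ∑ j, (α - Pi.single i 1 : Fin n → ℕ) j + 1 := by
      conv_lhs => rw [hα]
      simp [Finset.sum_add_distrib]
    omega

end MultiIter

/-! ### Linear differential operators and their symbols. -/

section Operators

open MvPolynomial

variable {n : ℕ} {R : Type} [CommRing R] [Algebra ℝ R] (D : Fin n → Derivation ℝ R R)

/-- The operator `w ↦ ∑ D^α (p_α w)` with total symbol `p`. -/
def opOf (p : MvPolynomial (Fin n) R) (w : R) : R :=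
  ∑ α ∈ p.support, multiIter (fun i => ⇑(D i)) α (coeff α p * w)

variable {D}

theorem multiIter_add (α : Fin n → ℕ) (F G : R) :
    multiIter (fun i => ⇑(D i)) α (F + G) =
      multiIter (fun i => ⇑(D i)) α F + multiIter (fun i => ⇑(D i)) α G := by
  rw [multiIter, multiIter, multiIter]
  induction List.finRange n with
  | nil => rfl
  | cons j l ih => rw [List.foldr_cons, List.foldr_cons, List.foldr_cons, ih, iterate_map_add]

theorem multiIter_map_zero (α : Fin n → ℕ) : multiIter (fun i => ⇑(D i)) α (0 : R) = 0 := by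
  have := multiIter_add (D := D) α 0 0
  simpa using this

theorem opOf_eq_of_subset {p : MvPolynomial (Fin n) R} {s : Finset (Fin n →₀ ℕ)}
    (hs : p.support ⊆ s) (w : R) :
    opOf D p w = ∑ α ∈ s, multiIter (fun i => ⇑(D i)) α (coeff α p * w) :=
  Finset.sum_subset hs fun α _ hα => by
    rw [notMem_support_iff.1 hα, zero_mul, multiIter_map_zero]

theorem opOf_add (p q : MvPolynomial (Fin n) R) (w : R) :
    opOf D (p + q) w = opOf D p w + opOf D q w := by
  classical
  rw [opOf_eq_of_subset (support_add (p := p) (q := q)),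
    opOf_eq_of_subset (p := p) (s := p.support ∪ q.support) Finset.subset_union_left,
    opOf_eq_of_subset (p := q) (s := p.support ∪ q.support) Finset.subset_union_right,
    ← Finset.sum_add_distrib]
  refine Finset.sum_congr rfl fun α _ => ?_
  rw [coeff_add, add_mul, multiIter_add]

theorem opOf_zero (w : R) : opOf D 0 w = 0 := by
  have := opOf_add (D := D) 0 0 w
  simpa using this

theorem opOf_sum {κ : Type*} (s : Finset κ) (p : κ → MvPolynomial (Fin n) R) (w : R) :
    opOf D (∑ i ∈ s, p i) w = ∑ i ∈ s, opOf D (p i) w :=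
  map_sum (AddMonoidHom.mk' (fun p => opOf D p w) fun p q => opOf_add p q w) p s

theorem opOf_monomial (α : Fin n →₀ ℕ) (a w : R) :
    opOf D (monomial α a) w = multiIter (fun i => ⇑(D i)) α (a * w) := by
  classical
  rw [opOf_eq_of_subset support_monomial_subset, Finset.sum_singleton, coeff_monomial, if_pos rfl]

theorem opOf_C (a w : R) : opOf D (C a) w = a * w := by
  rw [C_apply, opOf_monomial, Finsupp.coe_zero, multiIter_zero]

theorem opOf_neg (p : MvPolynomial (Fin n) R) (w : R) : opOf D (-p) w = -opOf D p w :=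
  map_neg (AddMonoidHom.mk' (fun p => opOf D p w) fun p q => opOf_add p q w) p

/-- In `opOf` the coefficients stand inside the derivatives, so one more outer derivative is exactly
a factor `X i`, with no Leibniz terms. A divergence of operators thus has symbol `∑ p i * X i`. -/
theorem opOf_mul_X (hD : ∀ i j F, D i (D j F) = D j (D i F)) (p : MvPolynomial (Fin n) R)
    (i : Fin n) (w : R) : opOf D (p * X i) w = D i (opOf D p w) := by
  induction p using MvPolynomial.induction_on' with
  | monomial α a =>
    rw [X, monomial_mul, mul_one, opOf_monomial, opOf_monomial, Finsupp.coe_add,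
      Finsupp.single_eq_pi_single, multiIter_add_single _ hD]
  | add p q hp hq => rw [add_mul, opOf_add, hp, hq, opOf_add, map_add]

/-- The commutator with multiplication by a coordinate differentiates the symbol, which lowers its
degree. -/
theorem opOf_mul_coord (hD : ∀ i j F, D i (D j F) = D j (D i F)) {x : Fin n → R}
    (hx : ∀ i j, D i (x j) = if i = j then 1 else 0) (p : MvPolynomial (Fin n) R)
    (i : Fin n) (w : R) : opOf D p (x i * w) = x i * opOf D p w + opOf D (pderiv i p) w := by
  induction p using MvPolynomial.induction_on with
  | C a => rw [pderiv_C, opOf_zero, opOf_C, opOf_C]; ring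
  | add p q hp hq => rw [map_add, opOf_add, opOf_add, opOf_add, hp, hq]; ring
  | mul_X p j hp =>
    rw [opOf_mul_X hD, hp, pderiv_mul, opOf_add, opOf_mul_X hD, opOf_mul_X hD, map_add,
      Derivation.leibniz, hx, pderiv_X]
    by_cases h : j = i
    · subst h
      simp only [if_true, Pi.single_eq_same, mul_one, smul_eq_mul]
      ring
    · simp only [h, if_false, Pi.single_eq_of_ne h, mul_zero, opOf_zero, smul_eq_mul]
      ring

/-- A coefficient with exponent `α i ≠ 0` reappears in `pderiv i p` multiplied by `α i`, which is
invertible since `R` is a real algebra. -/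
theorem eq_C_of_pderiv_eq_zero {p : MvPolynomial (Fin n) R} (h : ∀ i, pderiv i p = 0) :
    p = C (coeff 0 p) := by
  ext α
  rw [coeff_C]
  split_ifs with h0
  · rw [h0]
  · obtain ⟨i, hi⟩ : ∃ i, α i ≠ 0 := by
      by_contra! hc
      exact h0 (Finsupp.ext fun i => (hc i).symm)
    have h1 := congrArg (coeff (α - Finsupp.single i 1)) (h i)
    rw [coeff_pderiv, coeff_zero] at h1
    have h2 : α - Finsupp.single i 1 + Finsupp.single i 1 = α := by
      refine tsub_add_cancel_of_le ?_
      rw [Finsupp.single_le_iff]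
      omega
    rw [h2] at h1
    have h3 : (((α - Finsupp.single i 1 : Fin n →₀ ℕ) i + 1 : ℕ) : ℝ) • coeff α p = 0 := by
      rw [Algebra.smul_def, map_natCast, mul_comm, ← h1]
      push_cast
      ring
    have hpos : (((α - Finsupp.single i 1 : Fin n →₀ ℕ) i + 1 : ℕ) : ℝ) ≠ 0 := by positivity
    exact (smul_eq_zero_iff_eq (Units.mk0 _ hpos)).1 h3

/-- Induction on the degree. If `p` acts as zero then so does each `pderiv i p`, by
`opOf_mul_coord`, and these vanish by induction. What is left is a multiplication operator, tested
on `1`. -/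
theorem opOf_injective (hD : ∀ i j F, D i (D j F) = D j (D i F)) {x : Fin n → R}
    (hx : ∀ i j, D i (x j) = if i = j then 1 else 0) {p : MvPolynomial (Fin n) R}
    (h : ∀ w, opOf D p w = 0) : p = 0 := by
  have hC : ∀ q : MvPolynomial (Fin n) R, (∀ w, opOf D q w = 0) → (∀ i, pderiv i q = 0) →
      q = 0 := fun q hq hq' => by
    have h1 := eq_C_of_pderiv_eq_zero hq'
    have h2 := hq 1
    rw [h1, opOf_C, mul_one] at h2
    rw [h1, h2, map_zero]
  have key : ∀ m, ∀ q : MvPolynomial (Fin n) R, q.totalDegree ≤ m → (∀ w, opOf D q w = 0) →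
      q = 0 := by
    intro m
    induction m with
    | zero =>
      intro q hq h0
      refine hC q h0 fun i => ?_
      rw [totalDegree_eq_zero_iff_eq_C.1 (Nat.le_zero.1 hq), pderiv_C]
    | succ m ih =>
      intro q hq h0
      refine hC q h0 fun i => ih _ ?_ fun w => ?_
      · refine Finset.sup_le fun α hα => ?_
        rw [mem_support_iff, coeff_pderiv] at hα
        have h1 := le_totalDegree (mem_support_iff.2 (left_ne_zero_of_mul hα))
        rw [Finsupp.sum_add_index' (fun _ => rfl) (fun _ _ _ => rfl),
          Finsupp.sum_single_index rfl] at h1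
        omega
      · have := opOf_mul_coord hD hx q i w
        rw [h0, h0] at this
        simpa using this.symm
  exact key _ p le_rfl h

/-- For the homogeneous parts of degree d, Euler's identity together with the X_i-derivative of ∑
p_k X_k = 0 gives ∑_k (∂_k p_i - ∂_i p_k) X_k = (d+1) p_i. Dividing by d+1 yields the skew matrix.
-/
theorem koszul_exact {p : Fin n → MvPolynomial (Fin n) R} (hp : ∑ i, p i * X i = 0) :
    ∃ ψ : Fin n → Fin n → MvPolynomial (Fin n) R, (∀ i k, ψ i k = -ψ k i) ∧
      ∀ i, p i = ∑ k, ψ i k * X k := by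
  obtain ⟨M, hM⟩ : ∃ M, ∀ i, (p i).totalDegree < M :=
    ⟨∑ i, (p i).totalDegree + 1, fun i => Nat.lt_succ_of_le
      (Finset.single_le_sum (f := fun i => (p i).totalDegree) (fun _ _ => Nat.zero_le _)
        (Finset.mem_univ i))⟩
  have hsum : ∀ i, p i = ∑ d ∈ Finset.range M, homogeneousComponent d (p i) := fun i => by
    conv_lhs => rw [← sum_homogeneousComponent (p i)]
    refine Finset.sum_subset (Finset.range_mono (hM i)) fun d _ hd => ?_
    refine homogeneousComponent_eq_zero _ _ ?_
    simpa using hd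
  have hhom : ∀ d i, (homogeneousComponent d (p i) * X i).IsHomogeneous (d + 1) := fun d i =>
    (homogeneousComponent_isHomogeneous d (p i)).mul (isHomogeneous_X _ _)
  have hzero : ∀ d ∈ Finset.range M, ∑ i, homogeneousComponent d (p i) * X i = 0 := by
    intro d hd
    have h1 : ∑ e ∈ Finset.range M, ∑ i, homogeneousComponent e (p i) * X i = 0 := by
      rw [Finset.sum_comm, ← hp]
      refine Finset.sum_congr rfl fun i _ => ?_
      rw [← Finset.sum_mul, ← hsum]
    have h2 := congrArg (homogeneousComponent (d + 1)) h1
    rw [map_sum, map_zero] at h2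
    rw [← h2, Finset.sum_eq_single d]
    · rw [homogeneousComponent_of_mem (IsHomogeneous.sum _ _ _ fun i _ => hhom d i), if_pos rfl]
    · intro e _ he
      rw [homogeneousComponent_of_mem (IsHomogeneous.sum _ _ _ fun i _ => hhom e i), if_neg]
      omega
    · exact fun h => absurd hd h
  refine ⟨fun i k => ∑ d ∈ Finset.range M, ((d + 1 : ℕ) : ℝ)⁻¹ •
    (pderiv k (homogeneousComponent d (p i)) - pderiv i (homogeneousComponent d (p k))), ?_, ?_⟩
  · intro i k
    rw [← Finset.sum_neg_distrib]
    refine Finset.sum_congr rfl fun d _ => ?_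
    rw [← smul_neg, neg_sub]
  · intro i
    simp only [Finset.sum_mul]
    rw [Finset.sum_comm]
    conv_lhs => rw [hsum i]
    refine Finset.sum_congr rfl fun d hd => ?_
    have h1 := (homogeneousComponent_isHomogeneous d (p i)).sum_X_mul_pderiv
    have h2 := congrArg (pderiv i) (hzero d hd)
    rw [map_sum, map_zero] at h2
    simp only [pderiv_mul, pderiv_X, Finset.sum_add_distrib] at h2
    have h3 : ∑ k, homogeneousComponent d (p k) * Pi.single (M := fun _ => MvPolynomial (Fin n) R) i 1 k
        = homogeneousComponent d (p i) := by
      rw [Finset.sum_eq_single i] <;> simp +contextual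
    have h4 : ∑ k, (pderiv k (homogeneousComponent d (p i))
        - pderiv i (homogeneousComponent d (p k))) * X k
        = ((d + 1 : ℕ) : ℝ) • homogeneousComponent d (p i) := by
      simp only [sub_mul, Finset.sum_sub_distrib]
      rw [Nat.cast_smul_eq_nsmul, add_smul, one_smul, ← h1]
      simp only [mul_comm (X _)]
      have h5 : ∑ k, pderiv i (homogeneousComponent d (p k)) * X k
          = -homogeneousComponent d (p i) := by
        rw [eq_neg_iff_add_eq_zero, ← h2, h3.symm, add_comm]
      rw [h5, sub_neg_eq_add]
    simp only [smul_mul_assoc]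
    rw [← Finset.smul_sum, h4, smul_smul, inv_mul_cancel₀ (by positivity), one_smul]

variable (D) in
/-- `P` is a linear differential operator in the `D i`. -/
def IsOp (P : R → R) : Prop := ∃ p : MvPolynomial (Fin n) R, ∀ w, P w = opOf D p w

theorem isOp_mul_left (a : R) : IsOp D (fun w => a * w) := ⟨C a, fun w => (opOf_C a w).symm⟩

theorem isOp_id : IsOp D (fun w => w) := ⟨C 1, fun w => by rw [opOf_C, one_mul]⟩

theorem IsOp.congr {P Q : R → R} (hP : IsOp D P) (h : ∀ w, Q w = P w) : IsOp D Q := by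
  rwa [funext h]

theorem IsOp.add {P Q : R → R} (hP : IsOp D P) (hQ : IsOp D Q) : IsOp D (fun w => P w + Q w) := by
  obtain ⟨p, hp⟩ := hP
  obtain ⟨q, hq⟩ := hQ
  exact ⟨p + q, fun w => by simp only [opOf_add, hp, hq]⟩

theorem IsOp.neg {P : R → R} (hP : IsOp D P) : IsOp D (fun w => -P w) := by
  obtain ⟨p, hp⟩ := hP
  exact ⟨-p, fun w => by simp only [opOf_neg, hp]⟩

theorem IsOp.sub {P Q : R → R} (hP : IsOp D P) (hQ : IsOp D Q) : IsOp D (fun w => P w - Q w) := by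
  simpa only [sub_eq_add_neg] using hP.add hQ.neg

theorem isOp_zero : IsOp D (fun _ => 0) := ⟨0, fun w => (opOf_zero w).symm⟩

theorem isOp_sum {κ : Type*} (s : Finset κ) {P : κ → R → R} (hP : ∀ k ∈ s, IsOp D (P k)) :
    IsOp D (fun w => ∑ k ∈ s, P k w) := by
  classical
  induction s using Finset.induction_on with
  | empty => simpa using isOp_zero
  | insert a s ha ih =>
    simp only [Finset.sum_insert ha]
    exact (hP a (by simp)).add (ih fun k hk => hP k (by simp [hk]))

theorem IsOp.deriv (hD : ∀ i j F, D i (D j F) = D j (D i F)) {P : R → R} (hP : IsOp D P)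
    (i : Fin n) : IsOp D (fun w => D i (P w)) := by
  obtain ⟨p, hp⟩ := hP
  exact ⟨p * X i, fun w => by simp only [opOf_mul_X hD, hp]⟩

/-- From `a * D i (P w) = D i (a * P w) - D i a * P w`, by induction on the symbol with `a`
arbitrary. -/
theorem IsOp.mul (hD : ∀ i j F, D i (D j F) = D j (D i F)) {P : R → R} (hP : IsOp D P)
    (a : R) : IsOp D (fun w => a * P w) := by
  obtain ⟨p, hp⟩ := hP
  simp only [hp]
  clear hp
  induction p using MvPolynomial.induction_on generalizing a with
  | C b => simpa only [opOf_C, ← mul_assoc] using isOp_mul_left (a * b)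
  | add p q hp hq => simpa only [opOf_add, mul_add] using (hp a).add (hq a)
  | mul_X p i hp =>
    refine (((hp a).deriv hD i).sub (hp (D i a))).congr fun w => ?_
    rw [opOf_mul_X hD, Derivation.leibniz]
    simp only [smul_eq_mul]
    ring

theorem IsOp.comp (hD : ∀ i j F, D i (D j F) = D j (D i F)) {P Q : R → R} (hP : IsOp D P)
    (hQ : IsOp D Q) : IsOp D (fun w => P (Q w)) := by
  obtain ⟨p, hp⟩ := hP
  simp only [hp]
  clear hp
  induction p using MvPolynomial.induction_on with
  | C b => simpa only [opOf_C] using hQ.mul hD b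
  | add p q hp hq => simpa only [opOf_add] using hp.add hq
  | mul_X p i hp => simpa only [opOf_mul_X hD] using hp.deriv hD i

theorem IsOp.listIter (hD : ∀ i j F, D i (D j F) = D j (D i F)) {P : R → R} (hP : IsOp D P)
    (I : List (Fin n)) : IsOp D (fun w => listIter (fun i => ⇑(D i)) I (P w)) := by
  induction I with
  | nil => exact hP
  | cons i I h => exact h.deriv hD i

/-- Exactness of the horizontal complex for linear differential operators. -/
theorem exists_skew_of_divergence_eq (hD : ∀ i j F, D i (D j F) = D j (D i F)) {x : Fin n → R}
    (hx : ∀ i j, D i (x j) = if i = j then 1 else 0) {m : R} {P : Fin n → R → R}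
    (hP : ∀ i, IsOp D (P i)) (h : ∀ w, w * m + ∑ i, D i (P i w) = 0) :
    m = 0 ∧ ∃ ψ : Fin n → Fin n → R → R, (∀ i k w, ψ i k w = -ψ k i w) ∧
      ∀ i w, P i w = ∑ k, D k (ψ i k w) := by
  choose p hp using hP
  -- Injectivity of the symbol turns the identity for all `w` into one between polynomials, whose
  -- constant term is `m`.
  have h0 : C m + ∑ i, p i * X i = 0 := by
    refine opOf_injective hD hx fun w => ?_
    rw [opOf_add, opOf_C, opOf_sum, ← h w, mul_comm]
    simp only [opOf_mul_X hD, hp]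
  have hm : m = 0 := by
    have := congrArg (coeff 0) h0
    have h1 : ∀ i, coeff 0 (p i * X i) = 0 := fun i => by
      rw [coeff_mul_X', if_neg (by simp)]
    simpa [coeff_sum, h1] using this
  rw [hm, map_zero, zero_add] at h0
  obtain ⟨ψ, hψ, hψ'⟩ := koszul_exact h0
  refine ⟨hm, fun i k => opOf D (ψ i k), fun i k w => ?_, fun i w => ?_⟩
  · change opOf D (ψ i k) w = -opOf D (ψ k i) w
    rw [hψ, opOf_neg]
  · rw [hp, hψ' i, opOf_sum]
    simp only [opOf_mul_X hD]

end Operators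

end

end CKScalar

namespace CKScalar

noncomputable section

/-! ### Index strings and integration by parts. -/

section Strings

variable {n : ℕ}

/-- The index strings of length at most `K`. -/
def strs (n : ℕ) : ℕ → Finset (List (Fin n))
  | 0 => {[]}
  | K + 1 => insert [] ((Finset.univ ×ˢ strs n K).image fun p => p.1 :: p.2)

theorem mem_strs {K : ℕ} {I : List (Fin n)} : I ∈ strs n K ↔ I.length ≤ K := by
  induction K generalizing I with
  | zero => simp [strs]
  | succ K ih =>
    cases I with
    | nil => simp [strs]
    | cons i I => simp [strs, ih]

theorem sum_strs_succ {M : Type*} [AddCommMonoid M] (K : ℕ) (f : List (Fin n) → M) :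
    ∑ I ∈ strs n (K + 1), f I = f [] + ∑ i, ∑ I ∈ strs n K, f (i :: I) := by
  rw [strs, Finset.sum_insert (by simp), Finset.sum_image (by
    rintro ⟨i, I⟩ _ ⟨j, J⟩ _ h
    simpa using h), Finset.sum_product]

theorem strs_mono {K L : ℕ} (h : K ≤ L) : strs n K ⊆ strs n L := fun _ hI =>
  mem_strs.2 ((mem_strs.1 hI).trans h)

/-- Prefixing a letter raises the length bound by one; the vanishing of `f` beyond `K` absorbs the
extra strings. -/
theorem sum_cons_add_nil {M : Type*} [AddCommMonoid M] {K : ℕ} {f : List (Fin n) → M}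
    (hf : ∀ I, K < I.length → f I = 0) :
    f [] + ∑ i, ∑ I ∈ strs n K, f (i :: I) = ∑ I ∈ strs n K, f I := by
  rw [← sum_strs_succ]
  symm
  refine Finset.sum_subset (strs_mono K.le_succ) fun I _ h => hf I ?_
  simpa [mem_strs] using h

/-- The multi-index of an index string. -/
def cnt (I : List (Fin n)) : Fin n → ℕ := fun i => I.count i

theorem cnt_nil : cnt ([] : List (Fin n)) = 0 := by ext; simp [cnt]

theorem cnt_cons (i : Fin n) (I : List (Fin n)) : cnt (i :: I) = cnt I + Pi.single i 1 := by
  ext j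
  simp only [cnt, List.count_cons, Pi.add_apply, Pi.single_apply, beq_iff_eq]
  simp only [eq_comm]

theorem cnt_append_cons (i : Fin n) (I J : List (Fin n)) :
    cnt (I ++ i :: J) = cnt (i :: (I ++ J)) := by
  ext j
  simp only [cnt, List.count_append, List.count_cons]
  omega

theorem length_eq_sum_cnt (I : List (Fin n)) : I.length = ∑ i, cnt I i := by
  induction I with
  | nil => simp [cnt_nil]
  | cons i I ih => simp [cnt_cons, Finset.sum_add_distrib, ih]

/-- `α! / |α|!` for the multi-index `α` of an index string. -/
def wt (α : Fin n → ℕ) : ℝ := (∏ i, ((α i).factorial : ℝ)) / ((∑ i, α i).factorial : ℝ)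

theorem wt_add_single (α : Fin n → ℕ) (i : Fin n) :
    wt (α + Pi.single i 1) * ((∑ j, α j : ℕ) + 1) = wt α * (α i + 1) := by
  have h1 : ∏ j, (((α + Pi.single i 1 : Fin n → ℕ) j).factorial : ℝ)
      = (α i + 1) * ∏ j, ((α j).factorial : ℝ) := by
    rw [← Finset.mul_prod_erase _ _ (Finset.mem_univ i),
      ← Finset.mul_prod_erase _ (fun j => ((α j).factorial : ℝ)) (Finset.mem_univ i), ← mul_assoc]
    congr 1
    · simp [Nat.factorial_succ]
    · refine Finset.prod_congr rfl fun j hj => ?_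
      simp [Finset.ne_of_mem_erase hj]
  have h2 : ∑ j, (α + Pi.single i 1 : Fin n → ℕ) j = ∑ j, α j + 1 := by
    simp [Finset.sum_add_distrib]
  rw [wt, wt, h1, h2, Nat.factorial_succ]
  push_cast
  field_simp

/-- There are |α|!/α! strings with multi-index α. Sorted by their first letter i they contribute, by
induction, the fractions α_i/|α|, which add up to one. -/
theorem card_strs_cnt (α : Fin n → ℕ) {K : ℕ} (hK : ∑ i, α i ≤ K) :
    wt α * ∑ I ∈ strs n K, (if cnt I = α then (1 : ℝ) else 0) = 1 := by
  classical
  induction K generalizing α with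
  | zero =>
    have : α = 0 := by
      ext i
      exact Finset.sum_eq_zero_iff.1 (Nat.le_zero.1 hK) i (Finset.mem_univ i)
    subst this
    rw [strs, Finset.sum_singleton, cnt_nil]
    simp [wt]
  | succ K ih =>
    rw [sum_strs_succ, cnt_nil]
    simp only [cnt_cons]
    by_cases h0 : α = 0
    · subst h0
      have h1 : ∀ (i : Fin n) (I : List (Fin n)), cnt I + Pi.single i 1 ≠ 0 := fun i I h => by
        have := congrFun h i
        simp at this
      simp [h1, wt]
    · rw [if_neg (Ne.symm h0), zero_add]
      have hpos : 0 < ∑ i, α i := by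
        rw [Nat.pos_iff_ne_zero]
        intro h
        exact h0 (funext fun i => Finset.sum_eq_zero_iff.1 h i (Finset.mem_univ i))
      have key : ∀ i, wt α * ∑ I ∈ strs n K, (if cnt I + Pi.single i 1 = α then (1 : ℝ) else 0)
          = α i / (∑ i, α i : ℕ) := by
        intro i
        by_cases hi : α i = 0
        · rw [hi, Nat.cast_zero, zero_div, Finset.sum_eq_zero, mul_zero]
          intro I _
          rw [if_neg]
          rintro rfl
          simp at hi
        · obtain ⟨β, rfl⟩ : ∃ β : Fin n → ℕ, α = β + Pi.single i 1 := by
            refine ⟨(α - Pi.single i 1 : Fin n → ℕ), funext fun j => ?_⟩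
            change α j = α j - (Pi.single i 1 : Fin n → ℕ) j + (Pi.single i 1 : Fin n → ℕ) j
            by_cases hj : j = i
            · subst hj; simp; omega
            · simp [hj]
          have h2 : ∑ j, (β + Pi.single i 1 : Fin n → ℕ) j = ∑ j, β j + 1 := by
            simp [Finset.sum_add_distrib]
          have h3 := ih β (by omega)
          have h4 := wt_add_single β i
          simp only [add_left_inj, h2]
          have h5 : ((∑ j, β j : ℕ) + 1 : ℝ) ≠ 0 := by positivity
          rw [Nat.cast_add, Nat.cast_one, eq_div_iff h5]
          rw [mul_right_comm, h4, mul_right_comm, h3]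
          simp
      rw [Finset.mul_sum, Finset.sum_congr rfl fun i _ => key i, ← Finset.sum_div,
        ← Nat.cast_sum, div_self]
      exact_mod_cast hpos.ne'

theorem sum_strs_wt_smul {M : Type*} [AddCommGroup M] [Module ℝ M] {K : ℕ}
    {A : Finset (Fin n → ℕ)} {g : (Fin n → ℕ) → M} (hA : ∀ α, α ∉ A → g α = 0)
    (hK : ∀ α, K < ∑ i, α i → g α = 0) :
    ∑ I ∈ strs n K, wt (cnt I) • g (cnt I) = ∑ α ∈ A, g α := by
  classical
  have h1 : ∀ I ∈ strs n K, wt (cnt I) • g (cnt I)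
      = ∑ α ∈ A, (wt α * if cnt I = α then (1 : ℝ) else 0) • g α := by
    intro I _
    by_cases h : cnt I ∈ A
    · rw [Finset.sum_eq_single_of_mem _ h]
      · simp
      · intro α _ hα
        simp [Ne.symm hα]
    · rw [hA _ h, smul_zero, Finset.sum_eq_zero]
      intro α hα
      rw [if_neg (fun hc : cnt I = α => h (hc ▸ hα)), mul_zero, zero_smul]
  rw [Finset.sum_congr rfl h1, Finset.sum_comm]
  refine Finset.sum_congr rfl fun α _ => ?_
  rw [← Finset.sum_smul, ← Finset.mul_sum]
  by_cases h : ∑ i, α i ≤ K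
  · rw [card_strs_cnt α h, one_smul]
  · rw [hK α (not_le.1 h), smul_zero]

variable {R : Type} [CommRing R] [Algebra ℝ R] {D : Fin n → Derivation ℝ R R}

theorem listIter_eq_multiIter {A : Type*} (D : Fin n → A → A)
    (hD : ∀ i j F, D i (D j F) = D j (D i F)) (I : List (Fin n)) (F : A) :
    listIter D I F = multiIter D (cnt I) F := by
  induction I with
  | nil => rw [cnt_nil, multiIter_zero]; rfl
  | cons i I ih => rw [cnt_cons, multiIter_add_single _ hD, ← ih]; rfl

theorem listIter_add (I : List (Fin n)) (F G : R) :
    listIter (fun i => ⇑(D i)) I (F + G)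
      = listIter (fun i => ⇑(D i)) I F + listIter (fun i => ⇑(D i)) I G := by
  induction I with
  | nil => rfl
  | cons i I ih => simp only [listIter, List.foldr_cons] at ih ⊢; rw [ih, map_add]

theorem listIter_zero (I : List (Fin n)) : listIter (fun i => ⇑(D i)) I (0 : R) = 0 := by
  simpa using listIter_add (D := D) I 0 0

theorem map_listIter {ψ : R →ₗ[ℝ] R} (hψ : ∀ i F, ψ (D i F) = D i (ψ F)) (I : List (Fin n)) (F : R) :
    ψ (listIter (fun i => ⇑(D i)) I F) = listIter (fun i => ⇑(D i)) I (ψ F) := by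
  induction I with
  | nil => rfl
  | cons i I ih => simp only [listIter, List.foldr_cons] at ih ⊢; rw [hψ, ih]

variable (D) in
/-- The formal adjoint of `w ↦ ∑ a_I D_I w`, applied to `1`. -/
def eul (K : ℕ) (a : List (Fin n) → R) : R :=
  ∑ I ∈ strs n K, (-1) ^ I.length * listIter (fun i => ⇑(D i)) I (a I)

variable (D) in
/-- The boundary terms of the integration by parts of `∑ a_I D_I w`, with `ψ` applied to the
coefficients. -/
def bdry (K : ℕ) (ψ : R →ₗ[ℝ] R) (i : Fin n) (w : R) (a : List (Fin n) → R) : R :=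
  ∑ P ∈ strs n K ×ˢ strs n K, (-1) ^ P.2.length * listIter (fun i => ⇑(D i)) P.1 w
    * ψ (listIter (fun i => ⇑(D i)) P.2 (a (i :: (P.1 ++ P.2))))

/-- With T(I,J) = (-1)^|J| D_I w · ψ(D_J a_{IJ}), the divergence of the boundary terms is the
telescoping sum of T(iI,J) - T(I,iJ). The survivors are the terms T(I,∅), forming the left side, and
T(∅,J), forming the adjoint. The symmetry `hs` lets a letter pass from I to J. The map ψ will be a
homomorphism, an evolutionary derivation or the identity. -/
theorem integration_by_parts {K : ℕ} {ψ : R →ₗ[ℝ] R} (hψ : ∀ i F, ψ (D i F) = D i (ψ F))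
    {a : List (Fin n) → R} (ha : ∀ I, K < I.length → a I = 0)
    (hs : ∀ i I J, a (I ++ i :: J) = a (i :: (I ++ J))) (w : R) :
    ∑ I ∈ strs n K, listIter (fun i => ⇑(D i)) I w * ψ (a I)
      = w * ψ (eul D K a) + ∑ i, D i (bdry D K ψ i w a) := by
  set T : List (Fin n) → List (Fin n) → R := fun I J =>
    (-1) ^ J.length * listIter (fun i => ⇑(D i)) I w
      * ψ (listIter (fun i => ⇑(D i)) J (a (I ++ J))) with hT
  have hT0 : ∀ I J, K < I.length + J.length → T I J = 0 := fun I J h => by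
    simp only [hT]
    rw [ha _ (by simpa using h), listIter_zero, map_zero, mul_zero]
  have h1 : ∀ i, D i (bdry D K ψ i w a)
      = ∑ J ∈ strs n K, ∑ I ∈ strs n K, T (i :: I) J
        - ∑ I ∈ strs n K, ∑ J ∈ strs n K, T I (i :: J) := by
    intro i
    rw [bdry, map_sum, Finset.sum_product_right, Finset.sum_comm (s := strs n K) (t := strs n K)
      (f := fun I J => T I (i :: J)), ← Finset.sum_sub_distrib]
    refine Finset.sum_congr rfl fun J _ => ?_
    rw [← Finset.sum_sub_distrib]
    refine Finset.sum_congr rfl fun I _ => ?_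
    simp only [hT, hs, List.cons_append, List.length_cons]
    have h2 : D i ((-1) ^ J.length : R) = 0 := by
      rw [show ((-1) ^ J.length : R) = algebraMap ℝ R ((-1) ^ J.length) by simp]
      exact (D i).map_algebraMap _
    rw [Derivation.leibniz, Derivation.leibniz, h2, ← hψ]
    simp only [listIter, List.foldr_cons, smul_eq_mul]
    ring
  have h2 : ∀ J, T [] J + ∑ i, ∑ I ∈ strs n K, T (i :: I) J = ∑ I ∈ strs n K, T I J := fun J =>
    sum_cons_add_nil fun I hI => hT0 I J (by omega)
  have h3 : ∀ I, T I [] + ∑ i, ∑ J ∈ strs n K, T I (i :: J) = ∑ J ∈ strs n K, T I J := fun I =>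
    sum_cons_add_nil fun J hJ => hT0 I J (by omega)
  have h4 : ∑ i, D i (bdry D K ψ i w a) = ∑ I ∈ strs n K, T I [] - ∑ J ∈ strs n K, T [] J := by
    simp only [h1, Finset.sum_sub_distrib]
    rw [Finset.sum_comm, Finset.sum_comm (s := Finset.univ) (t := strs n K)
      (f := fun i I => ∑ J ∈ strs n K, T I (i :: J))]
    have e1 : ∑ J ∈ strs n K, ∑ i, ∑ I ∈ strs n K, T (i :: I) J
        = ∑ J ∈ strs n K, ∑ I ∈ strs n K, T I J - ∑ J ∈ strs n K, T [] J := by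
      rw [← Finset.sum_sub_distrib]
      exact Finset.sum_congr rfl fun J _ => by rw [← h2]; ring
    have e2 : ∑ I ∈ strs n K, ∑ i, ∑ J ∈ strs n K, T I (i :: J)
        = ∑ I ∈ strs n K, ∑ J ∈ strs n K, T I J - ∑ I ∈ strs n K, T I [] := by
      rw [← Finset.sum_sub_distrib]
      exact Finset.sum_congr rfl fun I _ => by rw [← h3]; ring
    rw [e1, e2, Finset.sum_comm (s := strs n K) (t := strs n K) (f := fun J I => T I J)]
    ring
  have h5 : ∑ J ∈ strs n K, T [] J = w * ψ (eul D K a) := by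
    rw [eul, map_sum, Finset.mul_sum]
    refine Finset.sum_congr rfl fun J _ => ?_
    have h6 : ∀ (k : ℕ) (F : R), ψ ((-1) ^ k * F) = (-1) ^ k * ψ F := fun k F => by
      rcases neg_one_pow_eq_or R k with h | h <;> simp [h]
    simp only [hT, h6, List.nil_append, listIter, List.foldr_nil]
    ring
  have h7 : ∑ I ∈ strs n K, T I [] = ∑ I ∈ strs n K, listIter (fun i => ⇑(D i)) I w * ψ (a I) := by
    refine Finset.sum_congr rfl fun I _ => ?_
    simp only [hT, List.append_nil, List.length_nil, pow_zero, one_mul]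
    rfl
  rw [h4, h5, h7]
  ring

theorem isOp_bdry (hD : ∀ i j F, D i (D j F) = D j (D i F)) (K : ℕ) (ψ : R →ₗ[ℝ] R) (i : Fin n)
    (a : List (Fin n) → R) : IsOp D (fun w => bdry D K ψ i w a) := by
  refine isOp_sum _ fun P _ => ?_
  refine ((isOp_id.listIter hD P.1).mul hD ((-1) ^ P.2.length *
    ψ (listIter (fun i => ⇑(D i)) P.2 (a (i :: (P.1 ++ P.2)))))).congr fun w => ?_
  ring

end Strings

end

end CKScalar

/-! ### Jet algebras, total derivatives and evolutionary derivations. -/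

namespace CKScalar

noncomputable section

/-- Labels of the coordinates: a homotopy parameter, the independent variables and the jet
variables. -/
inductive Idx (N n : ℕ) : Type
  | s : Idx N n
  | t : Idx N n
  | x : Fin n → Idx N n
  | u : Coord N n → Idx N n
  deriving DecidableEq

/-- An algebra with partial derivatives with respect to the jet coordinates. -/
structure JetAlg (N n : ℕ) (R : Type) [CommRing R] [Algebra ℝ R] where
  d : Derivation ℝ R (Idx N n →₀ R)
  symm : ∀ (F : R) (b c : Idx N n), d (d F b) c = d (d F c) b
  y : Idx N n → R
  d_y : ∀ b, d (y b) = Finsupp.single b 1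

section vfaLin

variable {ι R : Type} [CommRing R] [Algebra ℝ R] {d : Derivation ℝ R (ι →₀ R)} {φ : R →ₐ[ℝ] R}
  {Y : ι → R}

theorem vfa_smul (c : ℝ) (F : R) : vfa d φ Y (c • F) = c • vfa d φ Y F := by
  classical
  rw [vfa_eq_of_subset (s := (d F).support) (by
    rw [Derivation.map_smul]
    exact Finsupp.support_smul), vfa_eq_of_subset (F := F) subset_rfl, Finset.smul_sum]
  refine Finset.sum_congr rfl fun b _ => ?_
  rw [Derivation.map_smul, Finsupp.smul_apply, map_smul, mul_smul_comm]

variable (d φ Y) in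
/-- `vfa` as a linear map. -/
def vfaLin : R →ₗ[ℝ] R where
  toFun := vfa d φ Y
  map_add' := vfa_add
  map_smul' := vfa_smul

@[simp] theorem vfaLin_apply (F : R) : vfaLin d φ Y F = vfa d φ Y F := rfl

theorem vfa_algebraMap (c : ℝ) : vfa d φ Y (algebraMap ℝ R c) = 0 := by simp [vfa]

theorem map_vf (X : ι → R) (F : R) : φ (vf d X F) = vfa d φ (fun b => φ (X b)) F := by
  rw [vf_eq_sum, vfa, Finsupp.sum, Finsupp.sum, map_sum]
  exact Finset.sum_congr rfl fun b _ => by rw [map_mul, mul_comm]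

end vfaLin

namespace JetAlg

variable {N n : ℕ} {R : Type} [CommRing R] [Algebra ℝ R] (𝒥 : JetAlg N n R)

theorem vfa_y (φ : R →ₐ[ℝ] R) (Y : Idx N n → R) (b : Idx N n) : vfa 𝒥.d φ Y (𝒥.y b) = Y b := by
  rw [vfa, 𝒥.d_y, Finsupp.sum_single_index (by simp), map_one, mul_one]

theorem vf_y (Y : Idx N n → R) (b : Idx N n) : vf 𝒥.d Y (𝒥.y b) = Y b := by
  rw [vf_eq_vfa, vfa_y]

/-- Components of the total derivative with respect to `xⁱ`. -/
def compD (i : Fin n) : Idx N n → R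
  | .s => 0
  | .t => 0
  | .x k => if k = i then 1 else 0
  | .u c => 𝒥.y (.u (c.1, c.2 + Pi.single i 1))

/-- The total derivative with respect to `xⁱ`. -/
def D (i : Fin n) : Derivation ℝ R R := vf 𝒥.d (𝒥.compD i)

/-- Components of the total derivative with respect to `t` on the solution space. -/
def compDt (g : R) : Idx N n → R
  | .s => 0
  | .t => 1
  | .x _ => 0
  | .u c => if h : c.1.1 + 1 < N then 𝒥.y (.u (⟨c.1.1 + 1, h⟩, c.2))
      else -multiIter (fun i => ⇑(𝒥.D i)) c.2 g

/-- The total derivative with respect to `t` on the solution space. -/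
def Dt (g : R) : Derivation ℝ R R := vf 𝒥.d (𝒥.compDt g)

/-- The derivative with respect to the homotopy parameter. -/
def Ds : Derivation ℝ R R := vf 𝒥.d (Pi.single .s 1)

/-- Components of the evolutionary vector field with characteristic `w` in position `j`. -/
def prol (j : Fin N) (w : R) : Idx N n → R
  | .u c => if c.1 = j then multiIter (fun i => ⇑(𝒥.D i)) c.2 w else 0
  | _ => 0

/-- The evolutionary derivation along `φ`. -/
def evo (φ : R →ₐ[ℝ] R) (j : Fin N) (w : R) : R →ₗ[ℝ] R := vfaLin 𝒥.d φ (𝒥.prol j w)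

theorem D_comm (i j : Fin n) (F : R) : 𝒥.D i (𝒥.D j F) = 𝒥.D j (𝒥.D i F) := by
  refine vf_comm 𝒥.symm (fun b => ?_) F
  match b with
  | .s => simp [compD]
  | .t => simp [compD]
  | .x k => simp only [compD]; split_ifs <;> simp
  | .u c =>
    simp only [compD, vf_y]
    congr 3
    exact add_right_comm _ _ _

/-- It suffices to compare components. On a top variable both sides are -D_i D^α g: the
x-derivatives of ∂_t^N u are eliminated consistently with the equation. -/
theorem D_Dt (g : R) (i : Fin n) (F : R) : 𝒥.D i (𝒥.Dt g F) = 𝒥.Dt g (𝒥.D i F) := by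
  refine vf_comm 𝒥.symm (fun b => ?_) F
  match b with
  | .s => simp [compD, compDt]
  | .t => simp [compD, compDt]
  | .x k => simp only [compD, compDt]; split_ifs <;> simp
  | .u c =>
    simp only [compD, vf_y]
    simp only [compDt]
    split_ifs with h
    · simp only [vf_y, compD]
    · rw [map_neg, multiIter_add_single _ 𝒥.D_comm]
      rfl

theorem D_Ds (i : Fin n) (F : R) : 𝒥.D i (𝒥.Ds F) = 𝒥.Ds (𝒥.D i F) := by
  refine vf_comm 𝒥.symm (fun b => ?_) F
  match b with
  | .s => simp [compD]
  | .t => simp [compD]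
  | .x k => simp only [compD]; split_ifs <;> simp
  | .u c => simp [compD, vf_y]

theorem D_x (i j : Fin n) : 𝒥.D i (𝒥.y (.x j)) = if i = j then 1 else 0 := by
  rw [D, vf_y, compD]
  simp only [eq_comm]

theorem derivation_multiIter {X : Derivation ℝ R R} (hX : ∀ i F, 𝒥.D i (X F) = X (𝒥.D i F))
    (α : Fin n → ℕ) (F : R) : X (multiIter (fun i => ⇑(𝒥.D i)) α F)
      = multiIter (fun i => ⇑(𝒥.D i)) α (X F) := by
  induction α using multiIter_induction with
  | h0 => simp only [multiIter_zero]
  | hs α i ih => simp only [multiIter_add_single _ 𝒥.D_comm]; rw [← hX, ih]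

theorem linearMap_listIter {X : R →ₗ[ℝ] R} (hX : ∀ i F, X (𝒥.D i F) = 𝒥.D i (X F))
    (I : List (Fin n)) (F : R) : X (listIter (fun i => ⇑(𝒥.D i)) I F)
      = listIter (fun i => ⇑(𝒥.D i)) I (X F) :=
  map_listIter hX I F

variable {φ : R →ₐ[ℝ] R}

/-- The second-order parts agree by symmetry, and the prolonged components satisfy the defining rule
that the one at `α + Pi.single i 1` is `D i` of the one at `α`. -/
theorem evo_D (hφ : ∀ i F, φ (𝒥.D i F) = 𝒥.D i (φ F)) (j : Fin N) (w : R) (i : Fin n) (F : R) :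
    𝒥.evo φ j w (𝒥.D i F) = 𝒥.D i (𝒥.evo φ j w F) := by
  have hX : ∀ G, vf 𝒥.d (𝒥.compD i) (φ G) = vfa 𝒥.d φ (fun b => φ (𝒥.compD i b)) G := fun G => by
    rw [← map_vf]
    exact (hφ i G).symm
  change vfa 𝒥.d φ (𝒥.prol j w) (vf 𝒥.d (𝒥.compD i) F)
    = vf 𝒥.d (𝒥.compD i) (vfa 𝒥.d φ (𝒥.prol j w) F)
  rw [vfa_vf, vf_vfa hX, hess_comm 𝒥.symm]
  congr 2
  ext b
  match b with
  | .s => simp [compD, prol, vfa_zero]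
  | .t => simp [compD, prol, vfa_zero]
  | .x k =>
    simp only [compD, prol, map_zero]
    split_ifs
    · simpa using vfa_algebraMap (d := 𝒥.d) (φ := φ) (Y := 𝒥.prol j w) 1
    · exact vfa_zero
  | .u c =>
    simp only [compD, vfa_y]
    simp only [prol]
    split_ifs
    · rw [multiIter_add_single _ 𝒥.D_comm]; rfl
    · rw [map_zero]

/-- The evolutionary derivation in position `j - 1`, zero for `j = 0`. -/
def evoPred (φ : R →ₐ[ℝ] R) (j : Fin N) (w : R) (F : R) : R :=
  if h : 0 < j.1 then 𝒥.evo φ ⟨j.1 - 1, by omega⟩ w F else 0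

theorem evo_multiIter (hφ : ∀ i F, φ (𝒥.D i F) = 𝒥.D i (φ F)) (j : Fin N) (w : R)
    (α : Fin n → ℕ) (F : R) : 𝒥.evo φ j w (multiIter (fun i => ⇑(𝒥.D i)) α F)
      = multiIter (fun i => ⇑(𝒥.D i)) α (𝒥.evo φ j w F) := by
  induction α using multiIter_induction with
  | h0 => simp only [multiIter_zero]
  | hs α i ih => simp only [multiIter_add_single _ 𝒥.D_comm]; rw [𝒥.evo_D hφ, ih]

/-- Linearization of the total derivative with respect to `t`. -/
theorem evo_Dt (hφ : ∀ i F, φ (𝒥.D i F) = 𝒥.D i (φ F)) {g ρ : R} {l : Fin N} (hl : l.1 + 1 = N)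
    (hφt : ∀ F, 𝒥.Dt g (φ F) = φ (𝒥.Dt g F) + 𝒥.evo φ l ρ F) (j : Fin N) (w F : R) :
    𝒥.evo φ j w (𝒥.Dt g F) = 𝒥.Dt g (𝒥.evo φ j w F) + 𝒥.evoPred φ j w F
      - 𝒥.evo φ l (𝒥.evo φ j w g) F - 𝒥.evo φ j (𝒥.Dt g w) F
      - hess 𝒥.d φ (𝒥.prol l ρ) (𝒥.prol j w) F := by
  -- `φ` does not intertwine `Dt g` with itself; the additional components `prol l ρ` are the origin
  -- of the Hessian term.
  have hX : ∀ G, vf 𝒥.d (𝒥.compDt g) (φ G)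
      = vfa 𝒥.d φ (fun b => φ (𝒥.compDt g b) + 𝒥.prol l ρ b) G := fun G => by
    rw [vfa_add_field, ← map_vf]
    exact hφt G
  have h1 : 𝒥.evo φ j w (𝒥.Dt g F) = vfa 𝒥.d φ (fun b => 𝒥.evo φ j w (𝒥.compDt g b)) F
      + hess 𝒥.d φ (fun b => φ (𝒥.compDt g b)) (𝒥.prol j w) F := vfa_vf _ _
  have h2 : 𝒥.Dt g (𝒥.evo φ j w F) = vfa 𝒥.d φ (fun b => 𝒥.Dt g (𝒥.prol j w b)) F
      + hess 𝒥.d φ (𝒥.prol j w) (fun b => φ (𝒥.compDt g b) + 𝒥.prol l ρ b) F := vf_vfa hX _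
  rw [hess_add_right, hess_comm 𝒥.symm, hess_comm 𝒥.symm (Y := 𝒥.prol j w) (Z := 𝒥.prol l ρ)] at h2
  -- Linearizing the shift k ↦ k+1 of the jet variables moves position j to j-1, while the
  -- eliminated top variables contribute minus the linearization of `g`.
  have h3 : vfa 𝒥.d φ (fun b => 𝒥.evo φ j w (𝒥.compDt g b)) F
      = 𝒥.evoPred φ j w F - 𝒥.evo φ l (𝒥.evo φ j w g) F
        + (vfa 𝒥.d φ (fun b => 𝒥.Dt g (𝒥.prol j w b)) F - 𝒥.evo φ j (𝒥.Dt g w) F) := by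
    have h4 : 𝒥.evoPred φ j w F
        = vfa 𝒥.d φ (fun b => if h : 0 < j.1 then 𝒥.prol ⟨j.1 - 1, by omega⟩ w b else 0) F := by
      unfold evoPred
      split_ifs with h
      · rfl
      · simp [vfa]
    rw [h4]
    change _ = _ - vfa 𝒥.d φ (𝒥.prol l (𝒥.evo φ j w g)) F
      + (_ - vfa 𝒥.d φ (𝒥.prol j (𝒥.Dt g w)) F)
    rw [← vfa_sub_field, ← vfa_sub_field, ← vfa_add_field]
    congr 1
    ext b
    match b with
    | .s => simp [compDt, prol]
    | .t =>
      have := vfa_algebraMap (d := 𝒥.d) (φ := φ) (Y := 𝒥.prol j w) 1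
      rw [map_one] at this
      simp [compDt, prol, evo, this]
    | .x k => simp [compDt, prol]
    | .u c =>
      have h5 : 𝒥.Dt g (𝒥.prol j w (.u c)) = 𝒥.prol j (𝒥.Dt g w) (.u c) := by
        simp only [prol]
        split_ifs
        · exact 𝒥.derivation_multiIter (fun i F => 𝒥.D_Dt g i F) _ _
        · rw [map_zero]
      rw [h5, sub_self, add_zero]
      obtain ⟨k, α⟩ := c
      simp only [compDt, prol]
      by_cases hk : k.1 + 1 < N
      · have hkl : k ≠ l := fun h => by subst h; omega
        rw [dif_pos hk, if_neg hkl, sub_zero]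
        change vfa 𝒥.d φ (𝒥.prol j w) _ = _
        rw [vfa_y]
        simp only [prol]
        by_cases hj : j.1 = k.1 + 1
        · have e1 : (⟨k.1 + 1, hk⟩ : Fin N) = j := Fin.ext hj.symm
          have e2 : k = ⟨j.1 - 1, by omega⟩ := Fin.ext (by simp [hj])
          rw [if_pos e1, dif_pos (by omega), if_pos e2]
        · have e1 : (⟨k.1 + 1, hk⟩ : Fin N) ≠ j := fun h => hj (by rw [← h])
          rw [if_neg e1]
          split_ifs with h6 h7
          · exact absurd (congrArg Fin.val h7) (by simp only; omega)
          · rfl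
          · rfl
      · have hkl : k = l := Fin.ext (by omega)
        rw [dif_neg hk, if_pos hkl, map_neg, 𝒥.evo_multiIter hφ]
        split_ifs with h6 h7
        · exact absurd (congrArg Fin.val h7) (by simp only; omega)
        · rw [zero_sub]
        · rw [zero_sub]
  rw [h1, h3, h2]
  ring

/-- `F` involves only jet variables with at most `K` derivatives in `x`. -/
def HasOrder (K : ℕ) (F : R) : Prop := ∀ j α, K < ∑ i, α i → 𝒥.d F (.u (j, α)) = 0

theorem HasOrder.mono {K L : ℕ} (h : K ≤ L) {F : R} (hF : 𝒥.HasOrder K F) : 𝒥.HasOrder L F :=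
  fun j α hα => hF j α (lt_of_le_of_lt h hα)

theorem exists_hasOrder (F : R) : ∃ K, 𝒥.HasOrder K F := by
  refine ⟨(𝒥.d F).support.sup fun | .u c => ∑ i, c.2 i | _ => 0, fun j α hα => ?_⟩
  by_contra h
  have := Finset.le_sup (f := fun | .u c => ∑ i, c.2 i | _ => 0) (Finsupp.mem_support_iff.2 h)
  exact absurd this (not_le.2 hα)

/-- The normalized derivative with respect to the jet variable of an index string. -/
def pS (j : Fin N) (F : R) (I : List (Fin n)) : R := wt (cnt I) • 𝒥.d F (.u (j, cnt I))

theorem pS_eq_zero {K : ℕ} {F : R} (hF : 𝒥.HasOrder K F) (j : Fin N) {I : List (Fin n)}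
    (hI : K < I.length) : 𝒥.pS j F I = 0 := by
  rw [pS, hF j _ (by rwa [← length_eq_sum_cnt]), smul_zero]

theorem pS_perm (j : Fin N) (F : R) (i : Fin n) (I J : List (Fin n)) :
    𝒥.pS j F (I ++ i :: J) = 𝒥.pS j F (i :: (I ++ J)) := by
  rw [pS, pS, cnt_append_cons]

/-- The weights of the strings sharing a multi-index add up to one, so the sum over multi-indices
becomes one over strings. Leaving `ψ` free covers `evo` and `hess` at once. -/
theorem sum_prol_mul {K : ℕ} {F : R} (hF : 𝒥.HasOrder K F) (j : Fin N) (w : R)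
    (ψ : R →ₗ[ℝ] R) :
    ((𝒥.d F).sum fun b a => 𝒥.prol j w b * ψ a)
      = ∑ I ∈ strs n K, listIter (fun i => ⇑(𝒥.D i)) I w * ψ (𝒥.pS j F I) := by
  classical
  set A : Finset (Fin n → ℕ) := (𝒥.d F).support.biUnion
    fun | .u c => {c.2} | _ => ∅ with hA
  have hA' : ∀ α, α ∉ A → 𝒥.d F (.u (j, α)) = 0 := fun α hα => by
    by_contra h
    exact hα (Finset.mem_biUnion.2 ⟨_, Finsupp.mem_support_iff.2 h, by simp⟩)
  have h1 : ∀ I, listIter (fun i => ⇑(𝒥.D i)) I w * ψ (𝒥.pS j F I)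
      = wt (cnt I) • (multiIter (fun i => ⇑(𝒥.D i)) (cnt I) w * ψ (𝒥.d F (.u (j, cnt I)))) :=
    fun I => by
      rw [listIter_eq_multiIter _ 𝒥.D_comm, pS, map_smul, mul_smul_comm]
  rw [Finset.sum_congr rfl fun I _ => h1 I, sum_strs_wt_smul (A := A)
    (g := fun α => multiIter (fun i => ⇑(𝒥.D i)) α w * ψ (𝒥.d F (.u (j, α))))
    (fun α hα => by simp only [hA' α hα, map_zero, mul_zero])
    (fun α hα => by simp only [hF j α hα, map_zero, mul_zero])]
  have h2 : Function.Injective fun α : Fin n → ℕ => (Idx.u (j, α) : Idx N n) := fun α β h => by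
    simpa using h
  have h3 : ∑ α ∈ A, multiIter (fun i => ⇑(𝒥.D i)) α w * ψ (𝒥.d F (.u (j, α)))
      = ∑ b ∈ A.image fun α => (Idx.u (j, α) : Idx N n), 𝒥.prol j w b * ψ (𝒥.d F b) := by
    rw [Finset.sum_image h2.injOn]
    exact Finset.sum_congr rfl fun α _ => by simp [prol]
  rw [h3]
  trans ∑ b ∈ (𝒥.d F).support ∪ A.image (fun α => (Idx.u (j, α) : Idx N n)),
    𝒥.prol j w b * ψ (𝒥.d F b)
  · exact Finsupp.sum_of_support_subset _ Finset.subset_union_left _ fun b _ => by simp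
  · symm
    refine Finset.sum_subset Finset.subset_union_right fun b hb hb' => ?_
    match b with
    | .s => simp [prol]
    | .t => simp [prol]
    | .x k => simp [prol]
    | .u (k, α) =>
      by_cases hk : k = j
      · subst hk
        rw [hA' α fun h => hb' (Finset.mem_image_of_mem _ h), map_zero, mul_zero]
      · simp [prol, hk]

theorem evo_eq_sum {K : ℕ} {F : R} (hF : 𝒥.HasOrder K F) (φ : R →ₐ[ℝ] R) (j : Fin N) (w : R) :
    𝒥.evo φ j w F
      = ∑ I ∈ strs n K, listIter (fun i => ⇑(𝒥.D i)) I w * φ (𝒥.pS j F I) :=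
  𝒥.sum_prol_mul hF j w φ.toLinearMap

theorem hess_eq_sum {K : ℕ} {F : R} (hF : 𝒥.HasOrder K F) (φ : R →ₐ[ℝ] R) (l j : Fin N) (ρ w : R) :
    hess 𝒥.d φ (𝒥.prol l ρ) (𝒥.prol j w) F
      = ∑ I ∈ strs n K, listIter (fun i => ⇑(𝒥.D i)) I ρ * 𝒥.evo φ j w (𝒥.pS l F I) :=
  𝒥.sum_prol_mul hF l ρ (𝒥.evo φ j w)

theorem isOp_evo (φ : R →ₐ[ℝ] R) (j : Fin N) (F : R) : IsOp 𝒥.D (fun w => 𝒥.evo φ j w F) := by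
  obtain ⟨K, hK⟩ := 𝒥.exists_hasOrder F
  refine IsOp.congr (isOp_sum (strs n K) (P := fun I w => φ (𝒥.pS j F I) *
    listIter (fun i => ⇑(𝒥.D i)) I w) fun I _ =>
      (isOp_id.listIter 𝒥.D_comm I).mul 𝒥.D_comm _) fun w => ?_
  rw [𝒥.evo_eq_sum hK]
  exact Finset.sum_congr rfl fun I _ => mul_comm _ _

/-- The variational derivative with respect to the field in position `j`. -/
def E (K : ℕ) (j : Fin N) (F : R) : R := eul 𝒥.D K (𝒥.pS j F)

theorem evo_eq_mul_add_divergence (hφ : ∀ i F, φ (𝒥.D i F) = 𝒥.D i (φ F)) {K : ℕ} {F : R}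
    (hF : 𝒥.HasOrder K F) (j : Fin N) (w : R) :
    𝒥.evo φ j w F = w * φ (𝒥.E K j F)
      + ∑ i, 𝒥.D i (bdry 𝒥.D K φ.toLinearMap i w (𝒥.pS j F)) := by
  rw [𝒥.evo_eq_sum hF]
  exact integration_by_parts (ψ := φ.toLinearMap) hφ (fun I hI => 𝒥.pS_eq_zero hF j hI)
    (𝒥.pS_perm j F) w

theorem hess_eq_mul_add_divergence (hφ : ∀ i F, φ (𝒥.D i F) = 𝒥.D i (φ F)) {K : ℕ} {F : R}
    (hF : 𝒥.HasOrder K F) (l j : Fin N) (ρ w : R) :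
    hess 𝒥.d φ (𝒥.prol l ρ) (𝒥.prol j w) F = ρ * 𝒥.evo φ j w (𝒥.E K l F)
      + ∑ i, 𝒥.D i (bdry 𝒥.D K (𝒥.evo φ j w) i ρ (𝒥.pS l F)) := by
  rw [𝒥.hess_eq_sum hF]
  exact integration_by_parts (fun i G => 𝒥.evo_D hφ j w i G) (fun I hI => 𝒥.pS_eq_zero hF l hI)
    (𝒥.pS_perm l F) ρ

theorem mul_evo_eq_mul_add_divergence {K : ℕ} {F : R}
    (hF : 𝒥.HasOrder K F) (φ : R →ₐ[ℝ] R) (j : Fin N) (w W : R) :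
    W * 𝒥.evo φ j w F = w * eul 𝒥.D K (fun I => φ (𝒥.pS j F I) * W)
      + ∑ i, 𝒥.D i (bdry 𝒥.D K LinearMap.id i w (fun I => φ (𝒥.pS j F I) * W)) := by
  rw [𝒥.evo_eq_sum hF, Finset.mul_sum]
  refine Eq.trans (Finset.sum_congr rfl fun I _ => ?_)
    (integration_by_parts (ψ := LinearMap.id) (fun _ _ => rfl)
    (fun I hI => by simp only [𝒥.pS_eq_zero hF j hI, map_zero, zero_mul])
    (fun i I J => by simp only [𝒥.pS_perm]) w)
  rw [LinearMap.id_apply]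
  ring

/-- `X` commutes with the `D i`, so the Leibniz rule lets it act on `w` or on the coefficients. It
is used for both `Dt` and `Ds`. -/
theorem derivation_bdry {X : Derivation ℝ R R} (hX : ∀ i F, 𝒥.D i (X F) = X (𝒥.D i F)) (K : ℕ)
    (ψ : R →ₗ[ℝ] R) (i : Fin n) (w : R) (a : List (Fin n) → R) :
    X (bdry 𝒥.D K ψ i w a) = bdry 𝒥.D K ψ i (X w) a
      + bdry 𝒥.D K (X.toLinearMap ∘ₗ ψ) i w a := by
  rw [bdry, map_sum, bdry, bdry, ← Finset.sum_add_distrib]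
  refine Finset.sum_congr rfl fun P _ => ?_
  have h1 : X ((-1) ^ P.2.length : R) = 0 := by
    rw [show ((-1) ^ P.2.length : R) = algebraMap ℝ R ((-1) ^ P.2.length) by simp]
    exact X.map_algebraMap _
  have h2 : X (listIter (fun i => ⇑(𝒥.D i)) P.1 w) = listIter (fun i => ⇑(𝒥.D i)) P.1 (X w) :=
    𝒥.linearMap_listIter (X := X.toLinearMap) (fun i F => (hX i F).symm) P.1 w
  rw [Derivation.leibniz, Derivation.leibniz, h1, h2]
  have h3 : ∀ F, (X.toLinearMap ∘ₗ ψ) F = X (ψ F) := fun _ => rfl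
  simp only [smul_eq_mul, h3]
  ring

section Bdry

variable {κ : Type*}

theorem bdry_sum_map (K : ℕ) (s : Finset κ) (ψ : κ → R →ₗ[ℝ] R) (i : Fin n) (w : R)
    (a : List (Fin n) → R) :
    bdry 𝒥.D K (∑ k ∈ s, ψ k) i w a = ∑ k ∈ s, bdry 𝒥.D K (ψ k) i w a := by
  simp only [bdry, LinearMap.sum_apply, Finset.mul_sum]
  exact Finset.sum_comm

theorem bdry_add (K : ℕ) (ψ : R →ₗ[ℝ] R) (i : Fin n) (w w' : R) (a : List (Fin n) → R) :
    bdry 𝒥.D K ψ i (w + w') a = bdry 𝒥.D K ψ i w a + bdry 𝒥.D K ψ i w' a := by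
  simp only [bdry, listIter_add, mul_add, add_mul, Finset.sum_add_distrib]

theorem bdry_sum (K : ℕ) (ψ : R →ₗ[ℝ] R) (i : Fin n) (s : Finset κ) (w : κ → R)
    (a : List (Fin n) → R) :
    bdry 𝒥.D K ψ i (∑ k ∈ s, w k) a = ∑ k ∈ s, bdry 𝒥.D K ψ i (w k) a :=
  map_sum (AddMonoidHom.mk' (fun w => bdry 𝒥.D K ψ i w a)
    fun w w' => 𝒥.bdry_add K ψ i w w' a) w s

theorem isOp_bdry_evo (K : ℕ) (φ : R →ₐ[ℝ] R) (j : Fin N) (i : Fin n) (ρ : R)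
    (a : List (Fin n) → R) : IsOp 𝒥.D (fun w => bdry 𝒥.D K (𝒥.evo φ j w) i ρ a) :=
  isOp_sum _ fun _ _ => (𝒥.isOp_evo φ j _).mul 𝒥.D_comm _

end Bdry

end JetAlg

end

end CKScalar

/-! ### The linearized conservation law and its variation along a homotopy. -/

namespace CKScalar

noncomputable section

namespace JetAlg

variable {N n : ℕ} {R : Type} [CommRing R] [Algebra ℝ R] (𝒥 : JetAlg N n R) {φ : R →ₐ[ℝ] R}

/-- The variational derivative in position `j - 1`, zero for `j = 0`. -/
def EPred (K : ℕ) (j : Fin N) (F : R) : R :=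
  if h : 0 < j.1 then 𝒥.E K ⟨j.1 - 1, by omega⟩ F else 0

/-- The boundary terms in position `j - 1`, zero for `j = 0`. -/
def bdryPred (K : ℕ) (φ : R →ₐ[ℝ] R) (j : Fin N) (i : Fin n) (w F : R) : R :=
  if h : 0 < j.1 then bdry 𝒥.D K φ.toLinearMap i w (𝒥.pS ⟨j.1 - 1, by omega⟩ F) else 0

theorem evoPred_eq (hφ : ∀ i F, φ (𝒥.D i F) = 𝒥.D i (φ F)) {K : ℕ} {F : R}
    (hF : 𝒥.HasOrder K F) (j : Fin N) (w : R) :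
    𝒥.evoPred φ j w F = w * φ (𝒥.EPred K j F) + ∑ i, 𝒥.D i (𝒥.bdryPred K φ j i w F) := by
  unfold evoPred EPred bdryPred
  split_ifs with h
  · exact 𝒥.evo_eq_mul_add_divergence hφ hF _ w
  · simp

theorem isOp_bdryPred (K : ℕ) (j : Fin N) (i : Fin n) (F : R) :
    IsOp 𝒥.D (fun w => 𝒥.bdryPred K φ j i w F) := by
  unfold bdryPred
  split_ifs with h
  · exact isOp_bdry 𝒥.D_comm K _ i _
  · exact isOp_zero

/-- The linearization of a conservation law along an evolutionary derivation, integrated by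
parts. -/
theorem linearized_law (hφ : ∀ i F, φ (𝒥.D i F) = 𝒥.D i (φ F)) {g ρ : R} {l : Fin N}
    (hl : l.1 + 1 = N) (hφt : ∀ F, 𝒥.Dt g (φ F) = φ (𝒥.Dt g F) + 𝒥.evo φ l ρ F)
    {Φt : R} {Φx : Fin n → R} (hΦ : 𝒥.Dt g Φt + ∑ i, 𝒥.D i (Φx i) = 0) {K : ℕ}
    (hKΦ : 𝒥.HasOrder K Φt) (hKg : 𝒥.HasOrder K g) {Λ : R} (hΛ : Λ = 𝒥.E K l Φt)
    (hKΛ : 𝒥.HasOrder K Λ) (j : Fin N) :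
    (𝒥.Dt g (φ (𝒥.E K j Φt)) + φ (𝒥.EPred K j Φt) - eul 𝒥.D K (fun I => φ (𝒥.pS j g I) * φ Λ)
      - eul 𝒥.D K (fun I => φ (𝒥.pS j Λ I) * ρ) = 0) ∧
    ∃ ψ : Fin n → Fin n → R → R, (∀ i k w, ψ i k w = -ψ k i w) ∧ ∀ i w,
      𝒥.evo φ j w (Φx i)
        + (𝒥.Dt g (bdry 𝒥.D K φ.toLinearMap i w (𝒥.pS j Φt))
          - bdry 𝒥.D K φ.toLinearMap i (𝒥.Dt g w) (𝒥.pS j Φt))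
        + 𝒥.bdryPred K φ j i w Φt
        - bdry 𝒥.D K φ.toLinearMap i (𝒥.evo φ j w g) (𝒥.pS l Φt)
        - bdry 𝒥.D K (𝒥.evo φ j w) i ρ (𝒥.pS l Φt)
        - bdry 𝒥.D K LinearMap.id i w (fun I => φ (𝒥.pS j g I) * φ Λ)
        - bdry 𝒥.D K LinearMap.id i w (fun I => φ (𝒥.pS j Λ I) * ρ)
      = ∑ k, 𝒥.D k (ψ i k w) := by
  refine exists_skew_of_divergence_eq 𝒥.D_comm 𝒥.D_x
    (P := fun i w => _) (fun i => ?_) fun w => ?_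
  · refine IsOp.sub (IsOp.sub (IsOp.sub (IsOp.sub (IsOp.add (IsOp.add (𝒥.isOp_evo φ j _) ?_)
      (𝒥.isOp_bdryPred K j i _)) ?_) (𝒥.isOp_bdry_evo K φ j i ρ _))
      (isOp_bdry 𝒥.D_comm K _ i _)) (isOp_bdry 𝒥.D_comm K _ i _)
    -- Neither `Dt` term is visibly an operator in the `D i`; in the difference the derivative of
    -- `w` cancels and `Dt` falls on the coefficients only.
    · refine (isOp_bdry 𝒥.D_comm K ((𝒥.Dt g).toLinearMap ∘ₗ φ.toLinearMap) i
        (𝒥.pS j Φt)).congr fun w => ?_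
      rw [𝒥.derivation_bdry (𝒥.D_Dt g), add_sub_cancel_left]
    · exact IsOp.comp 𝒥.D_comm (isOp_bdry 𝒥.D_comm K _ i _) (𝒥.isOp_evo φ j g)
  · have h0 := congrArg (𝒥.evo φ j w) hΦ
    rw [map_add, map_zero, map_sum, 𝒥.evo_Dt hφ hl hφt,
      𝒥.evo_eq_mul_add_divergence hφ hKΦ j w, 𝒥.evoPred_eq hφ hKΦ,
      𝒥.evo_eq_mul_add_divergence hφ hKΦ l, 𝒥.evo_eq_mul_add_divergence hφ hKΦ j (𝒥.Dt g w),
      𝒥.hess_eq_mul_add_divergence hφ hKΦ, ← hΛ, mul_comm (𝒥.evo φ j w g),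
      𝒥.mul_evo_eq_mul_add_divergence hKg, 𝒥.mul_evo_eq_mul_add_divergence hKΛ,
      map_add, map_sum, Derivation.leibniz, smul_eq_mul, smul_eq_mul] at h0
    simp only [← 𝒥.D_Dt, 𝒥.evo_D hφ] at h0
    simp only [map_add, map_sub, Finset.sum_add_distrib, Finset.sum_sub_distrib]
    linear_combination h0

/-- The adjoint equation of `linearized_law` for `φ = id` and `ρ = 0`. It determines the variational
derivative in position j-1 from the one in position j, hence all of them from `Λ`; for j = 0 it is a
condition on the variational derivative in position 0. -/
theorem EPred_eq {g : R} {l : Fin N} (hl : l.1 + 1 = N)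
    {Φt : R} {Φx : Fin n → R} (hΦ : 𝒥.Dt g Φt + ∑ i, 𝒥.D i (Φx i) = 0) {K : ℕ}
    (hKΦ : 𝒥.HasOrder K Φt) (hKg : 𝒥.HasOrder K g) {Λ : R} (hΛ : Λ = 𝒥.E K l Φt)
    (hKΛ : 𝒥.HasOrder K Λ) (j : Fin N) :
    𝒥.EPred K j Φt = -𝒥.Dt g (𝒥.E K j Φt) + eul 𝒥.D K (fun I => 𝒥.pS j g I * Λ) := by
  have h := (𝒥.linearized_law (φ := AlgHom.id ℝ R) (ρ := 0) (fun _ _ => rfl) hl (fun F => by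
    have h0 : 𝒥.prol l (0 : R) = 0 := by
      ext b
      match b with
      | .s => rfl
      | .t => rfl
      | .x _ => rfl
      | .u c => simp [prol, multiIter_map_zero]
    change _ = _ + vfa 𝒥.d _ (𝒥.prol l 0) F
    rw [h0]
    simp [vfa]) hΦ hKΦ hKg hΛ hKΛ j).1
  have h1 : eul 𝒥.D K (fun I => (AlgHom.id ℝ R) (𝒥.pS j Λ I) * 0) = 0 := by
    simp [eul, listIter_zero]
  rw [h1] at h
  simp only [AlgHom.id_apply] at h
  linear_combination h

/-- The first variation of the densities along a homotopy `φ`. -/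
theorem homotopy_law (hφ : ∀ i F, φ (𝒥.D i F) = 𝒥.D i (φ F)) {g ρ κ : R} {l : Fin N}
    (hl : l.1 + 1 = N) (hφt : ∀ F, 𝒥.Dt g (φ F) = φ (𝒥.Dt g F) + 𝒥.evo φ l ρ F)
    {w : Fin N → R} (hφs : ∀ F, 𝒥.Ds (φ F) = ∑ j, 𝒥.evo φ j (w j) F)
    (hw : ∀ j, 𝒥.Dt g (w j) = if h : j.1 + 1 < N then w ⟨j.1 + 1, h⟩ else κ)
    (hρ : 𝒥.Ds ρ = 𝒥.Ds (φ g) + κ)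
    {Φt : R} {Φx : Fin n → R} (hΦ : 𝒥.Dt g Φt + ∑ i, 𝒥.D i (Φx i) = 0) {K : ℕ}
    (hKΦ : 𝒥.HasOrder K Φt) (hKg : 𝒥.HasOrder K g) {Λ : R} (hΛ : Λ = 𝒥.E K l Φt)
    (hKΛ : 𝒥.HasOrder K Λ) :
    ∃ θ : Fin n → R, 𝒥.Ds (φ Φt) = ∑ j, w j * φ (𝒥.E K j Φt) + ∑ i, 𝒥.D i (θ i) ∧
      ∃ ψ : Fin n → Fin n → R, (∀ i k, ψ i k = -ψ k i) ∧ ∀ i,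
        𝒥.Ds (φ (Φx i)) + 𝒥.Dt g (θ i)
          - 𝒥.Ds (bdry 𝒥.D K φ.toLinearMap i ρ (𝒥.pS l Φt))
          - (∑ j, bdry 𝒥.D K LinearMap.id i (w j) (fun I => φ (𝒥.pS j g I) * φ Λ)
          + ∑ j, bdry 𝒥.D K LinearMap.id i (w j) (fun I => φ (𝒥.pS j Λ I) * ρ))
        = ∑ k, 𝒥.D k (ψ i k) := by
  choose hm ψ hψ hψ' using 𝒥.linearized_law hφ hl hφt hΦ hKΦ hKg hΛ hKΛ
  refine ⟨fun i => ∑ j, bdry 𝒥.D K φ.toLinearMap i (w j) (𝒥.pS j Φt), ?_,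
    fun i k => ∑ j, ψ j i k (w j), fun i k => ?_, fun i => ?_⟩
  · rw [hφs]
    simp only [𝒥.evo_eq_mul_add_divergence hφ hKΦ, Finset.sum_add_distrib, map_sum]
    congr 1
    exact Finset.sum_comm
  · rw [← Finset.sum_neg_distrib]
    exact Finset.sum_congr rfl fun j _ => hψ j i k _
  · have h1 := Finset.sum_congr rfl fun j (_ : j ∈ Finset.univ) => hψ' j i (w j)
    -- The sums telescope because `Dt` sends each `w j` to the next one; only `κ`, the `Dt` of the
    -- last one, survives.
    have h2 : ∑ j, 𝒥.bdryPred K φ j i (w j) Φt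
        - ∑ j, bdry 𝒥.D K φ.toLinearMap i (𝒥.Dt g (w j)) (𝒥.pS j Φt)
        = -bdry 𝒥.D K φ.toLinearMap i κ (𝒥.pS l Φt) := by
      obtain ⟨M, rfl⟩ : ∃ M, N = M + 1 := ⟨l.1, hl.symm⟩
      have hlast : l = Fin.last M := Fin.ext (by simpa using hl)
      rw [Fin.sum_univ_succ, Fin.sum_univ_castSucc]
      have e1 : 𝒥.bdryPred K φ 0 i (w 0) Φt = 0 := by simp [bdryPred]
      have e2 : 𝒥.Dt g (w (Fin.last M)) = κ := by rw [hw, dif_neg (by simp)]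
      have e3 : ∀ j : Fin M, 𝒥.bdryPred K φ j.succ i (w j.succ) Φt
          = bdry 𝒥.D K φ.toLinearMap i (𝒥.Dt g (w j.castSucc)) (𝒥.pS j.castSucc Φt) := by
        intro j
        rw [hw, dif_pos (by simp), bdryPred, dif_pos (by simp)]
        rfl
      rw [e1, e2, hlast, Finset.sum_congr rfl fun j _ => e3 j]
      ring
    -- The surviving `κ`, the linearization of `g` and the Hessian boundary terms together form a
    -- single s-derivative, so after integration only end-point values are left.
    have h3 : 𝒥.Ds (bdry 𝒥.D K φ.toLinearMap i ρ (𝒥.pS l Φt))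
        = bdry 𝒥.D K φ.toLinearMap i (∑ j, 𝒥.evo φ j (w j) g) (𝒥.pS l Φt)
          + bdry 𝒥.D K φ.toLinearMap i κ (𝒥.pS l Φt)
          + ∑ j, bdry 𝒥.D K (𝒥.evo φ j (w j)) i ρ (𝒥.pS l Φt) := by
      rw [𝒥.derivation_bdry 𝒥.D_Ds, hρ, hφs, 𝒥.bdry_add, ← 𝒥.bdry_sum_map]
      congr 2
      ext F
      rw [LinearMap.sum_apply]
      exact hφs F
    rw [h3, 𝒥.bdry_sum, hφs, map_sum]
    simp only [Finset.sum_add_distrib, Finset.sum_sub_distrib] at h1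
    simp only [map_sum]
    rw [Finset.sum_comm, ← h1]
    linear_combination -h2

end JetAlg

end

end CKScalar

/-! ### Scaling, the Poincaré lemma and the abstract construction formula. -/

namespace CKScalar

noncomputable section

namespace JetAlg

variable {N n : ℕ} {R : Type} [CommRing R] [Algebra ℝ R] (𝒥 : JetAlg N n R)

theorem D_s (i : Fin n) : 𝒥.D i (𝒥.y .s) = 0 := by rw [D, vf_y, compD]
theorem D_t (i : Fin n) : 𝒥.D i (𝒥.y .t) = 0 := by rw [D, vf_y, compD]
theorem Dt_s (g : R) : 𝒥.Dt g (𝒥.y .s) = 0 := by rw [Dt, vf_y, compDt]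
theorem Dt_t (g : R) : 𝒥.Dt g (𝒥.y .t) = 1 := by rw [Dt, vf_y, compDt]
theorem Dt_x (g : R) (i : Fin n) : 𝒥.Dt g (𝒥.y (.x i)) = 0 := by rw [Dt, vf_y, compDt]
theorem Ds_s : 𝒥.Ds (𝒥.y .s) = 1 := by rw [Ds, vf_y, Pi.single_eq_same]

/-- Compatibility of the scaling `σ` of the independent variables with differentiation. -/
structure IsScaled (g : R) (e σ : R →ₐ[ℝ] R) (F : R) : Prop where
  D : ∀ i, 𝒥.D i (σ F) = 𝒥.y .s * σ (𝒥.D i F)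
  Dt : 𝒥.Dt g (σ F) = 𝒥.y .s * σ (𝒥.Dt g F)
  Ds : 𝒥.Ds (σ F) = 𝒥.y .t * σ (𝒥.Dt g F) + ∑ i, 𝒥.y (.x i) * σ (𝒥.D i F)
  eval : e (σ F) = F

/-- Integration over the homotopy parameter. -/
structure IsAverage (g : R) (J : R →ₗ[ℝ] R) (e₀ e₁ : R →ₐ[ℝ] R) : Prop where
  D : ∀ i F, 𝒥.D i (J F) = J (𝒥.D i F)
  Dt : ∀ F, 𝒥.Dt g (J F) = J (𝒥.Dt g F)
  Ds : ∀ F, J (𝒥.Ds F) = e₁ F - e₀ F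
  t_mul : ∀ F, J (𝒥.y .t * F) = 𝒥.y .t * J F
  x_mul : ∀ i F, J (𝒥.y (.x i) * F) = 𝒥.y (.x i) * J F
  e₀_s : e₀ (𝒥.y .s) = 0
  e₁_s : e₁ (𝒥.y .s) = 1

variable {𝒥} {g : R} {J : R →ₗ[ℝ] R} {e₀ e₁ σ : R →ₐ[ℝ] R}

/-- The integrand is `Ds (s ^ (k + 1) * σ F)`, whose primitive is `F` at 1 and zero at 0, the
exponent being positive even for k = 0. -/
theorem IsAverage.integral_Ds_pow (hJ : 𝒥.IsAverage g J e₀ e₁) {F : R}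
    (hF : 𝒥.IsScaled g e₁ σ F) (k : ℕ) :
    J (((k + 1 : ℕ) : R) * (𝒥.y .s ^ k * σ F) + 𝒥.y .s ^ (k + 1) *
      (𝒥.y .t * σ (𝒥.Dt g F) + ∑ i, 𝒥.y (.x i) * σ (𝒥.D i F))) = F := by
  have h1 : 𝒥.Ds (𝒥.y .s ^ (k + 1) * σ F) = ((k + 1 : ℕ) : R) * (𝒥.y .s ^ k * σ F)
      + 𝒥.y .s ^ (k + 1) *
      (𝒥.y .t * σ (𝒥.Dt g F) + ∑ i, 𝒥.y (.x i) * σ (𝒥.D i F)) := by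
    rw [Derivation.leibniz, Derivation.leibniz_pow, 𝒥.Ds_s, hF.Ds]
    simp only [smul_eq_mul, nsmul_eq_mul, Nat.add_sub_cancel]
    ring
  rw [← h1, hJ.Ds, map_mul, map_mul, map_pow, map_pow, hJ.e₀_s, hJ.e₁_s, hF.eval]
  simp

theorem D_s_pow (i : Fin n) (k : ℕ) : 𝒥.D i (𝒥.y .s ^ k) = 0 := by
  rw [Derivation.leibniz_pow, 𝒥.D_s]; simp

theorem Dt_s_pow (k : ℕ) : 𝒥.Dt g (𝒥.y .s ^ k) = 0 := by
  rw [Derivation.leibniz_pow, 𝒥.Dt_s]; simp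

/-- The radial field with prescribed divergence. -/
theorem divergence_radial (hJ : 𝒥.IsAverage g J e₀ e₁) {F : R} (hF : 𝒥.IsScaled g e₁ σ F) :
    𝒥.Dt g (𝒥.y .t * J (𝒥.y .s ^ n * σ F))
      + ∑ i, 𝒥.D i (𝒥.y (.x i) * J (𝒥.y .s ^ n * σ F)) = F := by
  conv_rhs => rw [← hJ.integral_Ds_pow hF n]
  have h1 : ∀ i, 𝒥.D i (𝒥.y (.x i) * J (𝒥.y .s ^ n * σ F))
      = J (𝒥.y .s ^ n * σ F) + J (𝒥.y .s ^ (n + 1) * (𝒥.y (.x i) * σ (𝒥.D i F))) := fun i => by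
    rw [Derivation.leibniz, hJ.D, Derivation.leibniz (𝒥.D i) (𝒥.y .s ^ n), D_s_pow, hF.D, D_x,
      if_pos rfl, smul_eq_mul, smul_eq_mul, ← hJ.x_mul]
    simp only [smul_eq_mul, mul_zero, add_zero, mul_one]
    rw [add_comm]
    congr 2
    ring
  have h2 : 𝒥.Dt g (𝒥.y .t * J (𝒥.y .s ^ n * σ F))
      = J (𝒥.y .s ^ n * σ F) + J (𝒥.y .s ^ (n + 1) * (𝒥.y .t * σ (𝒥.Dt g F))) := by
    rw [Derivation.leibniz, hJ.Dt, Derivation.leibniz (𝒥.Dt g) (𝒥.y .s ^ n), Dt_s_pow, hF.Dt, Dt_t,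
      smul_eq_mul, smul_eq_mul, ← hJ.t_mul]
    simp only [smul_eq_mul, mul_zero, add_zero, mul_one]
    rw [add_comm]
    congr 2
    ring
  -- `t` and the `n` variables `xⁱ` contribute `n + 1` equal terms, the factor that
  -- `integral_Ds_pow` requires for the weight `s ^ n`.
  rw [h2, Finset.sum_congr rfl fun i _ => h1 i, Finset.sum_add_distrib, Finset.sum_const,
    Finset.card_univ, Fintype.card_fin, mul_add, Finset.mul_sum, map_add, map_add, map_sum,
    ← nsmul_eq_mul, map_nsmul, add_smul, one_smul]
  abel

/-- Contraction with the radial field. A divergence-free field is a closed n-form in n+1 variables,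
so the weight is `s ^ (n - 1)`. For n = 0 the claim fails: a nonzero constant is conserved but not a
divergence. -/
theorem poincare (hn : 0 < n) (hJ : 𝒥.IsAverage g J e₀ e₁) {Zt : R} {Zx : Fin n → R}
    (hZt : 𝒥.IsScaled g e₁ σ Zt) (hZx : ∀ i, 𝒥.IsScaled g e₁ σ (Zx i))
    (hZ : 𝒥.Dt g Zt + ∑ i, 𝒥.D i (Zx i) = 0) :
    ∃ (θ : Fin n → R) (ψ : Fin n → Fin n → R), (∀ i k, ψ i k = -ψ k i) ∧
      Zt = ∑ i, 𝒥.D i (θ i) ∧ ∀ i, Zx i = -𝒥.Dt g (θ i) + ∑ k, 𝒥.D k (ψ i k) := by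
  obtain ⟨m, rfl⟩ : ∃ m, n = m + 1 := ⟨n - 1, by omega⟩
  have hσZ : σ (𝒥.Dt g Zt) + ∑ i, σ (𝒥.D i (Zx i)) = 0 := by
    rw [← map_sum, ← map_add, hZ, map_zero]
  refine ⟨fun i => J (𝒥.y .s ^ m * (σ Zt * 𝒥.y (.x i) - σ (Zx i) * 𝒥.y .t)),
    fun i k => J (𝒥.y .s ^ m * (σ (Zx i) * 𝒥.y (.x k) - σ (Zx k) * 𝒥.y (.x i))),
    fun i k => ?_, ?_, fun i => ?_⟩
  · change J _ = -J _
    rw [← map_neg]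
    congr 1
    ring
  · conv_lhs => rw [← hJ.integral_Ds_pow hZt m]
    simp only [hJ.D]
    rw [← map_sum]
    congr 1
    have h1 : ∀ i, 𝒥.D i (𝒥.y .s ^ m * (σ Zt * 𝒥.y (.x i) - σ (Zx i) * 𝒥.y .t))
        = 𝒥.y .s ^ m * σ Zt + 𝒥.y .s ^ (m + 1) * (𝒥.y (.x i) * σ (𝒥.D i Zt))
          - 𝒥.y .s ^ (m + 1) * 𝒥.y .t * σ (𝒥.D i (Zx i)) := fun i => by
      rw [Derivation.leibniz, D_s_pow, map_sub, Derivation.leibniz, Derivation.leibniz, D_x,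
        if_pos rfl, D_t, hZt.D, (hZx i).D]
      simp only [smul_eq_mul]
      ring
    rw [Finset.sum_congr rfl fun i _ => h1 i, Finset.sum_sub_distrib, Finset.sum_add_distrib,
      Finset.sum_const, Finset.card_univ, Fintype.card_fin, ← Finset.mul_sum, ← Finset.mul_sum,
      nsmul_eq_mul]
    linear_combination 𝒥.y .s ^ (m + 1) * 𝒥.y .t * hσZ
  · conv_lhs => rw [← hJ.integral_Ds_pow (hZx i) m]
    simp only [hJ.D, hJ.Dt]
    rw [← map_sum, ← map_neg, ← map_add]
    congr 1
    have h1 : ∀ k, 𝒥.D k (𝒥.y .s ^ m * (σ (Zx i) * 𝒥.y (.x k) - σ (Zx k) * 𝒥.y (.x i)))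
        = 𝒥.y .s ^ m * σ (Zx i) + 𝒥.y .s ^ (m + 1) * (𝒥.y (.x k) * σ (𝒥.D k (Zx i)))
          - 𝒥.y .s ^ (m + 1) * 𝒥.y (.x i) * σ (𝒥.D k (Zx k))
          - (if k = i then 𝒥.y .s ^ m * σ (Zx k) else 0) := fun k => by
      rw [Derivation.leibniz, D_s_pow, map_sub, Derivation.leibniz, Derivation.leibniz, D_x,
        if_pos rfl, D_x, (hZx i).D, (hZx k).D]
      simp only [smul_eq_mul]
      split_ifs <;> ring
    have h2 : 𝒥.Dt g (𝒥.y .s ^ m * (σ Zt * 𝒥.y (.x i) - σ (Zx i) * 𝒥.y .t))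
        = 𝒥.y .s ^ (m + 1) * 𝒥.y (.x i) * σ (𝒥.Dt g Zt)
          - 𝒥.y .s ^ (m + 1) * 𝒥.y .t * σ (𝒥.Dt g (Zx i)) - 𝒥.y .s ^ m * σ (Zx i) := by
      rw [Derivation.leibniz, Dt_s_pow, map_sub, Derivation.leibniz, Derivation.leibniz, Dt_x,
        Dt_t, hZt.Dt, (hZx i).Dt]
      simp only [smul_eq_mul]
      ring
    rw [h2, Finset.sum_congr rfl fun i _ => h1 i, Finset.sum_sub_distrib, Finset.sum_sub_distrib,
      Finset.sum_add_distrib, Finset.sum_ite_eq' Finset.univ i,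
      Finset.sum_const, Finset.card_univ, Fintype.card_fin, ← Finset.mul_sum, ← Finset.mul_sum,
      nsmul_eq_mul, if_pos (Finset.mem_univ i)]
    linear_combination 𝒥.y .s ^ (m + 1) * 𝒥.y (.x i) * hσZ

/-- The compatibility of a homotopy `φ` with the derivations. -/
structure IsHomotopy (𝒥 : JetAlg N n R) (g : R) (φ : R →ₐ[ℝ] R) (l : Fin N) (ρ κ : R)
    (w : Fin N → R) : Prop where
  last : l.1 + 1 = N
  D : ∀ i F, φ (𝒥.D i F) = 𝒥.D i (φ F)
  Dt : ∀ F, 𝒥.Dt g (φ F) = φ (𝒥.Dt g F) + 𝒥.evo φ l ρ F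
  Ds : ∀ F, 𝒥.Ds (φ F) = ∑ j, 𝒥.evo φ j (w j) F
  Dt_w : ∀ j, 𝒥.Dt g (w j) = if h : j.1 + 1 < N then w ⟨j.1 + 1, h⟩ else κ
  Ds_ρ : 𝒥.Ds ρ = 𝒥.Ds (φ g) + κ

theorem bdry_mem (𝔅 : Subalgebra ℝ R) (h𝔅 : ∀ i, ∀ F ∈ 𝔅, 𝒥.D i F ∈ 𝔅)
    (he : ∀ i F, e₀ (𝒥.D i F) = 𝒥.D i (e₀ F)) {ψ : R →ₗ[ℝ] R} (hψ : ∀ F, e₀ (ψ F) ∈ 𝔅) {ρ : R}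
    (hρ : e₀ ρ ∈ 𝔅) (K : ℕ) (i : Fin n) (a : List (Fin n) → R) :
    e₀ (bdry 𝒥.D K ψ i ρ a) ∈ 𝔅 := by
  rw [bdry, map_sum]
  refine 𝔅.sum_mem fun P _ => ?_
  rw [map_mul, map_mul, map_pow, map_neg, map_one]
  refine 𝔅.mul_mem (𝔅.mul_mem (𝔅.pow_mem (𝔅.neg_mem 𝔅.one_mem) _) ?_) (hψ _)
  rw [show e₀ (listIter (fun i => ⇑(𝒥.D i)) P.1 ρ) = listIter (fun i => ⇑(𝒥.D i)) P.1 (e₀ ρ) from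
    𝒥.linearMap_listIter (X := e₀.toLinearMap) he P.1 ρ]
  induction P.1 with
  | nil => exact hρ
  | cons j I ih => exact h𝔅 j _ ih

/-- Integrating `homotopy_law` leaves a residue at s = 0 inside `𝔅`, the functions of the
independent variables. Scaling is compatible with the derivations only there, and there the radial
field and `poincare` dispose of the residue. -/
theorem construction_formula (hn : 0 < n) (hJ : 𝒥.IsAverage g J e₀ e₁) {φ : R →ₐ[ℝ] R}
    {l : Fin N} {ρ κ : R} {w : Fin N → R} (hφ : 𝒥.IsHomotopy g φ l ρ κ w)
    (he₀ : ∀ i F, e₀ (𝒥.D i F) = 𝒥.D i (e₀ F)) (he₁ : ∀ i F, e₁ (𝒥.D i F) = 𝒥.D i (e₁ F))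
    (he₀t : ∀ F, e₀ (𝒥.Dt g F) = 𝒥.Dt g (e₀ F)) (hρ : e₁ ρ = 0)
    (𝔅 : Subalgebra ℝ R) (h𝔅 : ∀ F ∈ 𝔅, 𝒥.IsScaled g e₁ σ F) (h𝔅D : ∀ i, ∀ F ∈ 𝔅, 𝒥.D i F ∈ 𝔅)
    (h𝔅t : 𝒥.y .t ∈ 𝔅) (h𝔅x : ∀ i, 𝒥.y (.x i) ∈ 𝔅) (h𝔅φ : ∀ F, e₀ (φ F) ∈ 𝔅) (h𝔅ρ : e₀ ρ ∈ 𝔅)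
    (h𝔅σ : ∀ F, J (𝒥.y .s ^ n * σ F) ∈ 𝔅)
    {Φt : R} {Φx : Fin n → R} (hΦ : 𝒥.Dt g Φt + ∑ i, 𝒥.D i (Φx i) = 0)
    (h₁t : e₁ (φ Φt) = Φt) (h₁x : ∀ i, e₁ (φ (Φx i)) = Φx i) {K : ℕ}
    (hKΦ : 𝒥.HasOrder K Φt) (hKg : 𝒥.HasOrder K g) {Λ : R} (hΛ : Λ = 𝒥.E K l Φt)
    (hKΛ : 𝒥.HasOrder K Λ) :
    ∃ (θ : Fin n → R) (ψ : Fin n → Fin n → R), (∀ i k, ψ i k = -ψ k i) ∧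
      Φt - (J (∑ j, w j * φ (𝒥.E K j Φt)) + 𝒥.y .t * J (𝒥.y .s ^ n * σ (e₀ (ρ * φ Λ))))
        = ∑ i, 𝒥.D i (θ i) ∧
      ∀ i, Φx i - (𝒥.y (.x i) * J (𝒥.y .s ^ n * σ (e₀ (ρ * φ Λ)))
          + J (∑ j, bdry 𝒥.D K LinearMap.id i (w j) (fun I => φ (𝒥.pS j g I) * φ Λ)
            + ∑ j, bdry 𝒥.D K LinearMap.id i (w j) (fun I => φ (𝒥.pS j Λ I) * ρ)))
        = -𝒥.Dt g (θ i) + ∑ k, 𝒥.D k (ψ i k) := by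
  obtain ⟨θ, hθ, ψ, hψ, hψ'⟩ := 𝒥.homotopy_law hφ.D hφ.last hφ.Dt hφ.Ds hφ.Dt_w hφ.Ds_ρ hΦ hKΦ hKg
    hΛ hKΛ
  set κ₀ := e₀ (ρ * φ Λ) with hκ₀
  have hκ₀𝔅 : κ₀ ∈ 𝔅 := by
    rw [hκ₀, map_mul]
    exact 𝔅.mul_mem h𝔅ρ (h𝔅φ Λ)
  set B : Fin n → R := fun i => bdry 𝒥.D K φ.toLinearMap i ρ (𝒥.pS l Φt) with hB
  have hB₀ : ∀ i, e₀ (B i) ∈ 𝔅 := fun i =>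
    bdry_mem 𝔅 h𝔅D he₀ (ψ := φ.toLinearMap) h𝔅φ h𝔅ρ K i _
  have hB₁ : ∀ i, e₁ (B i) = 0 := fun i => by
    have : e₁ (B i) ∈ (⊥ : Ideal R) := by
      simp only [hB, bdry, map_sum]
      refine Ideal.sum_mem _ fun P _ => ?_
      rw [map_mul, map_mul, show e₁ (listIter (fun i => ⇑(𝒥.D i)) P.1 ρ)
        = listIter (fun i => ⇑(𝒥.D i)) P.1 (e₁ ρ) from
        𝒥.linearMap_listIter (X := e₁.toLinearMap) he₁ P.1 ρ, hρ, listIter_zero, mul_zero, zero_mul]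
      exact Ideal.zero_mem _
    simpa using this
  -- The residue at s = 0, corrected by the radial field.
  set Zt : R := e₀ (φ Φt) - 𝒥.y .t * J (𝒥.y .s ^ n * σ κ₀) with hZt
  set Zx : Fin n → R := fun i =>
    e₀ (φ (Φx i)) - e₀ (B i) - 𝒥.y (.x i) * J (𝒥.y .s ^ n * σ κ₀) with hZx
  -- Commuting `φ` with `Dt` produces `evo φ l ρ Φt`, that is `ρ * φ Λ` plus the divergence of `B`.
  -- Subtracting `B` leaves the source `κ₀`, which the radial field cancels.
  have hdiv : 𝒥.Dt g Zt + ∑ i, 𝒥.D i (Zx i) = 0 := by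
    have h1 := divergence_radial hJ (h𝔅 _ hκ₀𝔅)
    have h2 := congrArg (fun F => e₀ (φ F)) hΦ
    have h3 := congrArg e₀ (𝒥.evo_eq_mul_add_divergence hφ.D hKΦ l ρ)
    have h4 := congrArg e₀ (hφ.Dt Φt)
    simp only [hZt, hZx, map_sub, Finset.sum_sub_distrib]
    simp only [map_add, map_sum, map_zero, he₀, hφ.D, he₀t] at h1 h2 h3 h4
    rw [← hΛ, ← hκ₀] at h3
    linear_combination h2 + h3 + h4 - h1
  obtain ⟨θ₀, ψ₀, hψ₀, hθ₀, hψ₀'⟩ := poincare hn hJ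
    (h𝔅 Zt (𝔅.sub_mem (h𝔅φ _) (𝔅.mul_mem h𝔅t (h𝔅σ _))))
    (fun i => h𝔅 (Zx i) (𝔅.sub_mem (𝔅.sub_mem (h𝔅φ _) (hB₀ i)) (𝔅.mul_mem (h𝔅x i) (h𝔅σ _)))) hdiv
  refine ⟨fun i => J (θ i) + θ₀ i, fun i k => J (ψ i k) + ψ₀ i k, fun i k => ?_, ?_, fun i => ?_⟩
  · change J (ψ i k) + ψ₀ i k = -(J (ψ k i) + ψ₀ k i)
    rw [hψ, hψ₀, map_neg, neg_add]
  · have h1 := congrArg J hθ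
    rw [hJ.Ds, h₁t, map_add, map_sum J (fun i => 𝒥.D i (θ i))] at h1
    simp only [map_add, Finset.sum_add_distrib, ← hθ₀, hJ.D]
    rw [hZt]
    linear_combination h1
  · have h1 := congrArg J (hψ' i)
    rw [map_sub, map_sub, map_add, hJ.Ds, hJ.Ds, h₁x, hB₁, map_sum J (fun k => 𝒥.D k (ψ i k))] at h1
    have h2 := hψ₀' i
    simp only [map_add, Finset.sum_add_distrib, hJ.D, hJ.Dt] at h1 ⊢
    simp only [hZx] at h2
    linear_combination h1 + h2

/-- Trivial laws are divergence free: the `θ` terms cancel because `Dt` and `D i` commute, and the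
double divergence of a skew matrix is its own negative. -/
theorem conserved_of_trivial {Φt Ψt : R} {Φx Ψx : Fin n → R} {θ : Fin n → R} {ψ : Fin n → Fin n → R}
    (hΦ : 𝒥.Dt g Φt + ∑ i, 𝒥.D i (Φx i) = 0) (hψ : ∀ i k, ψ i k = -ψ k i)
    (ht : Φt - Ψt = ∑ i, 𝒥.D i (θ i))
    (hx : ∀ i, Φx i - Ψx i = -𝒥.Dt g (θ i) + ∑ k, 𝒥.D k (ψ i k)) :
    𝒥.Dt g Ψt + ∑ i, 𝒥.D i (Ψx i) = 0 := by
  have h1 := congrArg (𝒥.Dt g) ht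
  have h2 := Finset.sum_congr rfl fun i (_ : i ∈ Finset.univ) => congrArg (𝒥.D i) (hx i)
  simp only [map_sub, map_add, map_neg, map_sum, Finset.sum_sub_distrib, Finset.sum_add_distrib,
    Finset.sum_neg_distrib, 𝒥.D_Dt] at h1 h2
  have h3 : ∑ i, ∑ k, 𝒥.D i (𝒥.D k (ψ i k)) = 0 := by
    have h4 : ∑ i, ∑ k, 𝒥.D i (𝒥.D k (ψ i k)) = -∑ i, ∑ k, 𝒥.D i (𝒥.D k (ψ i k)) := by
      conv_lhs => rw [Finset.sum_comm]
      rw [← Finset.sum_neg_distrib]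
      refine Finset.sum_congr rfl fun i _ => ?_
      rw [← Finset.sum_neg_distrib]
      refine Finset.sum_congr rfl fun k _ => ?_
      rw [hψ, map_neg, map_neg, 𝒥.D_comm]
    have h5 : (2 : ℝ) • ∑ i, ∑ k, 𝒥.D i (𝒥.D k (ψ i k)) = 0 := by
      rw [two_smul]
      exact eq_neg_iff_add_eq_zero.1 h4
    have h6 := congrArg (fun F => (2 : ℝ)⁻¹ • F) h5
    simpa [smul_smul] using h6
  linear_combination hΦ - h1 - h2 - h3

end JetAlg

end

end CKScalar

/-! ### The concrete jet algebra and its substitution maps. -/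

namespace CKScalar

noncomputable section

open TopologicalSpace

/-! ### Functions of the independent variables -/

section BaseFunctions

variable {n : ℕ} {B : Set (Base n)} {f : Base n → ℝ}

theorem hasDerivAt_baseDt {p : Base n} (hf : DifferentiableAt ℝ f p) :
    HasDerivAt (fun r => f (r, p.2)) (fderiv ℝ f p (1, 0)) p.1 :=
  HasFDerivAt.comp_hasDerivAt (x := p.1) (f := fun r : ℝ => ((r, p.2) : Base n)) (l := f)
    hf.hasFDerivAt ((hasDerivAt_id p.1).prodMk (hasDerivAt_const _ _))

theorem hasDerivAt_baseDx {p : Base n} (hf : DifferentiableAt ℝ f p) (i : Fin n) :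
    HasDerivAt (fun r => f (p.1, Function.update p.2 i r)) (fderiv ℝ f p (0, Pi.single i 1))
      (p.2 i) := by
  have h : HasDerivAt (fun r : ℝ => ((p.1, Function.update p.2 i r) : Base n)) (0, Pi.single i 1)
      (p.2 i) := (hasDerivAt_const _ _).prodMk (_root_.hasDerivAt_update p.2 i (p.2 i))
  refine HasFDerivAt.comp_hasDerivAt (x := p.2 i) (l := f) ?_ h
  simpa using hf.hasFDerivAt

theorem contDiffOn_baseDt (hB : IsOpen B) (hf : ContDiffOn ℝ ∞ f B) :
    ContDiffOn ℝ ∞ (baseDt f) B := by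
  have h1 : ContDiffOn ℝ ∞ (fun p => fderiv ℝ f p (1, 0)) B :=
    ((contDiffOn_infty_iff_fderiv_of_isOpen hB).1 hf).2.clm_apply contDiffOn_const
  exact h1.congr fun p hp => (hasDerivAt_baseDt ((hf.contDiffAt (hB.mem_nhds hp)).differentiableAt
    (by simp))).deriv

theorem contDiffOn_baseDx (hB : IsOpen B) (hf : ContDiffOn ℝ ∞ f B) (i : Fin n) :
    ContDiffOn ℝ ∞ (baseDx i f) B := by
  have h1 : ContDiffOn ℝ ∞ (fun p => fderiv ℝ f p (0, Pi.single i 1)) B :=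
    ((contDiffOn_infty_iff_fderiv_of_isOpen hB).1 hf).2.clm_apply contDiffOn_const
  exact h1.congr fun p hp => (hasDerivAt_baseDx ((hf.contDiffAt (hB.mem_nhds hp)).differentiableAt
    (by simp)) i).deriv

theorem multiIter_invariant {A : Type*} {P : A → Prop} {D : Fin n → A → A}
    (hD : ∀ i F, P F → P (D i F)) (α : Fin n → ℕ) {F : A} (hF : P F) : P (multiIter D α F) := by
  rw [multiIter]
  induction List.finRange n with
  | nil => exact hF
  | cons i l ih =>
    rw [List.foldr_cons]
    induction α i with
    | zero => exact ih
    | succ m ihm => rw [Function.iterate_succ_apply']; exact hD i _ ihm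

theorem iterate_invariant {A : Type*} {P : A → Prop} {D : A → A}
    (hD : ∀ F, P F → P (D F)) (k : ℕ) {F : A} (hF : P F) : P (D^[k] F) := by
  induction k with
  | zero => exact hF
  | succ m ih => rw [Function.iterate_succ_apply']; exact hD _ ih

theorem contDiffOn_iterate_baseDt (hB : IsOpen B) (hf : ContDiffOn ℝ ∞ f B) (k : ℕ)
    (α : Fin n → ℕ) : ContDiffOn ℝ ∞ (baseDt^[k] (multiIter baseDx α f)) B :=
  iterate_invariant (P := fun f => ContDiffOn ℝ ∞ f B) (D := baseDt)
    (fun _ h => contDiffOn_baseDt hB h) k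
    (multiIter_invariant (P := fun f => ContDiffOn ℝ ∞ f B) (D := baseDx)
      (fun i _ h => contDiffOn_baseDx hB h i) α hf)

end BaseFunctions

/-! ### The domain of the homotopy -/

variable {N n : ℕ}

/-- The jet underlying a point of the extended coordinate space. -/
def toJet (q : Idx N n → ℝ) : Jet N n := ((q .t, fun i => q (.x i)), fun c => q (.u c))

/-- The point with prescribed homotopy parameter and jet. -/
def ofJet (s : ℝ) (z : Jet N n) : Idx N n → ℝ
  | .s => s
  | .t => z.1.1
  | .x i => z.1.2 i
  | .u c => z.2 c

@[simp] theorem toJet_ofJet (s : ℝ) (z : Jet N n) : toJet (ofJet s z) = z := rfl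

theorem ofJet_toJet (q : Idx N n → ℝ) (s : ℝ) : ofJet s (toJet q) = Function.update q .s s := by
  ext b
  match b with
  | .s => simp [ofJet]
  | .t => simp [ofJet, toJet]
  | .x i => simp [ofJet, toJet]
  | .u c => simp [ofJet, toJet]

@[simp] theorem toJet_update (q : Idx N n → ℝ) (s : ℝ) :
    toJet (Function.update q .s s) = toJet q := by
  rw [← ofJet_toJet, toJet_ofJet]

theorem continuous_toJet : Continuous (toJet : (Idx N n → ℝ) → Jet N n) := by
  unfold toJet
  fun_prop

theorem interp_one (v : Base n → ℝ) (z : Jet N n) : interp v 1 z = z := by simp [interp]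

theorem interp_zero (v : Base n → ℝ) (z : Jet N n) : interp v 0 z = jetOf v z.1 := by
  simp [interp, jetOf]

theorem interp_jetOf (v : Base n → ℝ) (p : Base n) (s : ℝ) :
    interp v s (jetOf v p : Jet N n) = jetOf v p := by
  refine Prod.ext rfl (funext fun c => ?_)
  change s * (jetOf v p : Jet N n).2 c + (1 - s) * (jetOf v p : Jet N n).2 c = _
  ring

/-- A region on which the construction formula is nonsingular. -/
structure Region (N n : ℕ) where
  U : Set (Jet N n)
  isOpen : IsOpen U
  v : Base n → ℝ
  smooth : ContDiffOn ℝ ∞ v (Prod.fst '' U)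
  seg : ∀ z ∈ U, ∀ s ∈ Set.Icc (0 : ℝ) 1, interp v s z ∈ U
  ray : ∀ p ∈ Prod.fst '' U, ∀ s ∈ Set.Icc (0 : ℝ) 1, s • p ∈ Prod.fst '' U

namespace Region

variable (𝒰 : Region N n)

/-- The projection of the region to the independent variables. -/
def B : Set (Base n) := Prod.fst '' 𝒰.U

theorem isOpen_B : IsOpen 𝒰.B := isOpenMap_fst _ 𝒰.isOpen

variable {𝒰} in
theorem fst_mem {z : Jet N n} (hz : z ∈ 𝒰.U) : z.1 ∈ 𝒰.B := ⟨z, hz, rfl⟩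

theorem jetOf_mem {p : Base n} (hp : p ∈ 𝒰.B) : (jetOf 𝒰.v p : Jet N n) ∈ 𝒰.U := by
  obtain ⟨z, hz, rfl⟩ := hp
  rw [← interp_zero]
  exact 𝒰.seg z hz 0 (by simp)

theorem contDiffOn_jetOf (c : Coord N n) :
    ContDiffOn ℝ ∞ (fun p => (jetOf 𝒰.v p : Jet N n).2 c) 𝒰.B :=
  contDiffOn_iterate_baseDt 𝒰.isOpen_B 𝒰.smooth _ _

theorem continuousOn_jetOf : ContinuousOn (fun p => (jetOf 𝒰.v p : Jet N n)) 𝒰.B :=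
  continuousOn_id.prodMk (continuousOn_pi.2 fun c => (𝒰.contDiffOn_jetOf c).continuousOn)

/-- The domain of the homotopy. -/
def W : Opens (Idx N n → ℝ) where
  -- The parameter is not confined to [0,1]: every value for which the interpolated jet and the
  -- scaled base point remain admissible is allowed. So the set is open, yet contains all of [0,1] ×
  -- U.
  carrier := {q | toJet q ∈ 𝒰.U ∧ interp 𝒰.v (q .s) (toJet q) ∈ 𝒰.U ∧ q .s • (toJet q).1 ∈ 𝒰.B}
  is_open' := by
    have h1 : IsOpen (toJet ⁻¹' 𝒰.U) := 𝒰.isOpen.preimage continuous_toJet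
    have h2 : ContinuousOn (fun q => interp 𝒰.v (q .s) (toJet q)) (toJet ⁻¹' 𝒰.U) := by
      have hs : Continuous fun q : Idx N n → ℝ => q .s := continuous_apply _
      have h3 : ContinuousOn (fun q : Idx N n → ℝ => (jetOf 𝒰.v (toJet q).1 : Jet N n))
          (toJet ⁻¹' 𝒰.U) := 𝒰.continuousOn_jetOf.comp
            (continuous_fst.comp continuous_toJet).continuousOn fun q hq => fst_mem hq
      refine (continuous_fst.comp continuous_toJet).continuousOn.prodMk ?_
      exact (hs.continuousOn.smul (continuous_snd.comp continuous_toJet).continuousOn).add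
        ((continuous_const.sub hs).continuousOn.smul (continuous_snd.comp_continuousOn h3))
    have h4 : Continuous fun q : Idx N n → ℝ => q .s • (toJet q).1 :=
      (continuous_apply _).smul (continuous_fst.comp continuous_toJet)
    have h5 := (h2.isOpen_inter_preimage h1 𝒰.isOpen).inter (𝒰.isOpen_B.preimage h4)
    convert h5 using 1
    ext q
    simp only [Set.mem_ofPred_eq, Set.mem_inter_iff, Set.mem_preimage, and_assoc]

theorem ofJet_mem {s : ℝ} (hs : s ∈ Set.Icc (0 : ℝ) 1) {z : Jet N n} (hz : z ∈ 𝒰.U) :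
    ofJet s z ∈ 𝒰.W := ⟨hz, 𝒰.seg z hz s hs, 𝒰.ray z.1 (fst_mem hz) s hs⟩

theorem update_mem (q : Idx N n → ℝ) (hq : q ∈ 𝒰.W) (r : ℝ) (hr : r ∈ Set.Icc (0 : ℝ) 1) :
    Function.update q .s r ∈ 𝒰.W := by
  rw [← ofJet_toJet]
  exact 𝒰.ofJet_mem hr hq.1

/-- The algebra of smooth functions on the domain of the homotopy. -/
abbrev R : Type := Cyl 𝒰.W

/-- The jet algebra structure given by the partial derivatives. -/
def jet : JetAlg N n 𝒰.R where
  d := dif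
  symm F b c := pd_comm c b F
  y := coord 𝒰.W
  d_y := dif_coord

theorem isCyl_ofBase {f : Base n → ℝ} (hf : ContDiffOn ℝ ∞ f 𝒰.B) {c : 𝒰.W → ℝ}
    (hc : IsCyl 𝒰.W c) (hmem : ∀ q : 𝒰.W, c q • (toJet q.1).1 ∈ 𝒰.B) :
    IsCyl 𝒰.W fun q => f (c q • (toJet q.1).1) := by
  refine isCyl_comp (K := Option (Option (Fin n)))
    (fun | none => c | some none => fun q => q.1 .t | some (some i) => fun q => q.1 (.x i))
    (fun | none => hc | some none => isCyl_coord _ | some (some i) => isCyl_coord _)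
    (fun y => f (y none • ((y (some none), fun i => y (some (some i))) : Base n)))
    (fun q => ?_) fun q => rfl
  refine ContDiffAt.comp (g := f) _ (hf.contDiffAt (𝒰.isOpen_B.mem_nhds (hmem q))) ?_
  refine ContDiff.contDiffAt ?_
  exact (contDiff_apply ℝ ℝ _).smul ((contDiff_apply ℝ ℝ _).prodMk
    (contDiff_pi.2 fun i => contDiff_apply ℝ ℝ _))

theorem isCyl_base {f : Base n → ℝ} (hf : ContDiffOn ℝ ∞ f 𝒰.B) :
    IsCyl 𝒰.W fun q => f (toJet q.1).1 := by
  have := 𝒰.isCyl_ofBase hf (c := fun _ => 1) (isCyl_const 1)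
    (fun q => by rw [one_smul]; exact fst_mem q.2.1)
  simpa only [one_smul] using this

theorem isCyl_s : IsCyl 𝒰.W fun q => q.1 .s := isCyl_coord _

/-- The homotopy `u ↦ u_(s)`. -/
def homFun (q : 𝒰.W) : 𝒰.W :=
  -- Any parameter in [0,1] would be admissible; the value 1 makes `ev_one_hom` true without a
  -- condition on `F`.
  ⟨ofJet 1 (interp 𝒰.v (q.1 .s) (toJet q.1)), 𝒰.ofJet_mem (by simp) q.2.2.1⟩

/-- Evaluation of the homotopy parameter. -/
def evalFun (r : Set.Icc (0 : ℝ) 1) (q : 𝒰.W) : 𝒰.W :=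
  ⟨ofJet r (toJet q.1), 𝒰.ofJet_mem r.2 q.2.1⟩

/-- Scaling of the independent variables. -/
def scaleFun (q : 𝒰.W) : 𝒰.W :=
  ⟨ofJet 0 (jetOf 𝒰.v (q.1 .s • (toJet q.1).1)), 𝒰.ofJet_mem (by simp) (𝒰.jetOf_mem q.2.2.2)⟩

theorem isCyl_homFun (b : Idx N n) : IsCyl 𝒰.W fun q => (𝒰.homFun q).1 b := by
  match b with
  | .s => exact isCyl_const 1
  | .t => exact isCyl_coord _
  | .x i => exact isCyl_coord _
  | .u c =>
    exact ((Cyl.mk _ 𝒰.isCyl_s * coord _ (.u c) +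
      (1 - Cyl.mk _ 𝒰.isCyl_s) * Cyl.mk _ (𝒰.isCyl_base (𝒰.contDiffOn_jetOf c)) : 𝒰.R)).isCyl

theorem isCyl_evalFun (r : Set.Icc (0 : ℝ) 1) (b : Idx N n) :
    IsCyl 𝒰.W fun q => (𝒰.evalFun r q).1 b := by
  match b with
  | .s => exact isCyl_const _
  | .t => exact isCyl_coord _
  | .x i => exact isCyl_coord _
  | .u c => exact isCyl_coord _

theorem isCyl_scaleFun (b : Idx N n) : IsCyl 𝒰.W fun q => (𝒰.scaleFun q).1 b := by
  match b with
  | .s => exact isCyl_const _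
  | .t => exact (Cyl.mk _ 𝒰.isCyl_s * coord _ .t : 𝒰.R).isCyl
  | .x i => exact (Cyl.mk _ 𝒰.isCyl_s * coord _ (.x i) : 𝒰.R).isCyl
  | .u c => exact 𝒰.isCyl_ofBase (𝒰.contDiffOn_jetOf c) 𝒰.isCyl_s fun q => q.2.2.2

/-- Substitution of `u_(s)`. -/
def hom : 𝒰.R →ₐ[ℝ] 𝒰.R := pull 𝒰.homFun 𝒰.isCyl_homFun

/-- Evaluation at a value of the homotopy parameter. -/
def ev (r : Set.Icc (0 : ℝ) 1) : 𝒰.R →ₐ[ℝ] 𝒰.R := pull (𝒰.evalFun r) (𝒰.isCyl_evalFun r)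

/-- Restriction to the reference function, composed with scaling. -/
def scale : 𝒰.R →ₐ[ℝ] 𝒰.R := pull 𝒰.scaleFun 𝒰.isCyl_scaleFun

/-- Integration over the homotopy parameter. -/
def avgS : 𝒰.R →ₗ[ℝ] 𝒰.R := avg .s 𝒰.update_mem

theorem vf_pull (Ψ : 𝒰.W → 𝒰.W) (hΨ : ∀ b, IsCyl 𝒰.W (fun q => (Ψ q).1 b)) (Y : Idx N n → 𝒰.R)
    (F : 𝒰.R) : vf 𝒰.jet.d Y (pull Ψ hΨ F)
      = vfa 𝒰.jet.d (pull Ψ hΨ) (fun b => vf 𝒰.jet.d Y (pull Ψ hΨ (𝒰.jet.y b))) F := by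
  change Finsupp.linearCombination 𝒰.R Y (dif (pull Ψ hΨ F)) = _
  rw [dif_pull, Finsupp.sum, map_sum, vfa, Finsupp.sum]
  refine Finset.sum_congr rfl fun b _ => ?_
  rw [map_smul, smul_eq_mul, mul_comm]
  rfl

/-- By the chain rule both sides are derivations along the pull-back, so agreement on coordinates is
enough. -/
theorem vf_pull_comm (Ψ : 𝒰.W → 𝒰.W) (hΨ : ∀ b, IsCyl 𝒰.W (fun q => (Ψ q).1 b))
    {Y Y' : Idx N n → 𝒰.R}
    (h : ∀ b, vf 𝒰.jet.d Y (pull Ψ hΨ (𝒰.jet.y b)) = pull Ψ hΨ (Y' b)) (F : 𝒰.R) :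
    pull Ψ hΨ (vf 𝒰.jet.d Y' F) = vf 𝒰.jet.d Y (pull Ψ hΨ F) := by
  rw [𝒰.vf_pull, map_vf]
  congr 1
  exact funext fun b => (h b).symm

end Region

end

end CKScalar

/-! ### Compatibility of homotopy, evaluation, average and scaling with the total derivatives. -/

namespace CKScalar

noncomputable section

variable {N n : ℕ}

namespace JetAlg

variable {R : Type} [CommRing R] [Algebra ℝ R] (𝒥 : JetAlg N n R)

theorem linearMap_multiIter {X : R →ₗ[ℝ] R} (hX : ∀ i F, X (𝒥.D i F) = 𝒥.D i (X F))
    (α : Fin n → ℕ) (F : R) : X (multiIter (fun i => ⇑(𝒥.D i)) α F)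
      = multiIter (fun i => ⇑(𝒥.D i)) α (X F) := by
  induction α using multiIter_induction with
  | h0 => simp only [multiIter_zero]
  | hs α i ih => simp only [multiIter_add_single _ 𝒥.D_comm]; rw [hX, ih]

theorem multiIter_mul_left {A : R} (hA : ∀ i, 𝒥.D i A = 0) (α : Fin n → ℕ) (F : R) :
    multiIter (fun i => ⇑(𝒥.D i)) α (A * F) = A * multiIter (fun i => ⇑(𝒥.D i)) α F :=
  (𝒥.linearMap_multiIter (X := LinearMap.mulLeft ℝ A) (fun i F => by
    simp [Derivation.leibniz, hA]) α F).symm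

theorem multiIter_sub (α : Fin n → ℕ) (F G : R) :
    multiIter (fun i => ⇑(𝒥.D i)) α (F - G)
      = multiIter (fun i => ⇑(𝒥.D i)) α F - multiIter (fun i => ⇑(𝒥.D i)) α G := by
  have := multiIter_add (D := 𝒥.D) α (F - G) G
  rw [sub_add_cancel] at this
  rw [this, add_sub_cancel_right]

theorem multiIter_y (j : Fin N) (α : Fin n → ℕ) :
    multiIter (fun i => ⇑(𝒥.D i)) α (𝒥.y (.u (j, 0))) = 𝒥.y (.u (j, α)) := by
  induction α using multiIter_induction with
  | h0 => simp only [multiIter_zero]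
  | hs α i ih => rw [multiIter_add_single _ 𝒥.D_comm, ih, D, vf_y, compD]

theorem Ds_y (c : Coord N n) : 𝒥.Ds (𝒥.y (.u c)) = 0 := by
  rw [Ds, vf_y, Pi.single_eq_of_ne (by simp)]

theorem Ds_eq (F : R) : 𝒥.Ds F = 𝒥.d F .s := by
  classical
  rw [Ds, vf_eq_vfa, vfa_eq_of_subset (s := insert .s (𝒥.d F).support) (Finset.subset_insert _ _)]
  refine (Finset.sum_eq_single Idx.s (fun b _ hb => by rw [Pi.single_eq_of_ne hb, zero_mul])
    (fun h => absurd (Finset.mem_insert_self _ _) h)).trans ?_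
  rw [Pi.single_eq_same, one_mul]
  rfl

end JetAlg

namespace Region

variable (𝒰 : Region N n)

/-- The element `F` of the algebra is the function `f` of the independent variables. -/
def IsBase (f : Base n → ℝ) (F : 𝒰.R) : Prop :=
  ContDiffOn ℝ ∞ f 𝒰.B ∧ ∀ q, F q = f (toJet q.1).1

variable {𝒰}

theorem isBase_mk {f : Base n → ℝ} (hf : ContDiffOn ℝ ∞ f 𝒰.B) :
    𝒰.IsBase f (Cyl.mk _ (𝒰.isCyl_base hf)) := ⟨hf, fun _ => rfl⟩

theorem IsBase.unique {f : Base n → ℝ} {F G : 𝒰.R} (hF : 𝒰.IsBase f F) (hG : 𝒰.IsBase f G) :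
    F = G := Cyl.ext fun q => by rw [hF.2, hG.2]

theorem IsBase.d_t {f : Base n → ℝ} {F : 𝒰.R} (hF : 𝒰.IsBase f F) (q : 𝒰.W) :
    𝒰.jet.d F .t q = baseDt f (toJet q.1).1 := by
  refine (pd_apply _ _ _).trans (HasDerivAt.deriv ?_)
  have h1 := hasDerivAt_baseDt ((hF.1.contDiffAt (𝒰.isOpen_B.mem_nhds (fst_mem q.2.1))).differentiableAt
    (by simp))
  rw [baseDt, h1.deriv]
  refine HasDerivAt.congr_of_eventuallyEq h1 ?_
  filter_upwards [eventually_update_mem q .t] with x hx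
  rw [extZero_of_mem _ hx, hF.2]
  simp [toJet]

theorem IsBase.d_x {f : Base n → ℝ} {F : 𝒰.R} (hF : 𝒰.IsBase f F) (i : Fin n) (q : 𝒰.W) :
    𝒰.jet.d F (.x i) q = baseDx i f (toJet q.1).1 := by
  refine (pd_apply _ _ _).trans (HasDerivAt.deriv ?_)
  have h1 := hasDerivAt_baseDx ((hF.1.contDiffAt (𝒰.isOpen_B.mem_nhds (fst_mem q.2.1))).differentiableAt
    (by simp)) i
  rw [baseDx, h1.deriv]
  refine HasDerivAt.congr_of_eventuallyEq h1 ?_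
  filter_upwards [eventually_update_mem q (.x i)] with x hx
  rw [extZero_of_mem _ hx, hF.2]
  congr 1
  refine Prod.ext (by simp [toJet]) (funext fun k => ?_)
  by_cases h : k = i
  · subst h; simp [toJet]
  · simp [toJet, h]

theorem IsBase.indepOf {f : Base n → ℝ} {F : 𝒰.R} (hF : 𝒰.IsBase f F) {b : Idx N n}
    (hb : b ≠ .t) (hb' : ∀ i, b ≠ .x i) : F.IndepOf b := by
  intro q r h
  rw [hF.2, hF.2]
  congr 1
  exact Prod.ext (by simp [toJet, hb.symm]) (funext fun k => by simp [toJet, (hb' k).symm])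

theorem IsBase.vfa_eq {f : Base n → ℝ} {F : 𝒰.R} (hF : 𝒰.IsBase f F) (φ : 𝒰.R →ₐ[ℝ] 𝒰.R)
    (Y : Idx N n → 𝒰.R) : vfa 𝒰.jet.d φ Y F
      = Y .t * φ (𝒰.jet.d F .t) + ∑ i, Y (.x i) * φ (𝒰.jet.d F (.x i)) := by
  classical
  have hinj : Function.Injective (Idx.x : Fin n → Idx N n) := fun i j h => by simpa using h
  rw [vfa_eq_of_subset (s := insert .t (Finset.univ.image Idx.x)) fun b hb => ?_,
    Finset.sum_insert (by simp), Finset.sum_image hinj.injOn]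
  by_contra h
  simp only [Finset.mem_insert, Finset.mem_image, Finset.mem_univ, true_and, not_or,
    not_exists] at h
  exact Finsupp.mem_support_iff.1 hb (hF.indepOf h.1 fun i hi => h.2 i hi.symm).pd_eq_zero

theorem IsBase.vf_eq {f : Base n → ℝ} {F : 𝒰.R} (hF : 𝒰.IsBase f F)
    (Y : Idx N n → 𝒰.R) : vf 𝒰.jet.d Y F
      = Y .t * 𝒰.jet.d F .t + ∑ i, Y (.x i) * 𝒰.jet.d F (.x i) := by
  rw [vf_eq_vfa]
  exact hF.vfa_eq _ Y

theorem IsBase.D_eq {f : Base n → ℝ} {F : 𝒰.R} (hF : 𝒰.IsBase f F) (i : Fin n) :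
    𝒰.jet.D i F = 𝒰.jet.d F (.x i) := by
  rw [JetAlg.D, hF.vf_eq]
  simp [JetAlg.compD]

theorem IsBase.Dt_eq {f : Base n → ℝ} {F : 𝒰.R} (hF : 𝒰.IsBase f F) (g : 𝒰.R) :
    𝒰.jet.Dt g F = 𝒰.jet.d F .t := by
  rw [JetAlg.Dt, hF.vf_eq]
  simp [JetAlg.compDt]

theorem IsBase.Ds_eq {f : Base n → ℝ} {F : 𝒰.R} (hF : 𝒰.IsBase f F) : 𝒰.jet.Ds F = 0 := by
  rw [JetAlg.Ds, hF.vf_eq]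
  simp

theorem IsBase.D {f : Base n → ℝ} {F : 𝒰.R} (hF : 𝒰.IsBase f F) (i : Fin n) :
    𝒰.IsBase (baseDx i f) (𝒰.jet.D i F) :=
  ⟨contDiffOn_baseDx 𝒰.isOpen_B hF.1 i, fun q => by rw [hF.D_eq, hF.d_x]⟩

theorem IsBase.Dt {f : Base n → ℝ} {F : 𝒰.R} (hF : 𝒰.IsBase f F) (g : 𝒰.R) :
    𝒰.IsBase (baseDt f) (𝒰.jet.Dt g F) :=
  ⟨contDiffOn_baseDt 𝒰.isOpen_B hF.1, fun q => by rw [hF.Dt_eq, hF.d_t]⟩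

theorem IsBase.iterate_Dt {f : Base n → ℝ} {F : 𝒰.R} (hF : 𝒰.IsBase f F) (g : 𝒰.R) (k : ℕ) :
    𝒰.IsBase (baseDt^[k] f) ((𝒰.jet.Dt g)^[k] F) := by
  induction k with
  | zero => exact hF
  | succ k ih => simp only [Function.iterate_succ_apply']; exact ih.Dt g

theorem multiIter_rel {A A' : Type*} {P : A → A' → Prop} {D : Fin n → A → A}
    {D' : Fin n → A' → A'} (hD : ∀ i F F', P F F' → P (D i F) (D' i F')) (α : Fin n → ℕ) {F : A}
    {F' : A'} (hF : P F F') : P (multiIter D α F) (multiIter D' α F') := by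
  rw [multiIter, multiIter]
  induction List.finRange n with
  | nil => exact hF
  | cons i l ih =>
    rw [List.foldr_cons, List.foldr_cons]
    induction α i with
    | zero => exact ih
    | succ m ihm =>
      rw [Function.iterate_succ_apply', Function.iterate_succ_apply']; exact hD i _ _ ihm

theorem IsBase.multiIter {f : Base n → ℝ} {F : 𝒰.R} (hF : 𝒰.IsBase f F) (α : Fin n → ℕ) :
    𝒰.IsBase (multiIter baseDx α f) (multiIter (fun i => ⇑(𝒰.jet.D i)) α F) :=
  multiIter_rel (fun i _ _ h => h.D i) α hF

variable (𝒰)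

/-- The reference function. -/
def ref : 𝒰.R := Cyl.mk _ (𝒰.isCyl_base 𝒰.smooth)

theorem isBase_ref : 𝒰.IsBase 𝒰.v 𝒰.ref := isBase_mk 𝒰.smooth

/-- The jet coordinates of the reference function. -/
def refJet (c : Coord N n) : 𝒰.R := Cyl.mk _ (𝒰.isCyl_base (𝒰.contDiffOn_jetOf c))

theorem isBase_refJet (c : Coord N n) :
    𝒰.IsBase (fun p => (jetOf 𝒰.v p : Jet N n).2 c) (𝒰.refJet c) :=
  isBase_mk (𝒰.contDiffOn_jetOf c)

theorem refJet_eq (g : 𝒰.R) (c : Coord N n) : 𝒰.refJet c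
    = (𝒰.jet.Dt g)^[c.1.1] (multiIter (fun i => ⇑(𝒰.jet.D i)) c.2 𝒰.ref) :=
  (𝒰.isBase_refJet c).unique ((𝒰.isBase_ref.multiIter c.2).iterate_Dt g c.1.1)

/-- The `N`-th derivative of the reference function with respect to `t`. -/
def refTop : 𝒰.R := (𝒰.jet.Dt 0)^[N] 𝒰.ref

theorem isBase_refTop : 𝒰.IsBase (baseDt^[N] 𝒰.v) 𝒰.refTop := 𝒰.isBase_ref.iterate_Dt 0 N

/-- On functions of `(t, x)` the derivation `Dt g` is the plain t-derivative whatever `g` is, so the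
choice `g = 0` in `refTop` is immaterial. -/
theorem refTop_eq (g : 𝒰.R) : 𝒰.refTop = (𝒰.jet.Dt g)^[N] 𝒰.ref :=
  𝒰.isBase_refTop.unique (𝒰.isBase_ref.iterate_Dt g N)

theorem D_iterate_Dt (g : 𝒰.R) (i : Fin n) (k : ℕ) (F : 𝒰.R) :
    𝒰.jet.D i ((𝒰.jet.Dt g)^[k] F) = (𝒰.jet.Dt g)^[k] (𝒰.jet.D i F) := by
  induction k with
  | zero => rfl
  | succ k ih => simp only [Function.iterate_succ_apply']; rw [𝒰.jet.D_Dt, ih]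

theorem D_refJet (i : Fin n) (c : Coord N n) :
    𝒰.jet.D i (𝒰.refJet c) = 𝒰.refJet (c.1, c.2 + Pi.single i 1) := by
  rw [𝒰.refJet_eq 0, 𝒰.refJet_eq 0, D_iterate_Dt, multiIter_add_single _ 𝒰.jet.D_comm]

theorem Dt_refJet (g : 𝒰.R) (c : Coord N n) : 𝒰.jet.Dt g (𝒰.refJet c)
    = if h : c.1.1 + 1 < N then 𝒰.refJet (⟨c.1.1 + 1, h⟩, c.2)
      else multiIter (fun i => ⇑(𝒰.jet.D i)) c.2 𝒰.refTop := by
  rw [𝒰.refJet_eq g, ← Function.iterate_succ_apply' (f := 𝒰.jet.Dt g)]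
  split_ifs with h
  · rw [𝒰.refJet_eq g]
  · have h1 : c.1.1.succ = N := by have := c.1.2; omega
    rw [h1, 𝒰.refTop_eq g]
    have h2 : ∀ k, (𝒰.jet.Dt g)^[k] (multiIter (fun i => ⇑(𝒰.jet.D i)) c.2 𝒰.ref)
        = multiIter (fun i => ⇑(𝒰.jet.D i)) c.2 ((𝒰.jet.Dt g)^[k] 𝒰.ref) := fun k => by
      induction k with
      | zero => rfl
      | succ k ih =>
        simp only [Function.iterate_succ_apply']
        rw [ih, 𝒰.jet.derivation_multiIter fun i F => 𝒰.jet.D_Dt g i F]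
    exact h2 N

theorem multiIter_refJet (j : Fin N) (α : Fin n → ℕ) :
    multiIter (fun i => ⇑(𝒰.jet.D i)) α (𝒰.refJet (j, 0)) = 𝒰.refJet (j, α) := by
  induction α using multiIter_induction with
  | h0 => simp only [multiIter_zero]
  | hs α i ih => rw [multiIter_add_single _ 𝒰.jet.D_comm, ih, D_refJet]

theorem hom_s : 𝒰.hom (𝒰.jet.y .s) = 1 := rfl
theorem hom_t : 𝒰.hom (𝒰.jet.y .t) = 𝒰.jet.y .t := rfl
theorem hom_x (i : Fin n) : 𝒰.hom (𝒰.jet.y (.x i)) = 𝒰.jet.y (.x i) := rfl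
theorem hom_u (c : Coord N n) : 𝒰.hom (𝒰.jet.y (.u c))
    = 𝒰.jet.y .s * 𝒰.jet.y (.u c) + (1 - 𝒰.jet.y .s) * 𝒰.refJet c := rfl

theorem hom_D (i : Fin n) (F : 𝒰.R) : 𝒰.hom (𝒰.jet.D i F) = 𝒰.jet.D i (𝒰.hom F) := by
  refine 𝒰.vf_pull_comm _ _ (fun b => ?_) F
  change 𝒰.jet.D i (𝒰.hom (𝒰.jet.y b)) = 𝒰.hom (𝒰.jet.compD i b)
  match b with
  | .s => simp [hom_s, JetAlg.compD]
  | .t => simp [hom_t, JetAlg.compD, JetAlg.D_t]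
  | .x k =>
    rw [hom_x, JetAlg.D, JetAlg.vf_y, JetAlg.compD]
    split_ifs <;> simp
  | .u c =>
    have h1 : 𝒰.jet.D i (𝒰.jet.y (.u c)) = 𝒰.jet.y (.u (c.1, c.2 + Pi.single i 1)) := by
      rw [JetAlg.D, JetAlg.vf_y, JetAlg.compD]
    rw [JetAlg.compD, hom_u, hom_u, map_add, Derivation.leibniz, Derivation.leibniz, map_sub,
      𝒰.jet.D_s, D_refJet, h1, Derivation.map_one_eq_zero]
    simp only [smul_eq_mul, mul_zero, sub_zero, add_zero]

/-- The deviation of the homotopy from being compatible with the total derivative in `t`. -/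
def defect (g : 𝒰.R) : 𝒰.R :=
  𝒰.hom g - 𝒰.jet.y .s * g + (1 - 𝒰.jet.y .s) * 𝒰.refTop

/-- The characteristics of the homotopy. -/
def char (j : Fin N) : 𝒰.R := 𝒰.jet.y (.u (j, 0)) - 𝒰.refJet (j, 0)

theorem D_one_sub_s (i : Fin n) : 𝒰.jet.D i (1 - 𝒰.jet.y .s) = 0 := by
  rw [map_sub, 𝒰.jet.D_s, Derivation.map_one_eq_zero, sub_zero]

/-- On a top variable, differentiating u_(s) gives D^α(-s g + (1-s) ∂_t^N ũ), whereas substituting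
into the eliminated derivative gives -D^α g[u_(s)]. The difference is D^α of `defect`; all other
coordinates agree. -/
theorem hom_Dt (g : 𝒰.R) {l : Fin N} (hl : l.1 + 1 = N) (F : 𝒰.R) :
    𝒰.jet.Dt g (𝒰.hom F) = 𝒰.hom (𝒰.jet.Dt g F) + 𝒰.jet.evo 𝒰.hom l (𝒰.defect g) F := by
  rw [JetAlg.Dt, map_vf]
  change _ = _ + vfa _ _ _ _
  rw [← vfa_add_field]
  refine (𝒰.vf_pull _ _ _ _).trans ?_
  change vfa 𝒰.jet.d 𝒰.hom _ F = _
  congr 1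
  ext1 b
  change 𝒰.jet.Dt g (𝒰.hom (𝒰.jet.y b)) = _
  match b with
  | .s => simp [hom_s, JetAlg.compDt, JetAlg.prol]
  | .t => simp [hom_t, JetAlg.compDt, JetAlg.Dt_t, JetAlg.prol]
  | .x k => simp [hom_x, JetAlg.compDt, JetAlg.Dt_x, JetAlg.prol]
  | .u c =>
    have h1 : 𝒰.jet.Dt g (𝒰.jet.y (.u c)) = 𝒰.jet.compDt g (.u c) := by
      rw [JetAlg.Dt, JetAlg.vf_y]
    rw [hom_u, map_add, Derivation.leibniz, Derivation.leibniz, map_sub, 𝒰.jet.Dt_s, h1,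
      Derivation.map_one_eq_zero, Dt_refJet]
    simp only [JetAlg.compDt, JetAlg.prol, smul_eq_mul, mul_zero, sub_zero, add_zero]
    split_ifs with h2 h3 h3
    · exact absurd h2 (by rw [h3]; omega)
    · rw [hom_u, add_zero]
    · rw [map_neg, defect, multiIter_add, 𝒰.jet.multiIter_sub, 𝒰.jet.multiIter_mul_left 𝒰.jet.D_s,
        𝒰.jet.multiIter_mul_left 𝒰.D_one_sub_s]
      have h4 := 𝒰.jet.linearMap_multiIter (X := 𝒰.hom.toLinearMap) 𝒰.hom_D c.2 g
      simp only [AlgHom.toLinearMap_apply] at h4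
      rw [h4]
      ring
    · exact absurd (Fin.ext (by have := c.1.2; omega)) h3

theorem hom_Ds (F : 𝒰.R) : 𝒰.jet.Ds (𝒰.hom F) = ∑ j, 𝒰.jet.evo 𝒰.hom j (𝒰.char j) F := by
  change _ = ∑ j, vfa _ _ _ _
  rw [← vfa_sum_field]
  refine (𝒰.vf_pull _ _ _ _).trans ?_
  change vfa 𝒰.jet.d 𝒰.hom _ F = _
  congr 1
  ext1 b
  change 𝒰.jet.Ds (𝒰.hom (𝒰.jet.y b)) = _
  match b with
  | .s => simp [hom_s, JetAlg.prol]
  | .t => simp [hom_t, JetAlg.Ds, JetAlg.vf_y, JetAlg.prol]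
  | .x k => simp [hom_x, JetAlg.Ds, JetAlg.vf_y, JetAlg.prol]
  | .u c =>
    simp only [JetAlg.prol, Finset.sum_ite_eq, Finset.mem_univ, if_true]
    rw [hom_u, map_add, Derivation.leibniz, Derivation.leibniz, map_sub, 𝒰.jet.Ds_s, 𝒰.jet.Ds_y,
      (𝒰.isBase_refJet c).Ds_eq, Derivation.map_one_eq_zero, char, JetAlg.multiIter_sub,
      JetAlg.multiIter_y, multiIter_refJet]
    simp only [smul_eq_mul]
    ring

theorem isHomotopy {g : 𝒰.R} (hg : g.IndepOf .s) {l : Fin N} (hl : l.1 + 1 = N) :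
    𝒰.jet.IsHomotopy g 𝒰.hom l (𝒰.defect g) (-g - 𝒰.refTop) 𝒰.char where
  last := hl
  D := 𝒰.hom_D
  Dt := 𝒰.hom_Dt g hl
  Ds := 𝒰.hom_Ds
  Dt_w j := by
    rw [char, map_sub, Dt_refJet, JetAlg.Dt, JetAlg.vf_y, JetAlg.compDt]
    simp only [multiIter_zero]
    split_ifs <;> rfl
  Ds_ρ := by
    have h1 : 𝒰.jet.Ds g = 0 := by
      rw [JetAlg.Ds_eq]
      exact hg.pd_eq_zero
    rw [defect, map_add, map_sub, Derivation.leibniz, Derivation.leibniz, map_sub, 𝒰.jet.Ds_s, h1,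
      𝒰.isBase_refTop.Ds_eq, Derivation.map_one_eq_zero]
    simp only [smul_eq_mul]
    ring

theorem evalFun_eq (r : Set.Icc (0 : ℝ) 1) (q : 𝒰.W) :
    𝒰.evalFun r q = ⟨_, 𝒰.update_mem q.1 q.2 r r.2⟩ := Subtype.ext (ofJet_toJet _ _)

theorem ev_apply (r : Set.Icc (0 : ℝ) 1) (F : 𝒰.R) (q : 𝒰.W) :
    𝒰.ev r F q = F (𝒰.evalFun r q) := rfl

theorem ev_y (r : Set.Icc (0 : ℝ) 1) {b : Idx N n} (hb : b ≠ .s) :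
    𝒰.ev r (𝒰.jet.y b) = 𝒰.jet.y b := by
  match b with
  | .s => exact absurd rfl hb
  | .t => rfl
  | .x i => rfl
  | .u c => rfl

variable {𝒰} in
theorem ev_of_indepOf {F : 𝒰.R} (hF : F.IndepOf .s) (r : Set.Icc (0 : ℝ) 1) : 𝒰.ev r F = F :=
  Cyl.ext fun q => by rw [ev_apply, evalFun_eq]; exact hF q _ _

variable {𝒰} in
theorem indepOf_of_ev {F : 𝒰.R} (r : Set.Icc (0 : ℝ) 1) (hF : 𝒰.ev r F = F) : F.IndepOf .s := by
  intro q x h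
  rw [← hF, ev_apply, ev_apply]
  exact congrArg F.1 (Subtype.ext (by simp [evalFun]))

theorem indepOf_y {b : Idx N n} (hb : b ≠ .s) : (𝒰.jet.y b).IndepOf .s :=
  indepOf_of_ev 0 (𝒰.ev_y 0 hb)

theorem ev_D (r : Set.Icc (0 : ℝ) 1) (i : Fin n) (F : 𝒰.R) :
    𝒰.ev r (𝒰.jet.D i F) = 𝒰.jet.D i (𝒰.ev r F) := by
  refine 𝒰.vf_pull_comm _ _ (fun b => ?_) F
  change 𝒰.jet.D i (𝒰.ev r (𝒰.jet.y b)) = 𝒰.ev r (𝒰.jet.compD i b)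
  match b with
  | .s =>
    have : 𝒰.ev r (𝒰.jet.y .s) = algebraMap ℝ 𝒰.R r := rfl
    rw [this, Derivation.map_algebraMap, JetAlg.compD, map_zero]
  | .t => rw [𝒰.ev_y r (by simp), JetAlg.D_t, JetAlg.compD, map_zero]
  | .x k =>
    rw [𝒰.ev_y r (by simp), JetAlg.D, JetAlg.vf_y, JetAlg.compD]
    split_ifs <;> simp
  | .u c => rw [𝒰.ev_y r (by simp), JetAlg.D, JetAlg.vf_y, JetAlg.compD, 𝒰.ev_y r (by simp)]

variable {𝒰} in
theorem indepOf_D {F : 𝒰.R} (hF : F.IndepOf .s) (i : Fin n) : (𝒰.jet.D i F).IndepOf .s :=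
  indepOf_of_ev 0 (by rw [ev_D, ev_of_indepOf hF])

variable {𝒰} in
theorem indepOf_neg {F : 𝒰.R} (hF : F.IndepOf .s) : (-F).IndepOf .s :=
  indepOf_of_ev 0 (by rw [map_neg, ev_of_indepOf hF])

theorem indepOf_zero : (0 : 𝒰.R).IndepOf .s := fun _ _ _ => rfl

theorem indepOf_one : (1 : 𝒰.R).IndepOf .s := fun _ _ _ => rfl

theorem indepOf_compD (i : Fin n) (b : Idx N n) : (𝒰.jet.compD i b).IndepOf .s := by
  match b with
  | .s => exact 𝒰.indepOf_zero
  | .t => exact 𝒰.indepOf_zero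
  | .x k =>
    rw [JetAlg.compD]
    split_ifs
    · exact 𝒰.indepOf_one
    · exact 𝒰.indepOf_zero
  | .u c => exact 𝒰.indepOf_y (by simp)

variable {𝒰} in
theorem indepOf_compDt {g : 𝒰.R} (hg : g.IndepOf .s) (b : Idx N n) :
    (𝒰.jet.compDt g b).IndepOf .s := by
  match b with
  | .s => exact 𝒰.indepOf_zero
  | .t => exact 𝒰.indepOf_one
  | .x k => exact 𝒰.indepOf_zero
  | .u c =>
    rw [JetAlg.compDt]
    split_ifs
    · exact 𝒰.indepOf_y (by simp)
    · exact indepOf_neg (multiIter_invariant (P := fun F : 𝒰.R => F.IndepOf .s)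
        (fun i F hF => indepOf_D hF i) c.2 hg)

variable {𝒰} in
theorem ev_Dt (r : Set.Icc (0 : ℝ) 1) {g : 𝒰.R} (hg : g.IndepOf .s) (F : 𝒰.R) :
    𝒰.ev r (𝒰.jet.Dt g F) = 𝒰.jet.Dt g (𝒰.ev r F) := by
  refine 𝒰.vf_pull_comm _ _ (fun b => ?_) F
  change 𝒰.jet.Dt g (𝒰.ev r (𝒰.jet.y b)) = 𝒰.ev r (𝒰.jet.compDt g b)
  rw [ev_of_indepOf (indepOf_compDt hg b)]
  by_cases hb : b = .s
  · subst hb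
    have : 𝒰.ev r (𝒰.jet.y .s) = algebraMap ℝ 𝒰.R r := rfl
    rw [this, Derivation.map_algebraMap, JetAlg.compDt]
  · rw [𝒰.ev_y r hb, JetAlg.Dt, JetAlg.vf_y]

/-- Components independent of s pass through the integral, and the partial derivatives other than
the one in s commute with it. -/
theorem vf_avgS {Y : Idx N n → 𝒰.R} (hs : Y .s = 0) (hY : ∀ b, (Y b).IndepOf .s) (F : 𝒰.R) :
    vf 𝒰.jet.d Y (𝒰.avgS F) = 𝒰.avgS (vf 𝒰.jet.d Y F) := by
  classical
  set A := (𝒰.jet.d F).support ∪ (𝒰.jet.d (𝒰.avgS F)).support with hA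
  rw [vf_eq_vfa, vf_eq_vfa, vfa_eq_of_subset (s := A) Finset.subset_union_right,
    vfa_eq_of_subset (s := A) Finset.subset_union_left, map_sum]
  refine Finset.sum_congr rfl fun b _ => ?_
  simp only [AlgHom.id_apply]
  by_cases hb : b = .s
  · rw [hb, hs, zero_mul, zero_mul, map_zero]
  · rw [avgS, avg_mul _ _ (hY b)]
    congr 1
    exact pd_avg _ 𝒰.update_mem hb F

theorem isAverage {g : 𝒰.R} (hg : g.IndepOf .s) :
    𝒰.jet.IsAverage g 𝒰.avgS (𝒰.ev 0) (𝒰.ev 1) where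
  D i F := 𝒰.vf_avgS rfl (𝒰.indepOf_compD i) F
  Dt F := 𝒰.vf_avgS rfl (indepOf_compDt hg) F
  Ds F := by
    rw [JetAlg.Ds_eq]
    refine Cyl.ext fun q => (avg_pd_self _ 𝒰.update_mem F q).trans ?_
    rw [Cyl.sub_apply, ev_apply, ev_apply, evalFun_eq, evalFun_eq]
    rfl
  t_mul F := avg_mul _ _ (𝒰.indepOf_y (by simp)) F
  x_mul i F := avg_mul _ _ (𝒰.indepOf_y (by simp)) F
  e₀_s := rfl
  e₁_s := rfl

theorem ev_one_hom (F : 𝒰.R) : 𝒰.ev 1 (𝒰.hom F) = 𝒰.ev 1 F := by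
  refine Cyl.ext fun q => ?_
  change F (𝒰.homFun (𝒰.evalFun 1 q)) = F (𝒰.evalFun 1 q)
  refine congrArg F.1 (Subtype.ext ?_)
  change ofJet 1 (interp 𝒰.v 1 (toJet q.1)) = ofJet 1 (toJet q.1)
  rw [interp_one]

variable {𝒰} in
theorem ev_one_defect (g : 𝒰.R) : 𝒰.ev 1 (𝒰.defect g) = 0 := by
  have : 𝒰.ev 1 (𝒰.jet.y .s) = 1 := rfl
  rw [defect, map_add, map_sub, map_mul, map_mul, map_sub, map_one, this, ev_one_hom]
  ring

theorem ev_zero_defect (g : 𝒰.R) : 𝒰.ev 0 (𝒰.defect g) = 𝒰.ev 0 (𝒰.hom g) + 𝒰.refTop := by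
  have : 𝒰.ev 0 (𝒰.jet.y .s) = 0 := rfl
  rw [defect, map_add, map_sub, map_mul, map_mul, map_sub, map_one, this,
    ev_of_indepOf (𝒰.isBase_refTop.indepOf (by simp) (by simp))]
  ring

/-- The functions of the independent variables. -/
def baseAlg : Subalgebra ℝ 𝒰.R where
  carrier := {F | ∃ f, 𝒰.IsBase f F}
  mul_mem' := by
    rintro F G ⟨f, hf⟩ ⟨g, hg⟩
    exact ⟨_, hf.1.mul hg.1, fun q => by rw [Cyl.mul_apply, hf.2, hg.2]⟩
  add_mem' := by
    rintro F G ⟨f, hf⟩ ⟨g, hg⟩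
    exact ⟨_, hf.1.add hg.1, fun q => by rw [Cyl.add_apply, hf.2, hg.2]⟩
  algebraMap_mem' c := ⟨fun _ => c, contDiffOn_const, fun q => rfl⟩

theorem contDiffOn_comp_jetOf (F : 𝒰.R) : ContDiffOn ℝ ∞
    (fun p => extZero F (ofJet 1 (jetOf 𝒰.v p : Jet N n))) 𝒰.B := by
  obtain ⟨S, f, hf⟩ := F.isCyl
  have h0 : ∀ p ∈ 𝒰.B, ofJet 1 (jetOf 𝒰.v p : Jet N n) ∈ 𝒰.W := fun p hp =>
    𝒰.ofJet_mem (by simp) (𝒰.jetOf_mem hp)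
  have h1 : ContDiffOn ℝ ∞ (fun p => f (res S (ofJet 1 (jetOf 𝒰.v p : Jet N n)))) 𝒰.B := by
    intro p hp
    refine ContDiffAt.comp_contDiffWithinAt (g := f) p (hf ⟨_, h0 p hp⟩).1 ?_
    refine contDiffWithinAt_pi.2 fun b => ?_
    obtain ⟨b, -⟩ := b
    match b with
    | .s => exact contDiffWithinAt_const
    | .t => exact contDiffWithinAt_fst
    | .x i =>
      exact (contDiff_apply ℝ ℝ i).comp_contDiffWithinAt contDiffWithinAt_snd
    | .u c => exact 𝒰.contDiffOn_jetOf c p hp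
  exact h1.congr fun p hp => by rw [extZero_of_mem _ (h0 p hp), (hf _).2]

theorem ev_zero_hom_apply (F : 𝒰.R) (q : 𝒰.W) : 𝒰.ev 0 (𝒰.hom F) q
    = F ⟨ofJet 1 (jetOf 𝒰.v (toJet q.1).1), 𝒰.ofJet_mem (by simp) (𝒰.jetOf_mem (fst_mem q.2.1))⟩ := by
  change F (𝒰.homFun (𝒰.evalFun 0 q)) = _
  refine congrArg F.1 (Subtype.ext ?_)
  change ofJet 1 (interp 𝒰.v 0 (toJet q.1)) = _
  rw [interp_zero]

theorem ev_zero_hom_mem (F : 𝒰.R) : 𝒰.ev 0 (𝒰.hom F) ∈ 𝒰.baseAlg :=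
  ⟨_, 𝒰.contDiffOn_comp_jetOf F, fun q => by rw [ev_zero_hom_apply, extZero_of_mem]⟩

/-- The average sees only the base point, so replacing u by ũ does not change it, and
`ev_zero_hom_mem` applies. -/
theorem avgS_scale_mem (F : 𝒰.R) (k : ℕ) : 𝒰.avgS (𝒰.jet.y .s ^ k * 𝒰.scale F) ∈ 𝒰.baseAlg := by
  convert 𝒰.ev_zero_hom_mem (𝒰.avgS (𝒰.jet.y .s ^ k * 𝒰.scale F)) using 1
  refine Cyl.ext fun q => ?_
  rw [ev_zero_hom_apply, avgS, avg_apply, avg_apply]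
  refine intervalIntegral.integral_congr fun r hr => ?_
  rw [Set.uIcc_of_le zero_le_one] at hr
  simp only [extZero_of_mem _ (𝒰.update_mem _ q.2 r hr), extZero_of_mem _ (𝒰.update_mem _
    (𝒰.ofJet_mem (s := 1) (by simp) (𝒰.jetOf_mem (fst_mem q.2.1))) r hr), Cyl.mul_apply,
    Cyl.pow_apply]
  congr 1

theorem isScaled {g F : 𝒰.R} (hF : F ∈ 𝒰.baseAlg) :
    𝒰.jet.IsScaled g (𝒰.ev 1) 𝒰.scale F := by
  obtain ⟨f, hf⟩ := hF
  have ht : 𝒰.scale (𝒰.jet.y .t) = 𝒰.jet.y .s * 𝒰.jet.y .t := rfl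
  have hx : ∀ i, 𝒰.scale (𝒰.jet.y (.x i)) = 𝒰.jet.y .s * 𝒰.jet.y (.x i) := fun _ => rfl
  have key : ∀ Y, vf 𝒰.jet.d Y (𝒰.scale F)
      = vf 𝒰.jet.d Y (𝒰.jet.y .s * 𝒰.jet.y .t) * 𝒰.scale (𝒰.jet.d F .t)
      + ∑ i, vf 𝒰.jet.d Y (𝒰.jet.y .s * 𝒰.jet.y (.x i)) * 𝒰.scale (𝒰.jet.d F (.x i)) := fun Y => by
    refine (𝒰.vf_pull _ _ _ _).trans ?_
    rw [hf.vfa_eq]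
    rfl
  refine ⟨fun i => ?_, ?_, ?_, ?_⟩
  · rw [hf.D_eq, JetAlg.D, key]
    simp [Derivation.leibniz, JetAlg.vf_y, JetAlg.compD]
  · rw [hf.Dt_eq, JetAlg.Dt, key]
    simp [Derivation.leibniz, JetAlg.vf_y, JetAlg.compDt]
  · rw [hf.Dt_eq, JetAlg.Ds, key]
    simp [Derivation.leibniz, JetAlg.vf_y, hf.D_eq]
  · refine Cyl.ext fun q => ?_
    change F (𝒰.scaleFun (𝒰.evalFun 1 q)) = _
    rw [hf.2, hf.2]
    congr 1
    change (1 : ℝ) • (toJet q.1).1 = _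
    rw [one_smul]

/-- The construction formula in the algebra of smooth functions. -/
theorem construction (hn : 0 < n) {g : 𝒰.R} (hg : g.IndepOf .s) {l : Fin N} (hl : l.1 + 1 = N)
    {Φt : 𝒰.R} {Φx : Fin n → 𝒰.R} (hΦ : 𝒰.jet.Dt g Φt + ∑ i, 𝒰.jet.D i (Φx i) = 0)
    (ht : Φt.IndepOf .s) (hx : ∀ i, (Φx i).IndepOf .s) {K : ℕ}
    (hKΦ : 𝒰.jet.HasOrder K Φt) (hKg : 𝒰.jet.HasOrder K g) {Λ : 𝒰.R}
    (hΛ : Λ = 𝒰.jet.E K l Φt) (hKΛ : 𝒰.jet.HasOrder K Λ) :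
    ∃ (θ : Fin n → 𝒰.R) (ψ : Fin n → Fin n → 𝒰.R), (∀ i k, ψ i k = -ψ k i) ∧
      Φt - (𝒰.avgS (∑ j, 𝒰.char j * 𝒰.hom (𝒰.jet.E K j Φt)) + 𝒰.jet.y .t *
        𝒰.avgS (𝒰.jet.y .s ^ n * 𝒰.scale (𝒰.ev 0 (𝒰.defect g * 𝒰.hom Λ))))
        = ∑ i, 𝒰.jet.D i (θ i) ∧
      ∀ i, Φx i - (𝒰.jet.y (.x i) *
          𝒰.avgS (𝒰.jet.y .s ^ n * 𝒰.scale (𝒰.ev 0 (𝒰.defect g * 𝒰.hom Λ)))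
          + 𝒰.avgS (∑ j, bdry 𝒰.jet.D K LinearMap.id i (𝒰.char j)
              (fun I => 𝒰.hom (𝒰.jet.pS j g I) * 𝒰.hom Λ)
            + ∑ j, bdry 𝒰.jet.D K LinearMap.id i (𝒰.char j)
              (fun I => 𝒰.hom (𝒰.jet.pS j Λ I) * 𝒰.defect g)))
        = -𝒰.jet.Dt g (θ i) + ∑ k, 𝒰.jet.D k (ψ i k) := by
  refine JetAlg.construction_formula hn (𝒰.isAverage hg) (𝒰.isHomotopy hg hl) (𝒰.ev_D 0) (𝒰.ev_D 1)
    (ev_Dt 0 hg) (ev_one_defect g) 𝒰.baseAlg (fun F hF => 𝒰.isScaled hF) ?_ ?_ ?_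
    𝒰.ev_zero_hom_mem ?_ (fun F => 𝒰.avgS_scale_mem F n) hΦ ?_ ?_ hKΦ hKg hΛ hKΛ
  · rintro i F ⟨f, hf⟩
    exact ⟨_, hf.D i⟩
  · exact ⟨fun p => p.1, contDiffOn_fst, fun _ => rfl⟩
  · exact fun i => ⟨fun p => p.2 i, (contDiff_apply ℝ ℝ i).comp_contDiffOn contDiffOn_snd,
      fun _ => rfl⟩
  · rw [ev_zero_defect]
    exact 𝒰.baseAlg.add_mem (𝒰.ev_zero_hom_mem g) ⟨_, 𝒰.isBase_refTop⟩
  · rw [ev_one_hom, ev_of_indepOf ht]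
  · exact fun i => by rw [ev_one_hom, ev_of_indepOf (hx i)]

end Region

end

end CKScalar

/-! ### Translation between functions on the jet space and the algebra. -/

namespace CKScalar

noncomputable section

variable {N n : ℕ}

/-- A point near `trunc s z` lifts to `U` by keeping the remaining coordinates of `z`. Openness
turns the `ContDiffOn` of `IsDiffFun` into smoothness at each point. -/
theorem isOpen_trunc_image {U : Set (Jet N n)} (hU : IsOpen U) (s : Finset (Coord N n)) :
    IsOpen (trunc s '' U) := by
  classical
  refine isOpen_iff_mem_nhds.2 ?_
  rintro _ ⟨z, hz, rfl⟩
  have h1 : Continuous fun y : Base n × (s → ℝ) =>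
      ((y.1, fun c => if h : c ∈ s then y.2 ⟨c, h⟩ else z.2 c) : Jet N n) := by
    refine continuous_fst.prodMk (continuous_pi fun c => ?_)
    split_ifs
    · exact (continuous_apply _).comp continuous_snd
    · exact continuous_const
  have h2 : ((trunc s z).1, fun c => if h : c ∈ s then (trunc s z).2 ⟨c, h⟩ else z.2 c) = z := by
    refine Prod.ext rfl (funext fun c => ?_)
    simp only [trunc]
    split_ifs <;> rfl
  have h3 := h1.continuousAt (x := trunc s z) |>.preimage_mem_nhds (t := U)
    (by rw [h2]; exact hU.mem_nhds hz)
  refine Filter.mem_of_superset h3 fun y hy => ⟨_, hy, ?_⟩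
  refine Prod.ext rfl (funext fun c => ?_)
  simp [trunc]

theorem listIter_rel {A A' : Type*} {P : A → A' → Prop} {D : Fin n → A → A}
    {D' : Fin n → A' → A'} (hD : ∀ i F F', P F F' → P (D i F) (D' i F')) (I : List (Fin n)) {F : A}
    {F' : A'} (hF : P F F') : P (listIter D I F) (listIter D' I F') := by
  induction I with
  | nil => exact hF
  | cons i I ih => exact hD i _ _ ih

namespace JetAlg

variable {R : Type} [CommRing R] [Algebra ℝ R] (𝒥 : JetAlg N n R)

theorem E_eq_of_le {K L : ℕ} (h : K ≤ L) {F : R} (hF : 𝒥.HasOrder K F) (j : Fin N) :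
    𝒥.E L j F = 𝒥.E K j F := by
  refine (Finset.sum_subset (strs_mono h) fun I _ hI => ?_).symm
  rw [mem_strs, not_le] at hI
  rw [𝒥.pS_eq_zero hF j hI, listIter_zero, mul_zero]

/-- The functions `Ω_q`. -/
def om (K : ℕ) (g Λ : R) (q : ℕ) : R :=
  (-1 : ℝ) ^ q • (𝒥.Dt g)^[q] Λ + ∑ l : Fin N, if l.1 < q then
    (-1 : ℝ) ^ (q - (l.1 + 1)) • (𝒥.Dt g)^[q - (l.1 + 1)] (eul 𝒥.D K fun I => 𝒥.pS l.rev g I * Λ)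
    else 0

/-- Each old term acquires a factor `-Dt`, and the new summand, `l = q`, enters undifferentiated. -/
theorem om_succ (K : ℕ) (g Λ : R) (q : Fin N) : 𝒥.om K g Λ (q.1 + 1)
    = -𝒥.Dt g (𝒥.om K g Λ q.1) + eul 𝒥.D K fun I => 𝒥.pS q.rev g I * Λ := by
  have h1 : ∀ l : Fin N, (if l.1 < q.1 + 1 then (-1 : ℝ) ^ (q.1 + 1 - (l.1 + 1)) •
      (𝒥.Dt g)^[q.1 + 1 - (l.1 + 1)] (eul 𝒥.D K fun I => 𝒥.pS l.rev g I * Λ) else 0)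
      = -𝒥.Dt g (if l.1 < q.1 then (-1 : ℝ) ^ (q.1 - (l.1 + 1)) •
        (𝒥.Dt g)^[q.1 - (l.1 + 1)] (eul 𝒥.D K fun I => 𝒥.pS l.rev g I * Λ) else 0)
        + if l = q then eul 𝒥.D K fun I => 𝒥.pS l.rev g I * Λ else 0 := fun l => by
    rcases lt_trichotomy l.1 q.1 with h | h | h
    · have h2 : l ≠ q := fun h3 => by rw [h3] at h; exact lt_irrefl _ h
      have h3 : q.1 + 1 - (l.1 + 1) = (q.1 - (l.1 + 1)) + 1 := by omega
      rw [if_pos (by omega), if_pos h, if_neg h2, h3, Function.iterate_succ_apply', pow_succ,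
        Derivation.map_smul]
      simp
    · have h2 : l = q := Fin.ext h
      subst h2
      simp
    · have h2 : l ≠ q := fun h3 => by rw [h3] at h; exact lt_irrefl _ h
      rw [if_neg (by omega), if_neg (by omega), if_neg h2]
      simp
  rw [om, Finset.sum_congr rfl fun l _ => h1 l, om, map_add, Finset.sum_add_distrib, map_sum,
    Finset.sum_ite_eq' Finset.univ q, if_pos (Finset.mem_univ q), Finset.sum_neg_distrib,
    Derivation.map_smul, pow_succ, Function.iterate_succ_apply']
  simp only [mul_neg, mul_one, neg_smul]
  abel

/-- `om_succ` and `EPred_eq` are the same recursion, run downwards from the top position, where both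
start at `Λ`. -/
theorem om_eq_E {g : R} {l : Fin N} (hl : l.1 + 1 = N)
    {Φt : R} {Φx : Fin n → R} (hΦ : 𝒥.Dt g Φt + ∑ i, 𝒥.D i (Φx i) = 0) {K : ℕ}
    (hKΦ : 𝒥.HasOrder K Φt) (hKg : 𝒥.HasOrder K g) {Λ : R} (hΛ : Λ = 𝒥.E K l Φt)
    (hKΛ : 𝒥.HasOrder K Λ) (q : ℕ) (hq : q < N) :
    𝒥.om K g Λ q = 𝒥.E K (Fin.rev ⟨q, hq⟩) Φt := by
  induction q with
  | zero =>
    have h1 : Fin.rev ⟨0, hq⟩ = l := Fin.ext (by simp only [Fin.val_rev]; omega)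
    rw [h1, ← hΛ, om]
    simp
  | succ q ih =>
    have h1 := 𝒥.EPred_eq hl hΦ hKΦ hKg hΛ hKΛ (Fin.rev ⟨q, by omega⟩)
    rw [← ih (by omega), EPred, dif_pos (by simp only [Fin.val_rev]; omega)] at h1
    rw [𝒥.om_succ K g Λ ⟨q, by omega⟩, ← h1]
    congr 1

end JetAlg

namespace Region

variable {𝒰 : Region N n}

/-- The point of the domain of the homotopy with given parameter and jet. -/
def pt (s : Set.Icc (0 : ℝ) 1) (z : 𝒰.U) : 𝒰.W := ⟨ofJet s z.1, 𝒰.ofJet_mem s.2 z.2⟩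

variable (𝒰) in
/-- The function `G` on the jet space is the element `F` at the homotopy parameter `s`. -/
def Rep (s : Set.Icc (0 : ℝ) 1) (G : Jet N n → ℝ) (F : 𝒰.R) : Prop :=
  ∀ z : 𝒰.U, G z = F (pt s z)

variable {s : Set.Icc (0 : ℝ) 1} {G : Jet N n → ℝ} {F : 𝒰.R}

theorem pt_one (q : 𝒰.W) : 𝒰.evalFun 1 q = pt 1 ⟨toJet q.1, q.2.1⟩ := rfl

theorem Rep.of_indepOf (h : 𝒰.Rep s G F) (hF : F.IndepOf .s) (r : Set.Icc (0 : ℝ) 1) :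
    𝒰.Rep r G F := fun z => by
  rw [h z, ← ev_of_indepOf hF r, ev_apply, ev_apply]
  rfl

/-- `Rep` says nothing about points with parameter outside [0,1]; independence of s moves them to
the parameter 1. -/
theorem eq_of_rep {F' : 𝒰.R} (h : 𝒰.Rep s G F) (h' : 𝒰.Rep s G F') (hF : F.IndepOf .s)
    (hF' : F'.IndepOf .s) : F = F' := Cyl.ext fun q => by
  rw [← ev_of_indepOf hF 1, ← ev_of_indepOf hF' 1, ev_apply, ev_apply, pt_one,
    ← h.of_indepOf hF 1, ← h'.of_indepOf hF' 1]

/-- An element of the algebra as a function on the jet space. -/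
def toFun (F : 𝒰.R) (z : Jet N n) : ℝ :=
  open Classical in if h : z ∈ 𝒰.U then F (pt 1 ⟨z, h⟩) else 0

theorem rep_toFun (F : 𝒰.R) : 𝒰.Rep 1 (toFun F) F := fun z => dif_pos z.2

theorem Rep.deriv_eq (h : 𝒰.Rep s G F) (z : 𝒰.U) (b : Idx N n) (hb : b ≠ .s) :
    deriv (fun r => G (toJet (Function.update (ofJet s z.1) b r))) (ofJet s z.1 b)
      = 𝒰.jet.d F b (pt s z) := by
  refine Filter.EventuallyEq.deriv_eq ?_
  filter_upwards [eventually_update_mem (pt s z) b] with r hr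
  change Function.update (ofJet s z.1) b r ∈ 𝒰.W at hr
  have h1 : ofJet s (toJet (Function.update (ofJet s z.1) b r))
      = Function.update (ofJet s z.1) b r := by
    rw [ofJet_toJet, Function.update_eq_self_iff, Function.update_of_ne hb.symm]
    rfl
  refine (h ⟨_, hr.1⟩).trans ((extZero_of_mem F.1 hr).trans (congrArg F.1 (Subtype.ext h1.symm))).symm

theorem Rep.pCoord (h : 𝒰.Rep s G F) (c : Coord N n) :
    𝒰.Rep s (pCoord c G) (𝒰.jet.d F (.u c)) := fun z => by
  rw [← h.deriv_eq z (.u c) (by simp)]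
  refine congrArg (fun f => deriv f (z.1.2 c)) (funext fun r => congrArg G ?_)
  refine Prod.ext (Prod.ext rfl rfl) (funext fun c' => ?_)
  by_cases hc : c' = c
  · subst hc; simp [toJet]
  · simp [toJet, ofJet, hc]

theorem Rep.pT (h : 𝒰.Rep s G F) : 𝒰.Rep s (pT G) (𝒰.jet.d F .t) := fun z => by
  rw [← h.deriv_eq z .t (by simp)]
  exact congrArg (fun f => deriv f z.1.1.1) (funext fun r => congrArg G
    (Prod.ext (Prod.ext (by simp [toJet]) rfl) rfl))

theorem Rep.pX (h : 𝒰.Rep s G F) (i : Fin n) :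
    𝒰.Rep s (pX i G) (𝒰.jet.d F (.x i)) := fun z => by
  rw [← h.deriv_eq z (.x i) (by simp)]
  refine congrArg (fun f => deriv f (z.1.1.2 i)) (funext fun r => congrArg G ?_)
  refine Prod.ext (Prod.ext rfl (funext fun k => ?_)) rfl
  by_cases hk : k = i
  · subst hk; simp [toJet]
  · simp [toJet, ofJet, hk]

theorem vf_apply (Y : Idx N n → 𝒰.R) (F : 𝒰.R) (q : 𝒰.W) : vf 𝒰.jet.d Y F q
    = Y .s q * 𝒰.jet.d F .s q + Y .t q * 𝒰.jet.d F .t q + ∑ i, Y (.x i) q * 𝒰.jet.d F (.x i) q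
      + ∑ᶠ c, Y (.u c) q * 𝒰.jet.d F (.u c) q := by
  classical
  have hx : Function.Injective (Idx.x : Fin n → Idx N n) := fun i j h => by simpa using h
  have hu : Function.Injective (Idx.u : Coord N n → Idx N n) := fun i j h => by simpa using h
  set A : Finset (Coord N n) := (𝒰.jet.d F).support.preimage Idx.u hu.injOn with hA
  have h1 : (𝒰.jet.d F).support ⊆ insert .s (insert .t (Finset.univ.image Idx.x ∪ A.image Idx.u)) :=
    fun b hb => by
      match b with
      | .s => simp
      | .t => simp
      | .x i => simp
      | .u c =>
        refine Finset.mem_insert_of_mem (Finset.mem_insert_of_mem (Finset.mem_union_right _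
          (Finset.mem_image_of_mem _ ?_)))
        rwa [hA, Finset.mem_preimage]
  rw [vf_eq_vfa, vfa_eq_of_subset h1, Cyl.sum_apply, Finset.sum_insert (by simp),
    Finset.sum_insert (by simp), Finset.sum_union (by
      rw [Finset.disjoint_left]
      intro b hb hb'
      simp only [Finset.mem_image, Finset.mem_univ, true_and] at hb hb'
      obtain ⟨i, rfl⟩ := hb
      obtain ⟨c, -, hc⟩ := hb'
      cases hc), Finset.sum_image hx.injOn, Finset.sum_image hu.injOn,
    finsum_eq_sum_of_support_subset (s := A) _ fun c hc => ?_]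
  · simp only [AlgHom.id_apply, Cyl.mul_apply, add_assoc]
  · rw [hA, Finset.mem_coe, Finset.mem_preimage, Finsupp.mem_support_iff]
    intro h
    exact hc (by beta_reduce; rw [h, Cyl.zero_apply, mul_zero])

theorem Rep.totD (h : 𝒰.Rep s G F) (i : Fin n) : 𝒰.Rep s (totD i G) (𝒰.jet.D i F) := fun z => by
  rw [JetAlg.D, vf_apply, CKScalar.totD, h.pX i z]
  congr 1
  · simp only [JetAlg.compD, Cyl.zero_apply, zero_mul, zero_add]
    rw [Finset.sum_eq_single i (fun k _ hk => by rw [if_neg hk, Cyl.zero_apply, zero_mul])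
      (fun h => absurd (Finset.mem_univ i) h), if_pos rfl, Cyl.one_apply, one_mul]
  · exact finsum_congr fun c => by rw [h.pCoord c z]; rfl

theorem Rep.multiIter (h : 𝒰.Rep s G F) (α : Fin n → ℕ) :
    𝒰.Rep s (multiIter CKScalar.totD α G) (multiIter (fun i => ⇑(𝒰.jet.D i)) α F) :=
  multiIter_rel (P := 𝒰.Rep s) (fun i _ _ h => h.totD i) α h

theorem Rep.listIter (h : 𝒰.Rep s G F) (I : List (Fin n)) :
    𝒰.Rep s (listIter CKScalar.totD I G) (listIter (fun i => ⇑(𝒰.jet.D i)) I F) :=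
  listIter_rel (P := 𝒰.Rep s) (fun i _ _ h => h.totD i) I h

variable {g : Jet N n → ℝ} {γ : 𝒰.R}

theorem Rep.solDt (hg : 𝒰.Rep s g γ) (h : 𝒰.Rep s G F) :
    𝒰.Rep s (solDt g G) (𝒰.jet.Dt γ F) := fun z => by
  rw [JetAlg.Dt, vf_apply, CKScalar.solDt, h.pT z]
  congr 1
  · simp [JetAlg.compDt]
  · refine finsum_congr fun c => ?_
    rw [h.pCoord c z]
    congr 1
    simp only [JetAlg.compDt]
    split_ifs
    · rfl
    · rw [Cyl.neg_apply, hg.multiIter c.2 z]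

theorem Rep.iterate_solDt (hg : 𝒰.Rep s g γ) (h : 𝒰.Rep s G F) (k : ℕ) :
    𝒰.Rep s ((CKScalar.solDt g)^[k] G) ((𝒰.jet.Dt γ)^[k] F) := by
  induction k with
  | zero => exact h
  | succ k ih => simp only [Function.iterate_succ_apply']; exact hg.solDt ih

theorem Rep.mul {G' : Jet N n → ℝ} {F' : 𝒰.R} (h : 𝒰.Rep s G F) (h' : 𝒰.Rep s G' F') :
    𝒰.Rep s (fun z => G z * G' z) (F * F') := fun z => by
  beta_reduce
  rw [Cyl.mul_apply, h z, h' z]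

theorem Rep.pString (h : 𝒰.Rep s G F) (j : Fin N) (I : List (Fin n)) :
    𝒰.Rep s (pString j I G) (𝒰.jet.pS j F I) := fun z => by
  rw [JetAlg.pS, Cyl.smul_apply, ← h.pCoord _ z, CKScalar.pString, wt, ← length_eq_sum_cnt]
  rfl

/-- Strings longer than the order bound contribute zero, so the `finsum` has finite support and does
not fall back to its default value. -/
theorem Rep.adjLin {W : Jet N n → ℝ} {ω' : 𝒰.R} (h : 𝒰.Rep s G F) (hW : 𝒰.Rep s W ω') {K : ℕ}
    (hK : 𝒰.jet.HasOrder K F) (j : Fin N) :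
    𝒰.Rep s (adjLin j G W) (eul 𝒰.jet.D K fun I => 𝒰.jet.pS j F I * ω') := fun z => by
  have h1 : ∀ I, CKScalar.listIter CKScalar.totD I (fun y => CKScalar.pString j I G y * W y) z
      = CKScalar.listIter (fun i => ⇑(𝒰.jet.D i)) I (𝒰.jet.pS j F I * ω') (pt s z) := fun I =>
    ((h.pString j I).mul hW).listIter I z
  rw [CKScalar.adjLin, finsum_eq_sum_of_support_subset (s := strs n K) _ fun I hI => ?_, eul,
    Cyl.sum_apply]
  · refine Finset.sum_congr rfl fun I _ => ?_
    rw [h1, Cyl.mul_apply, Cyl.pow_apply, Cyl.neg_apply, Cyl.one_apply]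
  · rw [Finset.mem_coe, mem_strs]
    by_contra h2
    refine hI ?_
    beta_reduce
    rw [h1, 𝒰.jet.pS_eq_zero hK j (not_le.1 h2), zero_mul, listIter_zero, Cyl.zero_apply, mul_zero]

theorem Rep.om {L : Jet N n → ℝ} {Λ : 𝒰.R} (hg : 𝒰.Rep s g γ) (hL : 𝒰.Rep s L Λ) {K : ℕ}
    (hK : 𝒰.jet.HasOrder K γ) (q : ℕ) : 𝒰.Rep s (Om g L q) (𝒰.jet.om K γ Λ q) := fun z => by
  rw [Om, JetAlg.om, Cyl.add_apply, Cyl.smul_apply, Cyl.sum_apply, hg.iterate_solDt hL q z]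
  congr 1
  refine Finset.sum_congr rfl fun l _ => ?_
  split_ifs
  · rw [Cyl.smul_apply, hg.iterate_solDt (hg.adjLin hL hK l.rev) _ z]
  · rfl

theorem Rep.interp (h : 𝒰.Rep 1 G F) (s : Set.Icc (0 : ℝ) 1) :
    𝒰.Rep s (fun z => G (interp 𝒰.v s z)) (𝒰.hom F) := fun z =>
  h ⟨_, 𝒰.seg z.1 z.2 s s.2⟩

theorem Rep.trilin {V W : Jet N n → ℝ} {w w' : 𝒰.R} (hg : 𝒰.Rep s g γ) (hG : 𝒰.Rep 1 G F)
    (hV : 𝒰.Rep s V w) (hW : 𝒰.Rep s W w') {K : ℕ} (hK : 𝒰.jet.HasOrder K F) (i : Fin n) :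
    𝒰.Rep s (trilin g 𝒰.v s i V W G) (∑ j : Fin N, bdry 𝒰.jet.D K LinearMap.id i
      ((𝒰.jet.Dt γ)^[j.1] w) (fun I => 𝒰.hom (𝒰.jet.pS j F I) * w')) := fun z => by
  rw [CKScalar.trilin, Cyl.sum_apply]
  refine Finset.sum_congr rfl fun j _ => ?_
  have h1 : ∀ P : List (Fin n) × List (Fin n), (-1) ^ P.2.length
      * CKScalar.listIter CKScalar.totD P.1 ((CKScalar.solDt g)^[j.1] V) z
      * CKScalar.listIter CKScalar.totD P.2
          (fun y => CKScalar.pString j (i :: (P.1 ++ P.2)) G (CKScalar.interp 𝒰.v s y) * W y) z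
      = (-1) ^ P.2.length
      * CKScalar.listIter (fun i => ⇑(𝒰.jet.D i)) P.1 ((𝒰.jet.Dt γ)^[j.1] w) (pt s z)
      * CKScalar.listIter (fun i => ⇑(𝒰.jet.D i)) P.2
          (𝒰.hom (𝒰.jet.pS j F (i :: (P.1 ++ P.2))) * w') (pt s z) := fun P => by
    rw [(hg.iterate_solDt hV j.1).listIter P.1 z,
      (((hG.pString j (i :: (P.1 ++ P.2))).interp s).mul hW).listIter P.2 z]
  rw [finsum_congr h1, finsum_eq_sum_of_support_subset (s := strs n K ×ˢ strs n K) _ fun P hP => ?_,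
    bdry, Cyl.sum_apply]
  · refine Finset.sum_congr rfl fun I _ => ?_
    rw [Cyl.mul_apply, Cyl.mul_apply, Cyl.pow_apply, Cyl.neg_apply, Cyl.one_apply]
    rfl
  · rw [Finset.mem_coe, Finset.mem_product, mem_strs, mem_strs]
    by_contra h2
    refine hP ?_
    beta_reduce
    rw [𝒰.jet.pS_eq_zero hK j, map_zero, zero_mul, listIter_zero, Cyl.zero_apply, mul_zero]
    simp only [List.length_cons, List.length_append]
    omega

theorem Rep.integral {f : ℝ → Jet N n → ℝ} (h : ∀ r : Set.Icc (0 : ℝ) 1, 𝒰.Rep r (f r) F) :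
    𝒰.Rep s (fun z => ∫ r in (0 : ℝ)..1, f r z) (𝒰.avgS F) := fun z => by
  rw [avgS, avg_apply]
  refine intervalIntegral.integral_congr fun r hr => ?_
  rw [Set.uIcc_of_le zero_le_one] at hr
  simp only [extZero_of_mem _ (𝒰.update_mem _ (pt s z).2 r hr)]
  refine (h ⟨r, hr⟩ z).trans (congrArg F.1 (Subtype.ext ?_))
  exact ofJet_toJet (ofJet s z.1) r

theorem rep_char (j : Fin N) :
    𝒰.Rep s (fun z => z.2 (j, 0) - (baseDt)^[j.1] 𝒰.v z.1) (𝒰.char j) := fun z => by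
  rw [char, Cyl.sub_apply, (𝒰.isBase_refJet (j, 0)).2]
  change _ = z.1.2 (j, 0) - baseDt^[j.1] (CKScalar.multiIter baseDx 0 𝒰.v) z.1.1
  rw [multiIter_zero]

theorem rep_defect (hg : ∀ r, 𝒰.Rep r g γ) (s : Set.Icc (0 : ℝ) 1) :
    𝒰.Rep s (fun z => g (CKScalar.interp 𝒰.v s z) - s * g z + (1 - s) * (baseDt)^[N] 𝒰.v z.1)
      (𝒰.defect γ) := fun z => by
  rw [defect, Cyl.add_apply, Cyl.sub_apply, Cyl.mul_apply, Cyl.mul_apply, Cyl.sub_apply,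
    𝒰.isBase_refTop.2, ← (hg 1).interp s z]
  beta_reduce
  rw [hg s z]
  rfl

/-- Interpolation fixes jets of the reference function, so at parameter 0 the defect there is its
residual in the PDE. -/
theorem rep_Kfun {L : Jet N n → ℝ} {Λ : 𝒰.R} (hg : ∀ r, 𝒰.Rep r g γ) (hL : 𝒰.Rep 1 L Λ) :
    𝒰.Rep s (fun z => Kfun g L 𝒰.v ((s : ℝ) • z.1))
      (𝒰.scale (𝒰.ev 0 (𝒰.defect γ * 𝒰.hom Λ))) := fun z => by
  have hz : (jetOf 𝒰.v ((s : ℝ) • z.1.1) : Jet N n) ∈ 𝒰.U :=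
    𝒰.jetOf_mem (𝒰.ray _ (fst_mem z.2) s s.2)
  have h1 := rep_defect hg 0 ⟨_, hz⟩
  have h2 := hL.interp 0 ⟨_, hz⟩
  simp only [Set.Icc.coe_zero, interp_jetOf, zero_mul, sub_zero, one_mul] at h1 h2
  change _ = (𝒰.defect γ * 𝒰.hom Λ) (pt 0 ⟨_, hz⟩)
  rw [Cyl.mul_apply, ← h1, ← h2, add_comm]
  rfl

theorem exists_rep {G : Jet N n → ℝ} (hG : IsDiffFun 𝒰.U G) :
    ∃ F : 𝒰.R, F.IndepOf .s ∧ ∀ r, 𝒰.Rep r G F := by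
  obtain ⟨S, f, hf, hGf⟩ := hG
  have h1 : IsCyl 𝒰.W fun q => G (toJet q.1) := by
    refine isCyl_comp (K := Option (Fin n) ⊕ S)
      (Sum.elim (fun | none => fun q => q.1 .t | some i => fun q => q.1 (.x i))
        fun c q => q.1 (.u c))
      (fun k => ?_)
      (fun y => f ((y (.inl none), fun i => y (.inl (some i))), fun c => y (.inr c))) (fun q => ?_)
      (fun q => hGf _ q.2.1)
    · match k with
      | .inl none => exact isCyl_coord _
      | .inl (some i) => exact isCyl_coord _
      | .inr c => exact isCyl_coord _
    · have h2 : ContDiffAt ℝ ∞ f (trunc S (toJet q.1)) :=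
        hf.contDiffAt ((isOpen_trunc_image 𝒰.isOpen S).mem_nhds ⟨_, q.2.1, rfl⟩)
      refine ContDiffAt.comp (g := f) _ h2 (ContDiff.contDiffAt ?_)
      exact ((contDiff_apply ℝ ℝ _).prodMk (contDiff_pi.2 fun i => contDiff_apply ℝ ℝ _)).prodMk
        (contDiff_pi.2 fun i => contDiff_apply ℝ ℝ _)
  refine ⟨Cyl.mk _ h1, fun q r h => ?_, fun r z => rfl⟩
  rw [Cyl.mk_apply, Cyl.mk_apply]
  simp

theorem Rep.isDiffFun (h : 𝒰.Rep s G F) : IsDiffFun 𝒰.U G := by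
  obtain ⟨S, f, hf⟩ := F.isCyl
  have hu : Function.Injective (Idx.u : Coord N n → Idx N n) := fun i j h => by simpa using h
  set e : Base n × (S.preimage Idx.u hu.injOn → ℝ) → S → ℝ := fun y b =>
    match b with
    | ⟨.s, _⟩ => s
    | ⟨.t, _⟩ => y.1.1
    | ⟨.x i, _⟩ => y.1.2 i
    | ⟨.u c, hc⟩ => y.2 ⟨c, Finset.mem_preimage.2 hc⟩ with he
  have he' : ∀ z, e (trunc _ z) = res S (ofJet s z) := fun z => by
    ext b
    obtain ⟨b, hb⟩ := b
    match b with
    | .s => rfl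
    | .t => rfl
    | .x i => rfl
    | .u c => rfl
  have hec : ContDiff ℝ ∞ e := by
    refine contDiff_pi.2 fun b => ?_
    obtain ⟨b, hb⟩ := b
    match b with
    | .s => exact contDiff_const
    | .t => exact contDiff_fst.comp contDiff_fst
    | .x i => exact (contDiff_apply ℝ ℝ i).comp (contDiff_snd.comp contDiff_fst)
    | .u c => exact (contDiff_apply ℝ ℝ _).comp contDiff_snd
  refine ⟨S.preimage Idx.u hu.injOn, fun y => f (e y), ?_, fun z hz => ?_⟩
  · rintro _ ⟨z, hz, rfl⟩
    refine ContDiffAt.contDiffWithinAt (ContDiffAt.comp (g := f) _ ?_ hec.contDiffAt)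
    rw [he']
    exact (hf (pt s ⟨z, hz⟩)).1
  · rw [h ⟨z, hz⟩, (hf _).2]
    beta_reduce
    rw [he']
    rfl

/-- Below order N no derivative is eliminated, so D_t^j of u - ũ is the j-th characteristic. This
matches `trilin` with the boundary terms of `homotopy_law`. -/
theorem iterate_Dt_char (hγ : γ.IndepOf .s) (hN : 0 < N) (j : Fin N) :
    (𝒰.jet.Dt γ)^[j.1] (𝒰.char ⟨0, hN⟩) = 𝒰.char j := by
  obtain ⟨j, hj⟩ := j
  have h1 := (𝒰.isHomotopy hγ (l := ⟨N - 1, by omega⟩) (by simp only; omega)).Dt_w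
  induction j with
  | zero => rfl
  | succ j ih =>
    change (𝒰.jet.Dt γ)^[j + 1] _ = _
    rw [Function.iterate_succ_apply', ih (by omega), h1, dif_pos hj]

end Region

end

end CKScalar

/-! ### The construction formula on the jet space. -/

namespace CKScalar

noncomputable section

variable {N n : ℕ}

namespace Region

variable {𝒰 : Region N n} {g : Jet N n → ℝ} {γ : 𝒰.R}

theorem rep_formulaT (hg : ∀ r, 𝒰.Rep r g γ) {K : ℕ}
    (hKg : 𝒰.jet.HasOrder K γ) {L : Jet N n → ℝ} {Λ : 𝒰.R} (hL : 𝒰.Rep 1 L Λ) {Φ : 𝒰.R}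
    (hom_eq : ∀ q (hq : q < N), 𝒰.jet.om K γ Λ q = 𝒰.jet.E K (Fin.rev ⟨q, hq⟩) Φ) :
    𝒰.Rep 1 (formulaT g L 𝒰.v) (𝒰.avgS (∑ j, 𝒰.char j * 𝒰.hom (𝒰.jet.E K j Φ)) + 𝒰.jet.y .t *
        𝒰.avgS (𝒰.jet.y .s ^ n * 𝒰.scale (𝒰.ev 0 (𝒰.defect γ * 𝒰.hom Λ)))) := fun z => by
  rw [Cyl.add_apply, Cyl.mul_apply, formulaT]
  congr 1
  · refine Rep.integral (f := fun s z => ∑ j : Fin N,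
      (z.2 (j, 0) - (baseDt)^[j.1] 𝒰.v z.1) * Om g L j.rev.1 (CKScalar.interp 𝒰.v s z))
      (fun r z => ?_) z
    rw [Cyl.sum_apply]
    refine Finset.sum_congr rfl fun j _ => ?_
    have h1 := (((hg 1).om hL hKg j.rev.1).interp r) z
    rw [hom_eq _ j.rev.2, Fin.eta, Fin.rev_rev] at h1
    rw [Cyl.mul_apply, ← h1, ← rep_char j z]
  · congr 1
    refine Rep.integral (f := fun s z => s ^ n * Kfun g L 𝒰.v (s • z.1)) (fun r z => ?_) z
    rw [Cyl.mul_apply, Cyl.pow_apply, ← rep_Kfun hg hL z]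
    rfl

theorem rep_formulaX (hN : 0 < N) (hγ : γ.IndepOf .s) (hg : ∀ r, 𝒰.Rep r g γ) {K : ℕ}
    (hKg : 𝒰.jet.HasOrder K γ) {L : Jet N n → ℝ} {Λ : 𝒰.R} (hL : 𝒰.Rep 1 L Λ)
    (hKΛ : 𝒰.jet.HasOrder K Λ) (i : Fin n) :
    𝒰.Rep 1 (formulaX hN g L 𝒰.v i) (𝒰.jet.y (.x i) *
          𝒰.avgS (𝒰.jet.y .s ^ n * 𝒰.scale (𝒰.ev 0 (𝒰.defect γ * 𝒰.hom Λ)))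
          + 𝒰.avgS (∑ j, bdry 𝒰.jet.D K LinearMap.id i (𝒰.char j)
              (fun I => 𝒰.hom (𝒰.jet.pS j γ I) * 𝒰.hom Λ)
            + ∑ j, bdry 𝒰.jet.D K LinearMap.id i (𝒰.char j)
              (fun I => 𝒰.hom (𝒰.jet.pS j Λ I) * 𝒰.defect γ))) := fun z => by
  rw [Cyl.add_apply, Cyl.mul_apply, formulaX]
  congr 1
  · congr 1
    refine Rep.integral (f := fun s z => s ^ n * Kfun g L 𝒰.v (s • z.1)) (fun r z => ?_) z
    rw [Cyl.mul_apply, Cyl.pow_apply, ← rep_Kfun hg hL z]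
    rfl
  · have h0 : 𝒰.Rep 1 (Om g L 0) Λ := fun z => by
      rw [← hL z]
      simp [Om]
    refine Rep.integral (f := fun s z => CKScalar.trilin g 𝒰.v s i
            (fun y => y.2 (⟨0, hN⟩, 0) - 𝒰.v y.1)
            (fun y => Om g L 0 (CKScalar.interp 𝒰.v s y)) g z
          + CKScalar.trilin g 𝒰.v s i (fun y => y.2 (⟨0, hN⟩, 0) - 𝒰.v y.1)
            (fun y => g (CKScalar.interp 𝒰.v s y) - s * g y + (1 - s) * (baseDt)^[N] 𝒰.v y.1)
            (Om g L 0) z) (fun r z => ?_) z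
    have h1 := (hg r).trilin (hg 1) (rep_char ⟨0, hN⟩) (h0.interp r) hKg i z
    have h2 := (hg r).trilin h0 (rep_char ⟨0, hN⟩) (rep_defect hg r) hKΛ i z
    simp only [iterate_Dt_char hγ hN] at h1 h2
    rw [Cyl.add_apply, ← h1, ← h2]
    rfl

end Region

end

end CKScalar

theorem theorem3p4 (N n : ℕ) (hN : 0 < N) (hn : 0 < n)
    -- the region of nonsingularity, and the PDE `∂ₜᴺ u + g = 0`
    (U : Set (CKScalar.Jet N n)) (hU : IsOpen U)
    (g : CKScalar.Jet N n → ℝ) (hg : CKScalar.IsDiffFun U g)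
    -- a conservation law in normal form and its multiplier
    (Φt : CKScalar.Jet N n → ℝ) (Φx : Fin n → CKScalar.Jet N n → ℝ)
    (hΦ : CKScalar.IsConservationLaw U g Φt Φx)
    (Λ : CKScalar.Jet N n → ℝ) (hΛ : Set.EqOn Λ (CKScalar.multiplier hN Φt) U)
    -- the reference function, chosen so that the integrands are nonsingular
    (v : CKScalar.Base n → ℝ) (hv : ContDiffOn ℝ ∞ v (Prod.fst '' U))
    (hseg : ∀ z ∈ U, ∀ s ∈ Set.Icc (0 : ℝ) 1, CKScalar.interp v s z ∈ U)
    (hray : ∀ p ∈ Prod.fst '' U, ∀ s ∈ Set.Icc (0 : ℝ) 1, s • p ∈ Prod.fst '' U) :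
    CKScalar.IsConservationLaw U g
        (CKScalar.formulaT g Λ v) (CKScalar.formulaX hN g Λ v) ∧
      CKScalar.IsTrivialLaw U g
        (fun z => Φt z - CKScalar.formulaT g Λ v z)
        (fun i z => Φx i z - CKScalar.formulaX hN g Λ v i z) := by
  open CKScalar Region in
  let 𝒰 : Region N n := ⟨U, hU, v, hv, hseg, hray⟩
  obtain ⟨γ, hγ, hgγ⟩ := exists_rep (𝒰 := 𝒰) hg
  obtain ⟨Pt, hPt, hΦt⟩ := exists_rep (𝒰 := 𝒰) hΦ.smooth_t
  choose Px hPx hΦx using fun i => exists_rep (𝒰 := 𝒰) (hΦ.smooth_x i)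
  -- Conservation is known on `U` only; independence of s makes it an identity in the algebra.
  have hcons : 𝒰.jet.Dt γ Pt + ∑ i, 𝒰.jet.D i (Px i) = 0 := by
    refine eq_of_rep (s := 1) (G := fun _ => 0) (fun z => ?_) (fun z => rfl) ?_ 𝒰.indepOf_zero
    · rw [Cyl.add_apply, Cyl.sum_apply, ← (hgγ 1).solDt (hΦt 1) z]
      refine (hΦ.conserved z.1 z.2).symm.trans ?_
      exact congrArg _ (Finset.sum_congr rfl fun i _ => (hΦx i 1).totD i z)
    · refine indepOf_of_ev 0 ?_
      rw [map_add, map_sum, ev_Dt 0 hγ, ev_of_indepOf hPt]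
      exact congrArg _ (Finset.sum_congr rfl fun i _ => by rw [ev_D, ev_of_indepOf (hPx i)])
  obtain ⟨K₀, hK₀⟩ := 𝒰.jet.exists_hasOrder Pt
  obtain ⟨K₁, hK₁⟩ := 𝒰.jet.exists_hasOrder γ
  set l : Fin N := ⟨N - 1, Nat.sub_lt hN Nat.one_pos⟩ with hl
  have hl' : l.1 + 1 = N := Nat.sub_add_cancel hN
  set M := 𝒰.jet.E K₀ l Pt with hM
  obtain ⟨K₂, hK₂⟩ := 𝒰.jet.exists_hasOrder M
  -- A common order bound for the density, `g` and the multiplier; by `E_eq_of_le` enlarging the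
  -- bound does not change the multiplier.
  set K := max K₀ (max K₁ K₂) with hK
  have hKΦ : 𝒰.jet.HasOrder K Pt := hK₀.mono _ (le_max_left _ _)
  have hKg : 𝒰.jet.HasOrder K γ := hK₁.mono _ ((le_max_left _ _).trans (le_max_right _ _))
  have hKM : 𝒰.jet.HasOrder K M := hK₂.mono _ ((le_max_right _ _).trans (le_max_right _ _))
  have hME : M = 𝒰.jet.E K l Pt := (𝒰.jet.E_eq_of_le (le_max_left _ _) hK₀ l).symm
  have hΛM : 𝒰.Rep 1 Λ M := fun z => by
    rw [hΛ z.2, multiplier, (hΦt 1).adjLin (W := fun _ => 1) (ω' := 1) (fun _ => rfl) hK₀ l z]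
    simp only [mul_one]
    rfl
  obtain ⟨θ, ψ, hψ, hθ, hx⟩ := 𝒰.construction hn hγ hl' hcons hPt hPx hKΦ hKg hME hKM
  have hT := rep_formulaT hgγ hKg hΛM (𝒰.jet.om_eq_E hl' hcons hKΦ hKg hME hKM)
  have hX := fun i => rep_formulaX hN hγ hgγ hKg hΛM hKM i
  -- Conservation of the formula is deduced from the triviality of its difference to the given law.
  have hcons' := JetAlg.conserved_of_trivial hcons hψ hθ hx
  refine ⟨⟨hT.isDiffFun, fun i => (hX i).isDiffFun, fun z hz => ?_⟩,
    fun i => toFun (θ i), fun i k => toFun (ψ i k), fun i => (rep_toFun (θ i)).isDiffFun,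
    fun i k => (rep_toFun (ψ i k)).isDiffFun, fun i k z hz => ?_, fun z hz => ?_,
    fun i z hz => ?_⟩
  · rw [(hgγ 1).solDt hT ⟨z, hz⟩, Finset.sum_congr rfl fun i _ => (hX i).totD i ⟨z, hz⟩,
      ← Cyl.sum_apply, ← Cyl.add_apply, hcons', Cyl.zero_apply]
  · beta_reduce
    rw [rep_toFun (ψ i k) ⟨z, hz⟩, rep_toFun (ψ k i) ⟨z, hz⟩, hψ i k, Cyl.neg_apply]
  · beta_reduce
    rw [hΦt 1 ⟨z, hz⟩, hT ⟨z, hz⟩, ← Cyl.sub_apply, hθ, Cyl.sum_apply]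
    exact Finset.sum_congr rfl fun i _ => ((rep_toFun (θ i)).totD i ⟨z, hz⟩).symm
  · beta_reduce
    rw [hΦx i 1 ⟨z, hz⟩, hX i ⟨z, hz⟩, ← Cyl.sub_apply, hx, Cyl.add_apply, Cyl.neg_apply,
      Cyl.sum_apply, (hgγ 1).solDt (rep_toFun (θ i)) ⟨z, hz⟩]
    exact congrArg _ (Finset.sum_congr rfl fun k _ =>
      ((rep_toFun (ψ i k)).totD k ⟨z, hz⟩).symm)
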